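/- **Setting.** Let $\lambda,\xi,\eta>0$ and let $3\le d_v<d_c$ be integers. A *$(d_v,d_c)$-regular code* is given by a binary parity-check matrix with $n\ge 1$ columns (variable nodes), each containing $d_v$ ones, and whose rows (check nodes) each contain $d_c$ ones; its Tanner graph is the corresponding bipartite graph, $g$ is the girth of that graph, and $\lfloor (g-2)/4\rfloor$ is the largest number of *independent* decoding iterations. *Channel.* At transmit power $P_T\ge 0$ the decoder sees a uniformly distributed codeword through a binary symmetric channel of flip probability $p_0=\mathbb Q(\sqrt{2\eta P_T})$, where $\mathbb Q(x)=\frac1{\sqrt{2\pi}}\int_x^\infty e^{-u^2/2}\,du$. *Gallager-A decoding.* In iteration $0$ each variable node sends its received bit to its neighbours. In each iteration a check node returns to each neighbour the parity of the messages of its other neighbours, and a variable node then sends to each neighbouring check node its received bit, unless all its other check nodes contradict that bit, in which case it sends the complement. The bit-error probability after $\ell$ iterations is the expected fraction of wrong variable-to-check messages in iteration $\ell$. *Wire Model.* The plane carries horizontal and vertical wiring tracks of width $\lambda$ and spacing $\lambda$; their overlaps are contact squares. Each node of the Tanner graph is a processing node, occupying one contact square if its degree $x$ is at most $4$ and a square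 of side $x\lambda$ otherwise; these squares are disjoint. Each edge is a wire that runs along tracks between its two processing nodes, passes over no processing node, and shares points with other wires only in contact squares, where the two wires cross orthogonally. The decoding power is $\xi A_{\mathrm{wires}}$, where $A_{\mathrm{wires}}$ is the total area occupied by the wires. *Total power.* For a class $\mathcal C$ of codes, $P_{\mathrm{total,min}}(\mathcal C,P_e)$ is the infimum of $P_T+\xi A_{\mathrm{wires}}$ over all $P_T\ge0$, all codes in $\mathcal C$, all numbers of independent Gallager-A iterations with bit-error probability at most $P_e$, and all layouts of the decoder. The power required by uncoded transmission is $P_{\mathrm{unc}}(P_e)=\inf\{P_T\ge 0:\mathbb Q(\sqrt{2\eta P_T})\le P_e\}$. Let $\Gamma=[\log((d_v-1)(d_c-1)),\,3\log(2d_vd_c+1)]$. A *code construction with constant $\gamma$* is a sequence $(C_N)_{N\ge0}$ of $(d_v,d_c)$-regular codes such that $C_N$ allows at least $N$ independent iterations and has blocklength $\Theta(e^{\gamma N})$. **Theorem.** There are absolute constants $0<c_1\le c_2$ such that the following holds for all $3\le d_v<d_c$. 1. For some $\gamma\in\Gamma$ there is a code construction with constant $\gamma$. For all $\lambda,\xi,\eta>0$,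 all $\gamma\in\Gamma$, if $\mathcal C$ is the class of all $(d_v,d_c)$-regular codes, or the set of codes of any code construction with constant $\gamma$, then for all sufficiently small $P_e>0$ $$c_1\,\frac{\frac{\gamma}{\eta}\log\frac1{P_e}}{\log\log\frac1{P_e}}\;\le\; P_{\mathrm{total,min}}(\mathcal C,P_e)\;\le\; c_2\,\frac{\frac{\gamma}{\eta}\log\frac1{P_e}}{\log\log\frac1{P_e}} .$$ 2. For $\mathcal C$ the class of all $(d_v,d_c)$-regular codes, $P_{\mathrm{unc}}(P_e)=\Theta\big(\log\log\frac1{P_e}\cdot P_{\mathrm{total,min}}(\mathcal C,P_e)\big)$ as $P_e\to0$, with constants that depend only on $d_v$ and $d_c$. 3. For all $\lambda,\xi,\eta>0$ and every fixed $P_T\ge0$ there are $a,b,k>0$ such that, for all sufficiently small $P_e>0$, every total power $P_T+\xi A_{\mathrm{wires}}$ with which bit-error probability $P_e$ is achieved at transmit power $P_T$ by a $(d_v,d_c)$-regular code with independent Gallager-A iterations is at least $k\,(1/P_e)^a$ and at least $e^{b P_{\mathrm{unc}}(P_e)}$. For all $\lambda,\xi,\eta>0$, every sufficiently large fixed $P_T$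 achieves every $P_e>0$. -/

import Mathlib

open Filter Topology

noncomputable section

/-! ### Channel -/

/-- Tail probability of the standard normal distribution. -/
def gaussQ (x : ℝ) : ℝ :=
  (1 / Real.sqrt (2 * Real.pi)) * ∫ u in Set.Ioi x, Real.exp (-u ^ 2 / 2)

/-- Flip probability of the binary symmetric channel obtained by hard decisions on BPSK symbols over
the AWGN channel with `E_s / N_0 = η * P_T`. -/
def flipProb (η PT : ℝ) : ℝ := gaussQ (Real.sqrt (2 * (η * PT)))

/-- Probability of the error pattern `e` when the symbols are flipped independently with
probability `p`. -/
def bscProb {n : ℕ} (p : ℝ) (e : Fin n → ZMod 2) : ℝ :=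
  ∏ v, if e v = 0 then 1 - p else p

/-- Power required by uncoded transmission to reach bit-error probability `Pe`. -/
def uncodedPower (η Pe : ℝ) : ℝ := sInf {PT : ℝ | 0 ≤ PT ∧ flipProb η PT ≤ Pe}

/-! ### Codes and their Tanner graphs -/

/-- A binary parity-check matrix with `n` columns (variable nodes) and `m` rows (check nodes). -/
structure Tanner where
  n : ℕ
  m : ℕ
  H : Matrix (Fin m) (Fin n) (ZMod 2)

namespace Tanner

variable (T : Tanner)

def checksOf (v : Fin T.n) : Finset (Fin T.m) := Finset.univ.filter fun c => T.H c v ≠ 0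

def varsOf (c : Fin T.m) : Finset (Fin T.n) := Finset.univ.filter fun v => T.H c v ≠ 0

def edges : Finset (Fin T.n × Fin T.m) := Finset.univ.filter fun e => T.H e.2 e.1 ≠ 0

/-- `(dv, dc)`-regular codes of positive blocklength. -/
def Regular (dv dc : ℕ) : Prop :=
  0 < T.n ∧ (∀ v, (T.checksOf v).card = dv) ∧ (∀ c, (T.varsOf c).card = dc)

/-- The bipartite Tanner graph. -/
def graph : SimpleGraph (Fin T.n ⊕ Fin T.m) :=
  SimpleGraph.fromRel fun a b => ∃ v c, a = Sum.inl v ∧ b = Sum.inr c ∧ T.H c v ≠ 0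

/-- The largest number of independent decoding iterations, `⌊(g - 2) / 4⌋` for girth `g`. -/
def maxIter : ℕ := (T.graph.girth - 2) / 4

def codewords : Finset (Fin T.n → ZMod 2) := Finset.univ.filter fun x => T.H.mulVec x = 0

/-! ### Gallager-A decoding -/

/-- The message from variable node `v` to check node `c` in iteration `ℓ` of Gallager-A decoding, for
the channel output `y`. A check node returns to each neighbour the parity of the messages of its other
neighbours; a variable node sends its channel value unless all the other check nodes
contradict it. -/
def varMsg (y : Fin T.n → ZMod 2) : ℕ → Fin T.n → Fin T.m → ZMod 2
  | 0, v, _ => y v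
  | ℓ + 1, v, c =>
      if ∀ c' ∈ (T.checksOf v).erase c,
          ∑ v' ∈ (T.varsOf c').erase v, varMsg y ℓ v' c' = y v + 1
      then y v + 1 else y v

/-- Average bit-error probability after `ℓ` iterations of Gallager-A decoding over the binary symmetric
channel with flip probability `p`: the expected fraction of edges `(v, c)` on which the estimate
of bit `v` that is sent in iteration `ℓ` is wrong, for a uniformly distributed codeword. -/
def bitErrorProb (p : ℝ) (ℓ : ℕ) : ℝ :=
  (∑ x ∈ T.codewords, ∑ e : Fin T.n → ZMod 2,
    bscProb p e *
      (((T.edges.filter fun a => T.varMsg (x + e) ℓ a.1 a.2 ≠ x a.1).card : ℝ)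
        / (T.edges.card : ℝ)))
    / (T.codewords.card : ℝ)

/-! ### VLSI layouts -/

/-- Number of external connections of a processing node. -/
def degree : Fin T.n ⊕ Fin T.m → ℕ
  | Sum.inl v => (T.checksOf v).card
  | Sum.inr c => (T.varsOf c).card

end Tanner

/-- The plane is cut into cells of side `λ`. The horizontal tracks are the rows of cells with even second
coordinate, the vertical tracks are the columns with even first coordinate (track width and track
spacing are both `λ`), and the contact squares are the cells with two even coordinates. -/
abbrev Cell := ℤ × ℤ

/-- Two neighbouring cells of one track. -/
def Cell.Step (p q : Cell) : Prop :=
  (Even p.1 ∧ p.1 = q.1 ∧ (q.2 = p.2 + 1 ∨ p.2 = q.2 + 1)) ∨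
    (Even p.2 ∧ p.2 = q.2 ∧ (q.1 = p.1 + 1 ∨ p.1 = q.1 + 1))

/-- The square of `s × s` cells with lower left cell `p`. -/
def Cell.square (p : Cell) (s : ℕ) : Set Cell :=
  {q | p.1 ≤ q.1 ∧ q.1 < p.1 + s ∧ p.2 ≤ q.2 ∧ q.2 < p.2 + s}

/-- A route passes straight through `p` in horizontal direction. -/
def Cell.StraightH (r : List Cell) (p : Cell) : Prop :=
  [(p.1 - 1, p.2), p, (p.1 + 1, p.2)] <:+: r ∨ [(p.1 + 1, p.2), p, (p.1 - 1, p.2)] <:+: r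

/-- A route passes straight through `p` in vertical direction. -/
def Cell.StraightV (r : List Cell) (p : Cell) : Prop :=
  [(p.1, p.2 - 1), p, (p.1, p.2 + 1)] <:+: r ∨ [(p.1, p.2 + 1), p, (p.1, p.2 - 1)] <:+: r

/-- Side, in cells, of a processing node with `x` external connections: a single contact square
if `x ≤ 4`, and a square of side `x λ` otherwise. -/
def nodeSide (x : ℕ) : ℕ := if x ≤ 4 then 1 else x

namespace Tanner

/-- A fully parallel planar layout of the decoder: one processing node for each node of the Tanner
graph, one wire for each of its edges. -/
structure Layout (T : Tanner) where
  /-- lower left cell of each processing node -/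
  pos : Fin T.n ⊕ Fin T.m → Cell
  pos_contact : ∀ a, Even (pos a).1 ∧ Even (pos a).2
  nodes_disjoint : ∀ a b, a ≠ b →
    Disjoint (Cell.square (pos a) (nodeSide (T.degree a)))
      (Cell.square (pos b) (nodeSide (T.degree b)))
  /-- the cells of the wire of an edge, from the variable node to the check node -/
  wire : Fin T.n → Fin T.m → List Cell
  /-- the cell of the variable node at which the wire is attached -/
  src : Fin T.n → Fin T.m → Cell
  /-- the cell of the check node at which the wire is attached -/
  dst : Fin T.n → Fin T.m → Cell
  src_mem : ∀ v c, (v, c) ∈ T.edges →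
    src v c ∈ Cell.square (pos (Sum.inl v)) (nodeSide (T.degree (Sum.inl v)))
  dst_mem : ∀ v c, (v, c) ∈ T.edges →
    dst v c ∈ Cell.square (pos (Sum.inr c)) (nodeSide (T.degree (Sum.inr c)))
  wire_ne_nil : ∀ v c, (v, c) ∈ T.edges → wire v c ≠ []
  wire_nodup : ∀ v c, (v, c) ∈ T.edges → (wire v c).Nodup
  /-- wires run along the tracks -/
  wire_chain : ∀ v c, (v, c) ∈ T.edges →
    List.IsChain Cell.Step (src v c :: (wire v c ++ [dst v c]))
  /-- no wire passes over a processing node -/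
  wire_avoids : ∀ v c, (v, c) ∈ T.edges → ∀ p ∈ wire v c, ∀ a,
    p ∉ Cell.square (pos a) (nodeSide (T.degree a))
  /-- distinct wires share a cell only where they cross orthogonally -/
  wire_cross : ∀ v c v' c', (v, c) ∈ T.edges → (v', c') ∈ T.edges → (v, c) ≠ (v', c') →
    ∀ p, p ∈ wire v c → p ∈ wire v' c' →
      (Cell.StraightH (src v c :: (wire v c ++ [dst v c])) p ∧
          Cell.StraightV (src v' c' :: (wire v' c' ++ [dst v' c'])) p) ∨
        (Cell.StraightV (src v c :: (wire v c ++ [dst v c])) p ∧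
          Cell.StraightH (src v' c' :: (wire v' c' ++ [dst v' c'])) p)

/-- Total area occupied by the wires, for feature size `lam`. -/
def Layout.wireArea {T : Tanner} (L : T.Layout) (lam : ℝ) : ℝ :=
  lam ^ 2 * ((T.edges.biUnion fun a => (L.wire a.1 a.2).toFinset).card : ℝ)

end Tanner

/-! ### Total power in the wire model -/

/-- The values of the total power `P_T + ξ * A_wires` with which bit-error probability `Pe` is achieved
at transmit power `PT` by a code of the class `𝒞`, a layout of its decoder, and a number of
independent Gallager-A iterations. -/
def totalPowersAt (𝒞 : Set Tanner) (lam ξ η Pe PT : ℝ) : Set ℝ :=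
  {P | ∃ T ∈ 𝒞, ∃ ℓ ≤ T.maxIter, ∃ L : T.Layout,
    T.bitErrorProb (flipProb η PT) ℓ ≤ Pe ∧ P = PT + ξ * L.wireArea lam}

/-- The optimal total power over the class `𝒞`, with free choice of the transmit power. -/
def totalPowerMin (𝒞 : Set Tanner) (lam ξ η Pe : ℝ) : ℝ :=
  sInf {P | ∃ PT, 0 ≤ PT ∧ P ∈ totalPowersAt 𝒞 lam ξ η Pe PT}

/-- The class of all `(dv, dc)`-regular codes. -/
def regularCodes (dv dc : ℕ) : Set Tanner := {T | T.Regular dv dc}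

/-- A construction of `(dv, dc)`-regular codes with growth rate `γ`: for each `N` a code that allows `N`
independent iterations, of blocklength `Θ(exp (γ N))`. -/
def IsConstruction (dv dc : ℕ) (γ : ℝ) (C : ℕ → Tanner) : Prop :=
  (∀ N, (C N).Regular dv dc ∧ N ≤ (C N).maxIter) ∧
    ∃ a A : ℝ, 0 < a ∧ ∀ N : ℕ,
      a * Real.exp (γ * N) ≤ ((C N).n : ℝ) ∧ ((C N).n : ℝ) ≤ A * Real.exp (γ * N)

/-- The range of the constant `γ`. -/
def gammaRange (dv dc : ℕ) : Set ℝ :=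
  Set.Icc (Real.log (((dv : ℝ) - 1) * ((dc : ℝ) - 1))) (3 * Real.log (2 * (dv : ℝ) * (dc : ℝ) + 1))

/-- The scale `(γ / η) * log (1 / Pe) / log (log (1 / Pe))`. -/
def powerScale (γ η Pe : ℝ) : ℝ :=
  γ / η * Real.log (1 / Pe) / Real.log (Real.log (1 / Pe))

end

/-!
While the girth exceeds `4 ℓ`, the messages of the first `ℓ` iterations depend on disjoint parts of
the error pattern, so the bit-error probability follows density evolution from the flip probability
`p` of the channel and lies between `p ^ (ℓ + 1)` and `(2 (dv dc)² p) ^ (ℓ + 1)`. As `log (1 / p)`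
is of the order of `η P_T`, error probability `Pe` forces `(ℓ + 1) η P_T ≳ log (1 / Pe)`. The
computation trees embed in the code, so the blocklength is at least `((dv - 1) (dc - 1)) ^ ℓ`, and
the wire area is at least linear in the blocklength. A total power below `log (1 / Pe)` therefore
allows only `O (log log (1 / Pe))` iterations, which is the lower bound on `P_T`.

Conversely, adding edges between far apart nodes yields regular codes of large girth and blocklength
`exp (O (ℓ))`. Placing all nodes in a row and giving each edge a track of its own is a layout of
area cubic in the blocklength, which is negligible against the transmit power for
`ℓ = ⌊log log (1 / Pe) / (6 γ)⌋`.
-/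

/-! ### Tails of the normal distribution -/

lemma integrable_exp_neg_sq_div_two :
    MeasureTheory.Integrable fun u : ℝ => Real.exp (-u ^ 2 / 2) := by
  simpa only [neg_mul, one_div_mul_eq_div, neg_div] using
    integrable_exp_neg_mul_sq (b := 1 / 2) (by norm_num)

lemma integral_Ioi_zero_exp_neg_sq_div_two :
    ∫ u in Set.Ioi (0 : ℝ), Real.exp (-u ^ 2 / 2) = Real.sqrt (2 * Real.pi) / 2 := by
  have gaussian := integral_gaussian_Ioi (1 / 2)
  rw [show Real.pi / (1 / 2) = 2 * Real.pi by ring] at gaussian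
  simpa only [neg_mul, one_div_mul_eq_div, neg_div] using gaussian

lemma setIntegral_Ioi_eq_setIntegral_Ioi_zero (f : ℝ → ℝ) (x : ℝ) :
    ∫ u in Set.Ioi x, f u = ∫ u in Set.Ioi (0 : ℝ), f (u + x) := by
  rw [← (MeasureTheory.measurePreserving_add_right MeasureTheory.volume x).setIntegral_preimage_emb
    (measurableEmbedding_addRight x) f (Set.Ioi x), Set.preimage_add_const_Ioi, sub_self]

lemma gaussQ_le_exp_neg_sq_div_two {x : ℝ} (hx : 0 ≤ x) :
    gaussQ x ≤ Real.exp (-x ^ 2 / 2) / 2 := by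
  have tail_le : ∫ u in Set.Ioi x, Real.exp (-u ^ 2 / 2) ≤
      Real.exp (-x ^ 2 / 2) * (Real.sqrt (2 * Real.pi) / 2) := by
    rw [setIntegral_Ioi_eq_setIntegral_Ioi_zero, ← integral_Ioi_zero_exp_neg_sq_div_two,
      ← MeasureTheory.integral_const_mul]
    refine MeasureTheory.setIntegral_mono_on
      (integrable_exp_neg_sq_div_two.comp_add_right x).integrableOn
      (integrable_exp_neg_sq_div_two.const_mul _).integrableOn measurableSet_Ioi fun u hu => ?_
    rw [← Real.exp_add, Real.exp_le_exp]
    nlinarith [mul_nonneg (le_of_lt hu) hx]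
  calc gaussQ x ≤ 1 / Real.sqrt (2 * Real.pi) *
        (Real.exp (-x ^ 2 / 2) * (Real.sqrt (2 * Real.pi) / 2)) := by
        unfold gaussQ
        gcongr
    _ = Real.exp (-x ^ 2 / 2) / 2 := by field_simp

lemma sqrt_two_mul_pi_le_exp_one : Real.sqrt (2 * Real.pi) ≤ Real.exp 1 := by
  rw [Real.sqrt_le_left (Real.exp_pos _).le]
  nlinarith [Real.exp_one_gt_d9, Real.pi_lt_d2]

lemma exp_neg_sq_sub_two_le_gaussQ {x : ℝ} (hx : 0 ≤ x) : Real.exp (-x ^ 2 - 2) ≤ gaussQ x := by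
  -- On `(x, x + 1]` we have `u² / 2 ≤ (x + 1)² / 2 ≤ x² + 1`.
  have le_tail : Real.exp (-x ^ 2 - 1) ≤ ∫ u in Set.Ioi x, Real.exp (-u ^ 2 / 2) := by
    calc Real.exp (-x ^ 2 - 1) = ∫ _u in Set.Ioc x (x + 1), Real.exp (-x ^ 2 - 1) := by simp
      _ ≤ ∫ u in Set.Ioc x (x + 1), Real.exp (-u ^ 2 / 2) := by
          refine MeasureTheory.setIntegral_mono_on (by simp)
            integrable_exp_neg_sq_div_two.integrableOn measurableSet_Ioc fun u hu => ?_
          rw [Real.exp_le_exp]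
          nlinarith [sq_nonneg (x - 1), hu.1, hu.2]
      _ ≤ ∫ u in Set.Ioi x, Real.exp (-u ^ 2 / 2) :=
          MeasureTheory.setIntegral_mono_set integrable_exp_neg_sq_div_two.integrableOn
            (Eventually.of_forall fun u => (Real.exp_pos _).le)
            Set.Ioc_subset_Ioi_self.eventuallyLE
  calc Real.exp (-x ^ 2 - 2) = 1 / Real.exp 1 * Real.exp (-x ^ 2 - 1) := by
        rw [one_div, ← Real.exp_neg, ← Real.exp_add]
        ring_nf
    _ ≤ gaussQ x := by
        unfold gaussQ
        gcongr
        exact sqrt_two_mul_pi_le_exp_one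

section FlipProb

variable {η PT Pe : ℝ}

lemma flipProb_le_exp_neg (h : 0 ≤ η * PT) : flipProb η PT ≤ Real.exp (-(η * PT)) / 2 := by
  have tail := gaussQ_le_exp_neg_sq_div_two (Real.sqrt_nonneg (2 * (η * PT)))
  rwa [Real.sq_sqrt (by positivity), neg_div, mul_div_cancel_left₀ _ two_ne_zero] at tail

lemma exp_neg_le_flipProb (h : 0 ≤ η * PT) :
    Real.exp (-(2 * (η * PT) + 2)) ≤ flipProb η PT := by
  have tail := exp_neg_sq_sub_two_le_gaussQ (Real.sqrt_nonneg (2 * (η * PT)))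
  rwa [Real.sq_sqrt (by positivity), ← neg_add'] at tail

lemma flipProb_pos : 0 < flipProb η PT :=
  (Real.exp_pos _).trans_le (exp_neg_sq_sub_two_le_gaussQ (Real.sqrt_nonneg _))

lemma flipProb_le_half : flipProb η PT ≤ 1 / 2 := by
  refine (gaussQ_le_exp_neg_sq_div_two (Real.sqrt_nonneg _)).trans ?_
  gcongr
  exact Real.exp_le_one_iff.mpr (by linarith [sq_nonneg (Real.sqrt (2 * (η * PT)))])

lemma log_one_div_flipProb_le (h : 0 ≤ η * PT) :
    Real.log (1 / flipProb η PT) ≤ 2 * (η * PT) + 2 := by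
  rw [one_div, Real.log_inv, neg_le]
  exact (Real.le_log_iff_exp_le flipProb_pos).mpr (exp_neg_le_flipProb h)

lemma log_one_div_flipProb_pos : 0 < Real.log (1 / flipProb η PT) :=
  Real.log_pos (by rw [lt_div_iff₀ flipProb_pos]; linarith [flipProb_le_half (η := η) (PT := PT)])

lemma exp_neg_log_one_div (h0 : 0 < Pe) : Real.exp (-Real.log (1 / Pe)) = Pe := by
  rw [one_div, Real.log_inv, neg_neg, Real.exp_log h0]

lemma log_one_div_pos (h0 : 0 < Pe) (h1 : Pe < 1) : 0 < Real.log (1 / Pe) :=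
  Real.log_pos (by rwa [lt_div_iff₀ h0, one_mul])

lemma log_one_div_div_mem_uncoded (hη : 0 < η) (h0 : 0 < Pe) (h1 : Pe < 1) :
    Real.log (1 / Pe) / η ∈ {PT : ℝ | 0 ≤ PT ∧ flipProb η PT ≤ Pe} := by
  have hlog := log_one_div_pos h0 h1
  refine ⟨by positivity, (flipProb_le_exp_neg (by positivity)).trans ?_⟩
  rw [mul_div_cancel₀ _ hη.ne', exp_neg_log_one_div h0]
  linarith

lemma uncodedPower_le (hη : 0 < η) (h0 : 0 < Pe) (h1 : Pe < 1) :
    uncodedPower η Pe ≤ Real.log (1 / Pe) / η :=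
  csInf_le ⟨0, fun _ h => h.1⟩ (log_one_div_div_mem_uncoded hη h0 h1)

lemma le_uncodedPower (hη : 0 < η) (h0 : 0 < Pe) (h1 : Pe < 1) :
    (Real.log (1 / Pe) - 2) / (2 * η) ≤ uncodedPower η Pe := by
  refine le_csInf ⟨_, log_one_div_div_mem_uncoded hη h0 h1⟩ fun PT ⟨hPT, hPe⟩ => ?_
  have hlog : Real.log (1 / Pe) ≤ Real.log (1 / flipProb η PT) :=
    Real.log_le_log (by positivity) (one_div_le_one_div_of_le flipProb_pos hPe)
  rw [div_le_iff₀ (by positivity)]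
  linarith [log_one_div_flipProb_le (mul_nonneg hη.le hPT)]

end FlipProb

/-! ### Expectations over the binary symmetric channel -/

/-- Expectation of `F` over the error patterns of a binary symmetric channel with flip
probability `p`, as a finite sum. -/
noncomputable def bscExpect {n : ℕ} (p : ℝ) (F : (Fin n → ZMod 2) → ℝ) : ℝ :=
  ∑ e, bscProb p e * F e

section BscExpect

variable {n : ℕ} {p : ℝ}

lemma sum_prod_apply (g : Fin n → ZMod 2 → ℝ) :
    ∑ e : Fin n → ZMod 2, ∏ u, g u (e u) = ∏ u, ∑ a, g u a := by
  rw [Finset.prod_univ_sum, Fintype.piFinset_univ]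

lemma sum_zmod_two (f : ZMod 2 → ℝ) : ∑ a, f a = f 0 + f 1 := Fin.sum_univ_two f

lemma sum_bscProb : ∑ e : Fin n → ZMod 2, bscProb p e = 1 := by
  unfold bscProb
  rw [sum_prod_apply fun _ a => if a = 0 then 1 - p else p]
  simp [sum_zmod_two]

lemma bscExpect_const (a : ℝ) : bscExpect p (fun _ : Fin n → ZMod 2 => a) = a := by
  rw [bscExpect, ← Finset.sum_mul, sum_bscProb, one_mul]

lemma bscExpect_add (F G : (Fin n → ZMod 2) → ℝ) :
    bscExpect p (fun e => F e + G e) = bscExpect p F + bscExpect p G := by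
  simp only [bscExpect, mul_add, Finset.sum_add_distrib]

lemma bscExpect_sub (F G : (Fin n → ZMod 2) → ℝ) :
    bscExpect p (fun e => F e - G e) = bscExpect p F - bscExpect p G := by
  simp only [bscExpect, mul_sub, Finset.sum_sub_distrib]

lemma bscExpect_const_mul (a : ℝ) (F : (Fin n → ZMod 2) → ℝ) :
    bscExpect p (fun e => a * F e) = a * bscExpect p F := by
  simp only [bscExpect, Finset.mul_sum, mul_left_comm]

lemma bscProb_piecewise_mul_bscProb_piecewise (s : Finset (Fin n)) (e e' : Fin n → ZMod 2) :
    bscProb p (s.piecewise e e') * bscProb p (s.piecewise e' e) = bscProb p e * bscProb p e' := by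
  simp only [bscProb, ← Finset.prod_mul_distrib]
  refine Finset.prod_congr rfl fun v _ => ?_
  by_cases hv : v ∈ s <;> simp [hv, mul_comm]

-- Exchanging the coordinates in `s` between two independent error patterns preserves their joint
-- probability and turns `F e * G e` into `F e * G e'`.
lemma bscExpect_mul {F G : (Fin n → ZMod 2) → ℝ} {s t : Finset (Fin n)}
    (hF : DependsOn F (s : Set (Fin n))) (hG : DependsOn G (t : Set (Fin n)))
    (hst : Disjoint s t) :
    bscExpect p (fun e => F e * G e) = bscExpect p F * bscExpect p G := by
  let exchange (x : (Fin n → ZMod 2) × (Fin n → ZMod 2)) :=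
    (s.piecewise x.1 x.2, s.piecewise x.2 x.1)
  have exchange_involutive : Function.Involutive exchange := by
    rintro ⟨e, e'⟩
    ext v <;> by_cases hv : v ∈ s <;> simp [exchange, hv]
  have F_exchange (x) : F (exchange x).1 = F x.1 :=
    hF fun v hv => by simp [exchange, Finset.mem_coe.mp hv]
  have G_exchange (x) : G (exchange x).2 = G x.1 := hG fun v hv => by
    simp [exchange, Finset.disjoint_right.mp hst (Finset.mem_coe.mp hv)]
  symm
  calc bscExpect p F * bscExpect p G
      = ∑ x : (Fin n → ZMod 2) × (Fin n → ZMod 2),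
          bscProb p x.1 * bscProb p x.2 * (F x.1 * G x.2) := by
        simp only [bscExpect, Finset.sum_mul_sum, Fintype.sum_prod_type, mul_mul_mul_comm]
    _ = ∑ x : (Fin n → ZMod 2) × (Fin n → ZMod 2),
          bscProb p x.1 * bscProb p x.2 * (F x.1 * G x.1) := by
        rw [← Equiv.sum_comp exchange_involutive.toPerm]
        refine Finset.sum_congr rfl fun x _ => ?_
        rw [Function.Involutive.coe_toPerm, F_exchange, G_exchange,
          bscProb_piecewise_mul_bscProb_piecewise]
    _ = bscExpect p (fun e => F e * G e) := by
        simp only [bscExpect, Fintype.sum_prod_type]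
        exact Finset.sum_congr rfl fun e _ => by
          rw [← Finset.sum_mul, ← Finset.mul_sum, sum_bscProb, mul_one]

lemma dependsOn_finsetProd {ι : Type*} {S : Finset ι} {F : ι → (Fin n → ZMod 2) → ℝ}
    {D : ι → Finset (Fin n)} (h : ∀ i ∈ S, DependsOn (F i) (D i : Set (Fin n))) :
    DependsOn (fun e => ∏ i ∈ S, F i e) (S.biUnion D : Set (Fin n)) := fun _ _ he =>
  Finset.prod_congr rfl fun i hi => h i hi fun v hv =>
    he v (Finset.mem_coe.mpr (Finset.mem_biUnion.mpr ⟨i, hi, hv⟩))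

lemma bscExpect_prod {ι : Type*} {S : Finset ι} {F : ι → (Fin n → ZMod 2) → ℝ}
    {D : ι → Finset (Fin n)} (h : ∀ i ∈ S, DependsOn (F i) (D i : Set (Fin n)))
    (hD : (S : Set ι).PairwiseDisjoint D) :
    bscExpect p (fun e => ∏ i ∈ S, F i e) = ∏ i ∈ S, bscExpect p (F i) := by
  classical
  induction S using Finset.induction_on with
  | empty => simp only [Finset.prod_empty, bscExpect_const]
  | insert i S hi ih =>
    obtain ⟨hFi, hFS⟩ := (Finset.forall_mem_insert _ _ _).mp h
    have hDi : Disjoint (D i) (S.biUnion D) := (Finset.disjoint_biUnion_right _ _ _).mpr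
      fun j hj => hD (by simp) (by simp [hj]) (ne_of_mem_of_not_mem hj hi).symm
    simp only [Finset.prod_insert hi]
    rw [bscExpect_mul hFi (dependsOn_finsetProd hFS) hDi, ih hFS (hD.subset (by simp))]

/-- The real number `0` or `1` with the same parity as `x`: the indicator that a bit `x` of an
error pattern is wrong. -/
noncomputable def bitIndicator (x : ZMod 2) : ℝ := if x = 0 then 0 else 1

lemma zmod_two_eq_zero_or_one (x : ZMod 2) : x = 0 ∨ x = 1 := by revert x; decide

@[simp] lemma bitIndicator_zero : bitIndicator 0 = 0 := if_pos rfl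

@[simp] lemma bitIndicator_one : bitIndicator 1 = 1 := if_neg one_ne_zero

lemma one_sub_two_mul_bitIndicator_add (x y : ZMod 2) :
    1 - 2 * bitIndicator (x + y) = (1 - 2 * bitIndicator x) * (1 - 2 * bitIndicator y) := by
  have one_add_one : (1 : ZMod 2) + 1 = 0 := by decide
  rcases zmod_two_eq_zero_or_one x with rfl | rfl <;>
    rcases zmod_two_eq_zero_or_one y with rfl | rfl <;>
    simp only [zero_add, add_zero, one_add_one, bitIndicator_zero, bitIndicator_one] <;> norm_num

lemma one_sub_two_mul_bitIndicator_sum {ι : Type*} (S : Finset ι) (f : ι → ZMod 2) :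
    1 - 2 * bitIndicator (∑ i ∈ S, f i) = ∏ i ∈ S, (1 - 2 * bitIndicator (f i)) := by
  classical
  induction S using Finset.induction_on with
  | empty => simp
  | insert i S hi ih =>
    rw [Finset.sum_insert hi, Finset.prod_insert hi, one_sub_two_mul_bitIndicator_add, ih]

lemma bscExpect_bitIndicator (v : Fin n) : bscExpect p (fun e => bitIndicator (e v)) = p := by
  let weight (u : Fin n) (a : ZMod 2) : ℝ :=
    (if a = 0 then 1 - p else p) * if u = v then bitIndicator a else 1
  have factor (e : Fin n → ZMod 2) :
      bscProb p e * bitIndicator (e v) = ∏ u, weight u (e u) := by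
    rw [Finset.prod_mul_distrib, Finset.prod_ite_eq' Finset.univ v]
    simp [bscProb]
  simp only [bscExpect, factor]
  rw [sum_prod_apply, Finset.prod_eq_single v]
  · simp [weight, sum_zmod_two]
  · intro u _ hu
    simp [weight, sum_zmod_two, hu]
  · simp

end BscExpect

/-! ### Reduction to the zero codeword -/

namespace Tanner

variable {T : Tanner}

lemma mem_varsOf_iff {v : Fin T.n} {c : Fin T.m} : v ∈ T.varsOf c ↔ T.H c v ≠ 0 := by
  simp [varsOf]

lemma mem_checksOf_iff {v : Fin T.n} {c : Fin T.m} : c ∈ T.checksOf v ↔ T.H c v ≠ 0 := by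
  simp [checksOf]

lemma mem_edges_iff {v : Fin T.n} {c : Fin T.m} : (v, c) ∈ T.edges ↔ T.H c v ≠ 0 := by
  simp [edges]

lemma zero_mem_codewords : (0 : Fin T.n → ZMod 2) ∈ T.codewords := by simp [codewords]

lemma sum_varsOf_eq_zero {x : Fin T.n → ZMod 2} (hx : x ∈ T.codewords) (c : Fin T.m) :
    ∑ v ∈ T.varsOf c, x v = 0 := by
  have parity : T.H.mulVec x c = 0 := congrFun (Finset.mem_filter.mp hx).2 c
  rw [← parity, Matrix.mulVec, dotProduct, varsOf, Finset.sum_filter]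
  refine Finset.sum_congr rfl fun u _ => ?_
  rcases zmod_two_eq_zero_or_one (T.H c u) with h | h <;> simp [h]

lemma sum_varsOf_erase_eq {x : Fin T.n → ZMod 2} (hx : x ∈ T.codewords) {v : Fin T.n}
    {c : Fin T.m} (hv : v ∈ T.varsOf c) : ∑ v' ∈ (T.varsOf c).erase v, x v' = x v := by
  have parity := sum_varsOf_eq_zero hx c
  rw [← Finset.add_sum_erase _ _ hv] at parity
  rw [eq_neg_of_add_eq_zero_right parity, ZMod.neg_eq_self_mod_two]

lemma varMsg_add_codeword {x : Fin T.n → ZMod 2} (hx : x ∈ T.codewords) (e : Fin T.n → ZMod 2)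
    (ℓ : ℕ) (v : Fin T.n) (c : Fin T.m) :
    T.varMsg (x + e) ℓ v c = x v + T.varMsg e ℓ v c := by
  induction ℓ generalizing v c with
  | zero => rfl
  | succ ℓ ih =>
    have contradicts_iff : ∀ c' ∈ (T.checksOf v).erase c,
        (∑ v' ∈ (T.varsOf c').erase v, T.varMsg (x + e) ℓ v' c' = (x + e) v + 1 ↔
          ∑ v' ∈ (T.varsOf c').erase v, T.varMsg e ℓ v' c' = e v + 1) := fun c' hc' => by
      have hv : v ∈ T.varsOf c' :=
        mem_varsOf_iff.mpr (mem_checksOf_iff.mp (Finset.mem_of_mem_erase hc'))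
      simp only [ih, Finset.sum_add_distrib, sum_varsOf_erase_eq hx hv, Pi.add_apply,
        add_assoc, add_right_inj]
    rw [varMsg, varMsg, if_congr (forall₂_congr contradicts_iff) rfl rfl]
    split_ifs <;> simp [add_assoc]

lemma card_filter_varMsg_ne {x : Fin T.n → ZMod 2} (hx : x ∈ T.codewords)
    (e : Fin T.n → ZMod 2) (ℓ : ℕ) :
    ((T.edges.filter fun a => T.varMsg (x + e) ℓ a.1 a.2 ≠ x a.1).card : ℝ) =
      ∑ a ∈ T.edges, bitIndicator (T.varMsg e ℓ a.1 a.2) := by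
  rw [Finset.card_filter, Nat.cast_sum]
  refine Finset.sum_congr rfl fun a _ => ?_
  rw [varMsg_add_codeword hx]
  rcases zmod_two_eq_zero_or_one (T.varMsg e ℓ a.1 a.2) with h | h <;> simp [h]

lemma bitErrorProb_eq_sum_edges (p : ℝ) (ℓ : ℕ) :
    T.bitErrorProb p ℓ =
      (∑ a ∈ T.edges, bscExpect p (fun e => bitIndicator (T.varMsg e ℓ a.1 a.2))) /
        (T.edges.card : ℝ) := by
  have codewords_card_ne : (T.codewords.card : ℝ) ≠ 0 :=
    Nat.cast_ne_zero.mpr (Finset.card_ne_zero_of_mem zero_mem_codewords)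
  rw [bitErrorProb, div_eq_iff codewords_card_ne, mul_comm, ← nsmul_eq_mul]
  refine Finset.sum_eq_card_nsmul fun x hx => ?_
  simp only [bscExpect]
  rw [Finset.sum_comm, Finset.sum_div]
  refine Finset.sum_congr rfl fun e _ => ?_
  rw [card_filter_varMsg_ne hx, ← Finset.mul_sum, mul_div_assoc]

end Tanner

/-! ### Computation trees below the girth -/

lemma notMem_support_of_length_lt_egirth {V : Type*} {G : SimpleGraph V} {a b u : V}
    {p : G.Walk a u} (hp : p.IsPath) (hab : G.Adj a b) (he : s(a, b) ∉ p.edges)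
    (hG : ((p.length + 1 : ℕ) : ℕ∞) < G.egirth) : b ∉ p.support := by
  classical
  intro hb
  have cycle : (SimpleGraph.Walk.cons hab.symm (p.takeUntil b hb)).IsCycle := by
    rw [SimpleGraph.Walk.cons_isCycle_iff, Sym2.eq_swap]
    exact ⟨hp.takeUntil hb, fun h => he (p.edges_takeUntil_subset_edges hb h)⟩
  have short := hG.trans_le (SimpleGraph.egirth_le_length cycle)
  rw [SimpleGraph.Walk.length_cons, Nat.cast_lt, Nat.add_lt_add_iff_right] at short
  exact (p.length_takeUntil_le_length hb).not_gt short

lemma one_lt_branching {dv dc : ℕ} (hdv : 3 ≤ dv) (hdc : 2 ≤ dc) : 1 < (dv - 1) * (dc - 1) :=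
  Nat.lt_of_lt_of_le (by norm_num : 1 < 2 * 1) (Nat.mul_le_mul (by omega) (by omega))

namespace Tanner

variable {T : Tanner}

lemma mem_checksOf_iff_mem_varsOf {v : Fin T.n} {c : Fin T.m} :
    c ∈ T.checksOf v ↔ v ∈ T.varsOf c := mem_checksOf_iff.trans mem_varsOf_iff.symm

lemma graph_adj_inl_inr {v : Fin T.n} {c : Fin T.m} :
    T.graph.Adj (Sum.inl v) (Sum.inr c) ↔ c ∈ T.checksOf v := by
  simp [graph, mem_checksOf_iff]

/-- The variable nodes of the computation tree of the message from `v` to `c` in iteration `ℓ`: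
those whose channel values enter this message. -/
def depSet (T : Tanner) : ℕ → Fin T.n → Fin T.m → Finset (Fin T.n)
  | 0, v, _ => {v}
  | ℓ + 1, v, c => insert v (((T.checksOf v).erase c).biUnion fun c' =>
      ((T.varsOf c').erase v).biUnion fun v' => T.depSet ℓ v' c')

/-- The variable nodes whose channel values enter the message that `c` returns to `v` after
iteration `ℓ`. -/
def checkDepSet (T : Tanner) (ℓ : ℕ) (v : Fin T.n) (c : Fin T.m) : Finset (Fin T.n) :=
  ((T.varsOf c).erase v).biUnion fun v' => T.depSet ℓ v' c

lemma exists_path_cons_cons {ℓ : ℕ} (hG : ((4 * (ℓ + 1) : ℕ) : ℕ∞) < T.graph.egirth)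
    {v v' u : Fin T.n} {c : Fin T.m} (hc : c ∈ T.checksOf v) (hv' : v' ∈ (T.varsOf c).erase v)
    {p : T.graph.Walk (Sum.inl v') (Sum.inl u)} (hp : p.IsPath) (hlen : p.length ≤ 2 * ℓ)
    (hcp : Sum.inr c ∉ p.support) :
    ∃ q : T.graph.Walk (Sum.inl v) (Sum.inl u), q.IsPath ∧ q.length ≤ 2 * (ℓ + 1) ∧
      q.getVert 1 = Sum.inr c ∧ q.getVert 2 = Sum.inl v' := by
  obtain ⟨hne, hv'c⟩ := Finset.mem_erase.mp hv'
  have adj : T.graph.Adj (Sum.inl v) (Sum.inr c) := graph_adj_inl_inr.mpr hc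
  have adj' : T.graph.Adj (Sum.inr c) (Sum.inl v') :=
    (graph_adj_inl_inr.mpr (mem_checksOf_iff_mem_varsOf.mpr hv'c)).symm
  have tail_isPath : (SimpleGraph.Walk.cons adj' p).IsPath := hp.cons hcp
  refine ⟨.cons adj (.cons adj' p), tail_isPath.cons ?_, ?_, ?_, ?_⟩
  · refine notMem_support_of_length_lt_egirth tail_isPath adj.symm ?_
      (lt_of_le_of_lt (Nat.cast_le.mpr ?_) hG)
    · rw [SimpleGraph.Walk.edges_cons, List.mem_cons, not_or]
      exact ⟨by simpa using hne.symm, fun h => hcp (p.fst_mem_support_of_mem_edges h)⟩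
    · rw [SimpleGraph.Walk.length_cons]
      omega
  · simp only [SimpleGraph.Walk.length_cons]
    omega
  · simp
  · simp

lemma exists_path_of_mem_depSet {ℓ : ℕ} (hG : ((4 * ℓ : ℕ) : ℕ∞) < T.graph.egirth)
    {v u : Fin T.n} {c : Fin T.m} (hc : c ∈ T.checksOf v) (hu : u ∈ T.depSet ℓ v c) :
    ∃ p : T.graph.Walk (Sum.inl v) (Sum.inl u), p.IsPath ∧ p.length ≤ 2 * ℓ ∧
      Sum.inr c ∉ p.support := by
  induction ℓ generalizing v c with
  | zero =>
    obtain rfl : u = v := by simpa [depSet] using hu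
    exact ⟨.nil, by simp, by simp, by simp⟩
  | succ ℓ ih =>
    rw [depSet, Finset.mem_insert] at hu
    rcases hu with rfl | hu
    · exact ⟨.nil, by simp, by simp, by simp⟩
    simp only [Finset.mem_biUnion] at hu
    obtain ⟨c', hc', v', hv', hu⟩ := hu
    obtain ⟨hne, hc'v⟩ := Finset.mem_erase.mp hc'
    obtain ⟨p, hp, hlen, hcp⟩ := ih (lt_of_le_of_lt (Nat.cast_le.mpr (by omega)) hG)
      (mem_checksOf_iff_mem_varsOf.mpr (Finset.mem_of_mem_erase hv')) hu
    obtain ⟨q, hq, hqlen, hq_snd, -⟩ := exists_path_cons_cons hG hc'v hv' hp hlen hcp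
    refine ⟨q, hq, hqlen, notMem_support_of_length_lt_egirth hq (graph_adj_inl_inr.mpr hc)
      (fun he => hne ?_) (lt_of_le_of_lt (Nat.cast_le.mpr (by omega)) hG)⟩
    exact Sum.inr_injective (hq_snd.symm.trans (hq.eq_snd_of_mem_edges he).symm)

lemma exists_path_of_mem_depSet_child {ℓ : ℕ}
    (hG : ((4 * (ℓ + 1) : ℕ) : ℕ∞) < T.graph.egirth) {v v' u : Fin T.n} {c : Fin T.m}
    (hc : c ∈ T.checksOf v) (hv' : v' ∈ (T.varsOf c).erase v) (hu : u ∈ T.depSet ℓ v' c) :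
    ∃ q : T.graph.Walk (Sum.inl v) (Sum.inl u), q.IsPath ∧ q.length ≤ 2 * (ℓ + 1) ∧
      q.getVert 1 = Sum.inr c ∧ q.getVert 2 = Sum.inl v' := by
  obtain ⟨p, hp, hlen, hcp⟩ := exists_path_of_mem_depSet
    (lt_of_le_of_lt (Nat.cast_le.mpr (by omega)) hG)
    (mem_checksOf_iff_mem_varsOf.mpr (Finset.mem_of_mem_erase hv')) hu
  exact exists_path_cons_cons hG hc hv' hp hlen hcp

lemma notMem_depSet_child {ℓ : ℕ} (hG : ((4 * (ℓ + 1) : ℕ) : ℕ∞) < T.graph.egirth)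
    {v v' : Fin T.n} {c : Fin T.m} (hc : c ∈ T.checksOf v) (hv' : v' ∈ (T.varsOf c).erase v) :
    v ∉ T.depSet ℓ v' c := by
  intro hv
  obtain ⟨q, hq, -, hq_snd, -⟩ := exists_path_of_mem_depSet_child hG hc hv' hv
  rw [(SimpleGraph.Walk.isPath_iff_nil.mp hq).eq_nil] at hq_snd
  simp at hq_snd

lemma disjoint_depSet_child {ℓ : ℕ} (hG : ((4 * (ℓ + 1) : ℕ) : ℕ∞) < T.graph.egirth)
    {v v₁ v₂ : Fin T.n} {c₁ c₂ : Fin T.m} (hc₁ : c₁ ∈ T.checksOf v)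
    (hv₁ : v₁ ∈ (T.varsOf c₁).erase v) (hc₂ : c₂ ∈ T.checksOf v)
    (hv₂ : v₂ ∈ (T.varsOf c₂).erase v) (hne : (c₁, v₁) ≠ (c₂, v₂)) :
    Disjoint (T.depSet ℓ v₁ c₁) (T.depSet ℓ v₂ c₂) := by
  refine Finset.disjoint_left.mpr fun u hu₁ hu₂ => ?_
  obtain ⟨q₁, hq₁, hlen₁, hfst₁, hsnd₁⟩ := exists_path_of_mem_depSet_child hG hc₁ hv₁ hu₁
  obtain ⟨q₂, hq₂, hlen₂, hfst₂, hsnd₂⟩ := exists_path_of_mem_depSet_child hG hc₂ hv₂ hu₂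
  have paths_ne : q₁ ≠ q₂ := by
    rintro rfl
    exact hne (Prod.ext (Sum.inr_injective (hfst₁.symm.trans hfst₂))
      (Sum.inl_injective (hsnd₁.symm.trans hsnd₂)))
  obtain ⟨a, -, -, w, hw, hwlen⟩ := hq₁.exists_isCycle_length_le_add_of_ne hq₂ paths_ne
  have long := Nat.cast_lt.mp (hG.trans_le (SimpleGraph.egirth_le_length hw))
  omega

lemma pairwiseDisjoint_depSet {ℓ : ℕ} (hG : ((4 * (ℓ + 1) : ℕ) : ℕ∞) < T.graph.egirth)
    {v : Fin T.n} {c : Fin T.m} (hc : c ∈ T.checksOf v) :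
    ((T.varsOf c).erase v : Set (Fin T.n)).PairwiseDisjoint fun v' => T.depSet ℓ v' c :=
  fun _ hv₁ _ hv₂ hne => disjoint_depSet_child hG hc (Finset.mem_coe.mp hv₁) hc
    (Finset.mem_coe.mp hv₂) (by simpa using hne)

lemma pairwiseDisjoint_checkDepSet {ℓ : ℕ} (hG : ((4 * (ℓ + 1) : ℕ) : ℕ∞) < T.graph.egirth)
    (v : Fin T.n) (c : Fin T.m) :
    ((T.checksOf v).erase c : Set (Fin T.m)).PairwiseDisjoint (T.checkDepSet ℓ v) := by
  intro c₁ hc₁ c₂ hc₂ hne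
  simp only [Function.onFun, checkDepSet, Finset.disjoint_biUnion_left,
    Finset.disjoint_biUnion_right]
  intro v₁ hv₁ v₂ hv₂
  exact disjoint_depSet_child hG (Finset.mem_of_mem_erase (Finset.mem_coe.mp hc₁)) hv₂
    (Finset.mem_of_mem_erase (Finset.mem_coe.mp hc₂)) hv₁ (by simp [hne])

lemma notMem_biUnion_checkDepSet {ℓ : ℕ} (hG : ((4 * (ℓ + 1) : ℕ) : ℕ∞) < T.graph.egirth)
    (v : Fin T.n) (c : Fin T.m) : v ∉ ((T.checksOf v).erase c).biUnion (T.checkDepSet ℓ v) := by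
  simp only [checkDepSet, Finset.mem_biUnion, not_exists, not_and]
  exact fun c' hc' v' hv' => notMem_depSet_child hG (Finset.mem_of_mem_erase hc') hv'

/-! ### Girth against blocklength -/

variable {dv dc : ℕ}

lemma Regular.card_erase_checksOf (h : T.Regular dv dc) {v : Fin T.n} {c : Fin T.m}
    (hc : c ∈ T.checksOf v) : ((T.checksOf v).erase c).card = dv - 1 := by
  rw [Finset.card_erase_of_mem hc, h.2.1]

lemma Regular.card_erase_varsOf (h : T.Regular dv dc) {v : Fin T.n} {c : Fin T.m}
    (hc : c ∈ T.checksOf v) : ((T.varsOf c).erase v).card = dc - 1 := by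
  rw [Finset.card_erase_of_mem (mem_checksOf_iff_mem_varsOf.mp hc), h.2.2]

lemma Regular.pow_le_card_depSet (h : T.Regular dv dc) {ℓ : ℕ}
    (hG : ((4 * ℓ : ℕ) : ℕ∞) < T.graph.egirth) {v : Fin T.n} {c : Fin T.m}
    (hc : c ∈ T.checksOf v) : ((dv - 1) * (dc - 1)) ^ ℓ ≤ (T.depSet ℓ v c).card := by
  induction ℓ generalizing v c with
  | zero => simp [depSet]
  | succ ℓ ih =>
    have pow_le_checkDepSet : ∀ c' ∈ (T.checksOf v).erase c,
        (dc - 1) * ((dv - 1) * (dc - 1)) ^ ℓ ≤ (T.checkDepSet ℓ v c').card := fun c' hc' => by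
      have hc'v := Finset.mem_of_mem_erase hc'
      rw [checkDepSet, Finset.card_biUnion (pairwiseDisjoint_depSet hG hc'v), ← smul_eq_mul]
      nth_rw 1 [← h.card_erase_varsOf hc'v]
      exact Finset.card_nsmul_le_sum _ _ _ fun v' hv' =>
        ih (lt_of_le_of_lt (Nat.cast_le.mpr (by omega)) hG)
          (mem_checksOf_iff_mem_varsOf.mpr (Finset.mem_of_mem_erase hv'))
    calc ((dv - 1) * (dc - 1)) ^ (ℓ + 1)
        = ((T.checksOf v).erase c).card • ((dc - 1) * ((dv - 1) * (dc - 1)) ^ ℓ) := by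
          rw [h.card_erase_checksOf hc, smul_eq_mul]
          ring
      _ ≤ ∑ c' ∈ (T.checksOf v).erase c, (T.checkDepSet ℓ v c').card :=
          Finset.card_nsmul_le_sum _ _ _ pow_le_checkDepSet
      _ = (((T.checksOf v).erase c).biUnion (T.checkDepSet ℓ v)).card :=
          (Finset.card_biUnion (pairwiseDisjoint_checkDepSet hG v c)).symm
      _ ≤ (T.depSet (ℓ + 1) v c).card := Finset.card_le_card (Finset.subset_insert _ _)

lemma Regular.exists_mem_checksOf (h : T.Regular dv dc) (hdv : 0 < dv) :
    ∃ (v : Fin T.n) (c : Fin T.m), c ∈ T.checksOf v := by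
  obtain ⟨c, hc⟩ := Finset.card_pos.mp (hdv.trans_eq (h.2.1 ⟨0, h.1⟩).symm)
  exact ⟨_, c, hc⟩

lemma Regular.pow_le_n (h : T.Regular dv dc) (hdv : 0 < dv) {ℓ : ℕ}
    (hG : ((4 * ℓ : ℕ) : ℕ∞) < T.graph.egirth) : ((dv - 1) * (dc - 1)) ^ ℓ ≤ T.n := by
  obtain ⟨v, c, hc⟩ := h.exists_mem_checksOf hdv
  exact (h.pow_le_card_depSet hG hc).trans (card_finset_fin_le _)

lemma lt_egirth_of_le_maxIter {ℓ : ℕ} (h : ℓ ≤ T.maxIter) :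
    ((4 * ℓ : ℕ) : ℕ∞) < T.graph.egirth := by
  refine lt_of_lt_of_le (Nat.cast_lt.mpr (Nat.lt_succ_self _)) ?_
  refine SimpleGraph.le_egirth.mpr fun a w hw => Nat.cast_le.mpr ?_
  have girth_le := SimpleGraph.girth_le_length hw
  have three_le := hw.three_le_length
  unfold maxIter at h
  omega

lemma Regular.not_isAcyclic (h : T.Regular dv dc) (hdv : 3 ≤ dv) (hdc : 2 ≤ dc) :
    ¬ T.graph.IsAcyclic := fun hac =>
  (Nat.lt_pow_self (one_lt_branching hdv hdc)).not_ge
    (h.pow_le_n (by omega) (by rw [SimpleGraph.egirth_eq_top.mpr hac]; exact ENat.natCast_lt_top _))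

lemma Regular.le_maxIter (h : T.Regular dv dc) (hdv : 3 ≤ dv) (hdc : 2 ≤ dc) {N : ℕ}
    (hG : ((4 * N + 1 : ℕ) : ℕ∞) < T.graph.egirth) : N ≤ T.maxIter := by
  obtain ⟨a, w, hw, hlen⟩ := SimpleGraph.exists_girth_eq_length.mpr (h.not_isAcyclic hdv hdc)
  have long := Nat.cast_lt.mp (hG.trans_le (SimpleGraph.egirth_le_length hw))
  unfold maxIter
  omega

end Tanner

/-! ### Density evolution -/

/-- Error probability of the parity of `k` independent bits that are wrong with probability `x`:
the check-node half of the density evolution of Gallager-A decoding. -/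
noncomputable def parityError (k : ℕ) (x : ℝ) : ℝ := (1 - (1 - 2 * x) ^ k) / 2

/-- Error probability of a bit received with flip probability `p` and complemented when `k`
independent estimates, each wrong with probability `q`, all contradict it: the variable-node half
of the density evolution of Gallager-A decoding. -/
noncomputable def varError (p : ℝ) (k : ℕ) (q : ℝ) : ℝ := p * (1 - (1 - q) ^ k) + (1 - p) * q ^ k

/-- Density evolution of Gallager-A decoding: the error probability of a message in iteration `ℓ`
when all computation trees are trees. -/
noncomputable def densityEvolution (p : ℝ) (dv dc : ℕ) : ℕ → ℝ
  | 0 => p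
  | ℓ + 1 => varError p (dv - 1) (parityError (dc - 1) (densityEvolution p dv dc ℓ))

namespace Tanner

variable {T : Tanner} {dv dc : ℕ} {p : ℝ}

/-- The message that the check node `c` returns to `v` after iteration `ℓ`. -/
def checkMsg (T : Tanner) (y : Fin T.n → ZMod 2) (ℓ : ℕ) (v : Fin T.n) (c : Fin T.m) : ZMod 2 :=
  ∑ v' ∈ (T.varsOf c).erase v, T.varMsg y ℓ v' c

lemma varMsg_succ (y : Fin T.n → ZMod 2) (ℓ : ℕ) (v : Fin T.n) (c : Fin T.m) :
    T.varMsg y (ℓ + 1) v c =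
      if ∀ c' ∈ (T.checksOf v).erase c, T.checkMsg y ℓ v c' = y v + 1 then y v + 1 else y v := rfl

lemma dependsOn_varMsg (ℓ : ℕ) (v : Fin T.n) (c : Fin T.m) :
    DependsOn (fun y => T.varMsg y ℓ v c) (T.depSet ℓ v c : Set (Fin T.n)) := by
  induction ℓ generalizing v c with
  | zero => exact fun y y' h => h v (by simp [depSet])
  | succ ℓ ih =>
    intro y y' h
    have channel_eq : y v = y' v := h v (by simp [depSet])
    have checkMsg_eq : ∀ c' ∈ (T.checksOf v).erase c,
        T.checkMsg y ℓ v c' = T.checkMsg y' ℓ v c' := fun c' hc' =>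
      Finset.sum_congr rfl fun v' hv' => ih v' c' fun u hu => h u (by
        simp only [depSet, Finset.coe_insert, Finset.coe_biUnion, Set.mem_insert_iff,
          Set.mem_iUnion]
        exact Or.inr ⟨c', hc', v', hv', hu⟩)
    have contradicts_iff : ∀ c' ∈ (T.checksOf v).erase c,
        (T.checkMsg y ℓ v c' = y v + 1 ↔ T.checkMsg y' ℓ v c' = y' v + 1) := fun c' hc' => by
      rw [checkMsg_eq c' hc', channel_eq]
    simp only [varMsg_succ]
    rw [if_congr (forall₂_congr contradicts_iff) rfl rfl, channel_eq]

lemma dependsOn_checkMsg (ℓ : ℕ) (v : Fin T.n) (c : Fin T.m) :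
    DependsOn (fun y => T.checkMsg y ℓ v c) (T.checkDepSet ℓ v c : Set (Fin T.n)) := fun _ _ h =>
  Finset.sum_congr rfl fun v' hv' => dependsOn_varMsg ℓ v' c fun u hu => h u
    (Finset.mem_coe.mpr (Finset.mem_biUnion.mpr ⟨v', hv', Finset.mem_coe.mp hu⟩))

lemma bitIndicator_varMsg_succ (y : Fin T.n → ZMod 2) (ℓ : ℕ) (v : Fin T.n) (c : Fin T.m) :
    bitIndicator (T.varMsg y (ℓ + 1) v c) =
      bitIndicator (y v) *
          (1 - ∏ c' ∈ (T.checksOf v).erase c, (1 - bitIndicator (T.checkMsg y ℓ v c'))) +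
        (1 - bitIndicator (y v)) *
          ∏ c' ∈ (T.checksOf v).erase c, bitIndicator (T.checkMsg y ℓ v c') := by
  have one_add_one : (1 : ZMod 2) + 1 = 0 := by decide
  rw [varMsg_succ]
  split_ifs with contradict
  · rcases zmod_two_eq_zero_or_one (y v) with hy | hy <;>
      simp only [hy, one_add_one, zero_add] at contradict ⊢
    · rw [Finset.prod_eq_one (f := fun c' => bitIndicator (T.checkMsg y ℓ v c'))
        fun c' hc' => by rw [contradict c' hc', bitIndicator_one]]
      simp
    · rw [Finset.prod_eq_one (f := fun c' => 1 - bitIndicator (T.checkMsg y ℓ v c'))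
        fun c' hc' => by rw [contradict c' hc', bitIndicator_zero, sub_zero]]
      simp
  · push Not at contradict
    obtain ⟨c', hc', hne⟩ := contradict
    rcases zmod_two_eq_zero_or_one (y v) with hy | hy <;>
      simp only [hy, one_add_one, zero_add] at hne ⊢
    · rw [Finset.prod_eq_zero (f := fun c' => bitIndicator (T.checkMsg y ℓ v c')) hc'
        (by rw [(zmod_two_eq_zero_or_one _).resolve_right hne, bitIndicator_zero])]
      simp
    · rw [Finset.prod_eq_zero (f := fun c' => 1 - bitIndicator (T.checkMsg y ℓ v c')) hc'
        (by rw [(zmod_two_eq_zero_or_one _).resolve_left hne, bitIndicator_one, sub_self])]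
      simp

lemma bscExpect_bitIndicator_checkMsg {ℓ : ℕ}
    (hG : ((4 * (ℓ + 1) : ℕ) : ℕ∞) < T.graph.egirth) {v : Fin T.n} {c : Fin T.m}
    (hc : c ∈ T.checksOf v) {x : ℝ} (hx : ∀ v' ∈ (T.varsOf c).erase v,
      bscExpect p (fun e => bitIndicator (T.varMsg e ℓ v' c)) = x) :
    bscExpect p (fun e => bitIndicator (T.checkMsg e ℓ v c)) =
      parityError ((T.varsOf c).erase v).card x := by
  have sign_expect : 1 - 2 * bscExpect p (fun e => bitIndicator (T.checkMsg e ℓ v c)) =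
      (1 - 2 * x) ^ ((T.varsOf c).erase v).card := by
    calc 1 - 2 * bscExpect p (fun e => bitIndicator (T.checkMsg e ℓ v c))
        = bscExpect p (fun e => ∏ v' ∈ (T.varsOf c).erase v,
            (1 - 2 * bitIndicator (T.varMsg e ℓ v' c))) := by
          simp only [← one_sub_two_mul_bitIndicator_sum]
          rw [bscExpect_sub, bscExpect_const, bscExpect_const_mul]
          rfl
      _ = ∏ v' ∈ (T.varsOf c).erase v,
            bscExpect p (fun e => 1 - 2 * bitIndicator (T.varMsg e ℓ v' c)) :=
          bscExpect_prod (fun v' _ _ _ he => congrArg (fun b => 1 - 2 * bitIndicator b)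
            (dependsOn_varMsg ℓ v' c he)) (pairwiseDisjoint_depSet hG hc)
      _ = (1 - 2 * x) ^ ((T.varsOf c).erase v).card := Finset.prod_eq_pow_card fun v' hv' => by
          rw [bscExpect_sub, bscExpect_const, bscExpect_const_mul, hx v' hv']
  rw [parityError, ← sign_expect]
  ring

lemma bscExpect_bitIndicator_varMsg_succ {ℓ : ℕ}
    (hG : ((4 * (ℓ + 1) : ℕ) : ℕ∞) < T.graph.egirth) {v : Fin T.n} {c : Fin T.m} {q : ℝ}
    (hq : ∀ c' ∈ (T.checksOf v).erase c,
      bscExpect p (fun e => bitIndicator (T.checkMsg e ℓ v c')) = q) :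
    bscExpect p (fun e => bitIndicator (T.varMsg e (ℓ + 1) v c)) =
      varError p ((T.checksOf v).erase c).card q := by
  let others := (T.checksOf v).erase c
  have dependsOn_channel (f : ℝ → ℝ) : DependsOn
      (fun e : Fin T.n → ZMod 2 => f (bitIndicator (e v))) (({v} : Finset (Fin T.n)) : Set _) :=
    fun _ _ he => congrArg (fun b => f (bitIndicator b)) (he v (by simp))
  have dependsOn_check (f : ℝ → ℝ) : ∀ c' ∈ others, DependsOn
      (fun e => f (bitIndicator (T.checkMsg e ℓ v c'))) (T.checkDepSet ℓ v c' : Set (Fin T.n)) :=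
    fun c' _ _ _ he => congrArg (fun b => f (bitIndicator b)) (dependsOn_checkMsg ℓ v c' he)
  have expect_prod (f : ℝ → ℝ) {y : ℝ} (hf : ∀ c' ∈ others,
      bscExpect p (fun e => f (bitIndicator (T.checkMsg e ℓ v c'))) = y) :
      bscExpect p (fun e => ∏ c' ∈ others, f (bitIndicator (T.checkMsg e ℓ v c'))) =
        y ^ others.card := by
    rw [bscExpect_prod (dependsOn_check f) (pairwiseDisjoint_checkDepSet hG v c)]
    exact Finset.prod_eq_pow_card hf
  have disjoint : Disjoint {v} (others.biUnion (T.checkDepSet ℓ v)) :=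
    Finset.disjoint_singleton_left.mpr (notMem_biUnion_checkDepSet hG v c)
  have all_right_dependsOn := dependsOn_finsetProd (dependsOn_check fun b => 1 - b)
  simp only [bitIndicator_varMsg_succ]
  rw [bscExpect_add,
    bscExpect_mul (dependsOn_channel fun b => b)
      (fun _ _ he => congrArg (1 - ·) (all_right_dependsOn he)) disjoint,
    bscExpect_mul (dependsOn_channel fun b => 1 - b)
      (dependsOn_finsetProd (dependsOn_check fun b => b)) disjoint,
    bscExpect_sub, bscExpect_sub, bscExpect_const, bscExpect_bitIndicator,
    expect_prod (fun b => 1 - b) (y := 1 - q) fun c' hc' => by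
      rw [bscExpect_sub, bscExpect_const, hq c' hc'],
    expect_prod (fun b => b) hq, varError]

theorem Regular.bscExpect_bitIndicator_varMsg (h : T.Regular dv dc) {ℓ : ℕ}
    (hG : ((4 * ℓ : ℕ) : ℕ∞) < T.graph.egirth) {v : Fin T.n} {c : Fin T.m}
    (hc : c ∈ T.checksOf v) :
    bscExpect p (fun e => bitIndicator (T.varMsg e ℓ v c)) = densityEvolution p dv dc ℓ := by
  induction ℓ generalizing v c with
  | zero => exact bscExpect_bitIndicator v
  | succ ℓ ih =>
    rw [densityEvolution, ← h.card_erase_checksOf hc]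
    refine bscExpect_bitIndicator_varMsg_succ hG fun c' hc' => ?_
    have hc'v := Finset.mem_of_mem_erase hc'
    rw [← h.card_erase_varsOf hc'v]
    exact bscExpect_bitIndicator_checkMsg hG hc'v fun v' hv' =>
      ih (lt_of_le_of_lt (Nat.cast_le.mpr (by omega)) hG)
        (mem_checksOf_iff_mem_varsOf.mpr (Finset.mem_of_mem_erase hv'))

theorem Regular.bitErrorProb_eq_densityEvolution (h : T.Regular dv dc) (hdv : 0 < dv) (p : ℝ)
    {ℓ : ℕ} (hℓ : ℓ ≤ T.maxIter) : T.bitErrorProb p ℓ = densityEvolution p dv dc ℓ := by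
  obtain ⟨v, c, hc⟩ := h.exists_mem_checksOf hdv
  have edges_card_ne : (T.edges.card : ℝ) ≠ 0 := Nat.cast_ne_zero.mpr
    (Finset.card_ne_zero_of_mem (mem_edges_iff.mpr (mem_checksOf_iff.mp hc)))
  rw [bitErrorProb_eq_sum_edges, div_eq_iff edges_card_ne, mul_comm, ← nsmul_eq_mul]
  exact Finset.sum_eq_card_nsmul fun a ha => h.bscExpect_bitIndicator_varMsg
    (lt_egirth_of_le_maxIter hℓ) (mem_checksOf_iff.mpr (mem_edges_iff.mp ha))

end Tanner

section DensityEvolutionBounds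

variable {p q x : ℝ} {k dv dc : ℕ}

lemma parityError_mem_Icc (hk : k ≠ 0) (hx : x ∈ Set.Icc 0 (1 / 2)) :
    parityError k x ∈ Set.Icc x (1 / 2) := by
  have nonneg : 0 ≤ 1 - 2 * x := by linarith [hx.2]
  have pow_le : (1 - 2 * x) ^ k ≤ 1 - 2 * x := pow_le_of_le_one nonneg (by linarith [hx.1]) hk
  have pow_nonneg := pow_nonneg nonneg k
  unfold parityError
  constructor <;> linarith

lemma parityError_le_mul (hx : x ≤ 1 / 2) : parityError k x ≤ k * x := by
  have bernoulli := one_add_mul_le_pow (a := -(2 * x)) (by linarith) k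
  rw [← sub_eq_add_neg] at bernoulli
  unfold parityError
  linarith

lemma mul_le_varError (hp : p ∈ Set.Icc 0 (1 / 2)) (hk : k ≠ 0) (hq : q ∈ Set.Icc 0 (1 / 2)) :
    p * q ≤ varError p k q := by
  have pow_le : (1 - q) ^ k ≤ 1 - q :=
    pow_le_of_le_one (by linarith [hq.2]) (by linarith [hq.1]) hk
  calc p * q ≤ p * (1 - (1 - q) ^ k) := mul_le_mul_of_nonneg_left (by linarith) hp.1
    _ ≤ varError p k q :=
      le_add_of_nonneg_right (mul_nonneg (by linarith [hp.2]) (pow_nonneg hq.1 k))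

lemma varError_le_half (hp : p ∈ Set.Icc 0 (1 / 2)) (hk : k ≠ 0) (hq : q ∈ Set.Icc 0 (1 / 2)) :
    varError p k q ≤ 1 / 2 := by
  obtain ⟨hp0, hp1⟩ := hp
  obtain ⟨hq0, hq1⟩ := hq
  have pow_le_one_sub_pow : q ^ k ≤ (1 - q) ^ k := pow_le_pow_left₀ hq0 (by linarith) k
  have pow_le_half : q ^ k ≤ 1 / 2 := (pow_le_of_le_one hq0 (by linarith) hk).trans hq1
  calc varError p k q ≤ p * (1 - q ^ k) + (1 - p) * q ^ k := by unfold varError; gcongr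
    _ ≤ 1 / 2 := by nlinarith

lemma varError_le (hp : 0 ≤ p) (hk : 2 ≤ k) (hq : q ∈ Set.Icc 0 (1 / 2)) :
    varError p k q ≤ p * (k * q) + q ^ 2 := by
  obtain ⟨hq0, hq1⟩ := hq
  have bernoulli := one_add_mul_le_pow (a := -q) (by linarith) k
  rw [← sub_eq_add_neg] at bernoulli
  have pow_le_sq : q ^ k ≤ q ^ 2 := pow_le_pow_of_le_one hq0 (by linarith) hk
  have pow_nonneg := pow_nonneg hq0 k
  unfold varError
  gcongr
  · linarith
  · nlinarith

lemma densityEvolution_mem_Icc (hp : p ∈ Set.Icc 0 (1 / 2)) (hdv : 2 ≤ dv) (hdc : 2 ≤ dc) (ℓ : ℕ) :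
    densityEvolution p dv dc ℓ ∈ Set.Icc (p ^ (ℓ + 1)) (1 / 2) := by
  induction ℓ with
  | zero => simpa [densityEvolution] using hp.2
  | succ ℓ ih =>
    have pow_nonneg := pow_nonneg hp.1 (ℓ + 1)
    obtain ⟨le_parity, parity_le⟩ :=
      parityError_mem_Icc (k := dc - 1) (by omega) ⟨pow_nonneg.trans ih.1, ih.2⟩
    have pow_le_parity := ih.1.trans le_parity
    have parity_mem := Set.mem_Icc.mpr ⟨pow_nonneg.trans pow_le_parity, parity_le⟩
    refine ⟨?_, varError_le_half hp (by omega) parity_mem⟩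
    rw [pow_succ']
    exact (mul_le_mul_of_nonneg_left pow_le_parity hp.1).trans
      (mul_le_varError hp (by omega) parity_mem)

lemma densityEvolution_succ_le (hp : p ∈ Set.Icc 0 (1 / 2)) (hdv : 3 ≤ dv) (hdc : 2 ≤ dc)
    (ℓ : ℕ) : densityEvolution p dv dc (ℓ + 1) ≤
      dv * dc * (p * densityEvolution p dv dc ℓ) +
        (dv * dc) ^ 2 * densityEvolution p dv dc ℓ ^ 2 := by
  have mem := densityEvolution_mem_Icc hp (by omega : 2 ≤ dv) hdc ℓ
  rw [densityEvolution]
  generalize densityEvolution p dv dc ℓ = x at *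
  have x_nonneg : 0 ≤ x := (pow_nonneg hp.1 _).trans mem.1
  obtain ⟨le_parity, parity_le⟩ := parityError_mem_Icc (k := dc - 1) (by omega) ⟨x_nonneg, mem.2⟩
  have parity_le_mul : parityError (dc - 1) x ≤ dc * x :=
    (parityError_le_mul mem.2).trans (by gcongr; omega)
  have parity_nonneg := x_nonneg.trans le_parity
  have one_le_dv : (1 : ℝ) ≤ dv := Nat.one_le_cast.mpr (by omega)
  calc varError p (dv - 1) (parityError (dc - 1) x)
      ≤ p * (((dv - 1 : ℕ) : ℝ) * parityError (dc - 1) x) + parityError (dc - 1) x ^ 2 :=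
        varError_le hp.1 (by omega) ⟨parity_nonneg, parity_le⟩
    _ ≤ p * (dv * (dc * x)) + (1 * (dc * x)) ^ 2 := by
        rw [one_mul]
        gcongr
        · exact hp.1
        · omega
    _ ≤ p * (dv * (dc * x)) + (dv * (dc * x)) ^ 2 := by gcongr
    _ = dv * dc * (p * x) + (dv * dc) ^ 2 * x ^ 2 := by ring

lemma densityEvolution_le (h0 : 0 ≤ p) (hdv : 3 ≤ dv) (hdc : 2 ≤ dc)
    (hp : 2 * ((dv : ℝ) * dc) ^ 2 * p ≤ 1) (ℓ : ℕ) :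
    densityEvolution p dv dc ℓ ≤ (2 * ((dv : ℝ) * dc) ^ 2 * p) ^ (ℓ + 1) := by
  have one_le_D : (1 : ℝ) ≤ dv * dc := by
    rw [← Nat.cast_mul]
    exact Nat.one_le_cast.mpr (Nat.mul_pos (by omega) (by omega))
  generalize hD : (dv : ℝ) * dc = D at *
  have D_le : D ≤ D ^ 2 := le_self_pow₀ one_le_D two_ne_zero
  have p_mem : p ∈ Set.Icc 0 (1 / 2) := ⟨h0, by nlinarith⟩
  have nonneg (ℓ : ℕ) : 0 ≤ densityEvolution p dv dc ℓ :=
    (pow_nonneg h0 _).trans (densityEvolution_mem_Icc p_mem (by omega) hdc ℓ).1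
  suffices scaled : 2 * D ^ 2 * densityEvolution p dv dc ℓ ≤ (2 * D ^ 2 * p) ^ (ℓ + 1) by
    nlinarith [nonneg ℓ]
  induction ℓ with
  | zero => exact (pow_one _).ge
  | succ ℓ ih =>
    have step := densityEvolution_succ_le p_mem hdv hdc ℓ
    rw [hD] at step
    have x_nonneg := nonneg ℓ
    generalize densityEvolution p dv dc ℓ = x at *
    have base_nonneg : 0 ≤ 2 * D ^ 2 * p := by positivity
    have scaled_le_base : 2 * D ^ 2 * x ≤ 2 * D ^ 2 * p :=
      ih.trans (pow_le_of_le_one base_nonneg hp (by omega))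
    calc 2 * D ^ 2 * densityEvolution p dv dc (ℓ + 1)
        ≤ 2 * D ^ 2 * (D * (p * x) + D ^ 2 * x ^ 2) := by gcongr
      _ ≤ 2 * D ^ 2 * (D ^ 2 * (p * x) + D ^ 2 * x ^ 2) := by gcongr
      _ = (2 * D ^ 2 * p + 2 * D ^ 2 * x) * (2 * D ^ 2 * x) / 2 := by ring
      _ ≤ (2 * D ^ 2 * p + 2 * D ^ 2 * p) * (2 * D ^ 2 * p) ^ (ℓ + 1) / 2 := by gcongr
      _ = (2 * D ^ 2 * p) ^ (ℓ + 1 + 1) := by ring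

end DensityEvolutionBounds

/-! ### Adding an edge to a graph of large girth -/

section AddEdge

open SimpleGraph

variable {V : Type*} {G K : SimpleGraph V} {r : ℕ} {a b s t x w : V}

lemma natCast_le_edist_iff : (r : ℕ∞) ≤ G.edist a b ↔ ∀ p : G.Walk a b, r ≤ p.length := by
  simp only [SimpleGraph.edist, le_iInf_iff, Nat.cast_le]

lemma edist_le_one_add_edist (hab : G.Adj a b) : G.edist a x ≤ 1 + G.edist b x :=
  edist_eq_one_iff_adj.mpr hab ▸ G.edist_triangle

lemma natCast_lt_egirth_iff : (r : ℕ∞) < G.egirth ↔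
    ∀ ⦃a b : V⦄, G.Adj a b → (r : ℕ∞) ≤ (G.deleteEdges {s(a, b)}).edist a b := by
  classical
  rw [← Order.add_one_le_iff_of_not_isMax (by simp), ← Nat.cast_add_one, le_egirth]
  constructor
  · intro long_cycles a b hab
    refine natCast_le_edist_iff.mpr fun p => ?_
    have edge_notMem : s(a, b) ∉ p.bypass.edges := fun h =>
      (deleteEdges_adj.mp (p.bypass.adj_of_mem_edges h)).2 rfl
    let q : G.Walk a b := p.bypass.mapLe (deleteEdges_le _)
    have cycle : (Walk.cons hab.symm q).IsCycle := by
      rw [Walk.cons_isCycle_iff, Sym2.eq_swap, Walk.edges_mapLe_eq_edges]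
      exact ⟨(p.bypass_isPath).mapLe _, edge_notMem⟩
    have length_le := Nat.cast_le.mp (long_cycles b _ cycle)
    rw [Walk.length_cons, Walk.length_mapLe, Nat.add_le_add_iff_right] at length_le
    exact length_le.trans p.length_bypass_le_length
  · rintro long_detours a (_ | ⟨hab, p⟩) cycle
    · simp at cycle
    · rw [Walk.cons_isCycle_iff] at cycle
      have length_ge := natCast_le_edist_iff.mp (edist_comm ▸ long_detours hab)
        (p.toDeleteEdge _ cycle.2)
      rw [Walk.toDeleteEdge, Walk.toDeleteEdges, Walk.length_transfer] at length_ge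
      rw [Walk.length_cons]
      exact_mod_cast Nat.succ_le_succ length_ge

lemma min_le_edist_sup_edge (K : SimpleGraph V) (x w s t : V) :
    min (K.edist s t)
        (min (1 + (K.edist s x + K.edist w t)) (1 + (K.edist s w + K.edist x t))) ≤
      (K ⊔ edge x w).edist s t := by
  refine le_iInf fun p => ?_
  induction p with
  | nil => simp
  | @cons s u t h p ih =>
    rw [Walk.length_cons, Nat.cast_add_one, add_comm (p.length : ℕ∞)]
    refine le_trans ?_ (add_le_add_right ih 1)
    rw [← min_add_add_left, ← min_add_add_left]
    rw [sup_adj, edge_adj] at h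
    rcases h with h | ⟨⟨rfl, rfl⟩ | ⟨rfl, rfl⟩, -⟩
    · simp only [← add_assoc 1 (K.edist u _)]
      gcongr <;> exact edist_le_one_add_edist h
    all_goals
      simp only [edist_self, zero_add]
      refine le_min ?_ (le_min ?_ ?_)
    · exact (min_le_right _ _).trans (min_le_left _ _)
    · exact (min_le_right _ _).trans ((min_le_left _ _).trans
        (add_le_add_right (le_add_self.trans le_add_self) 1))
    · exact (min_le_left _ _).trans (by simp [← add_assoc])
    · exact (min_le_right _ _).trans (min_le_right _ _)
    · exact (min_le_left _ _).trans (by simp [← add_assoc])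
    · exact (min_le_right _ _).trans ((min_le_right _ _).trans
        (add_le_add_right (le_add_self.trans le_add_self) 1))

lemma natCast_lt_egirth_sup_edge (hK : (r : ℕ∞) < K.egirth) (hxw : (r : ℕ∞) ≤ K.edist x w) :
    (r : ℕ∞) < (K ⊔ edge x w).egirth := by
  refine natCast_lt_egirth_iff.mpr fun a b hab => ?_
  rw [deleteEdges_sup]
  by_cases hs : s(x, w) = s(a, b)
  · rw [deleteEdges_edge (by exact hs), sup_bot_eq]
    refine le_trans ?_ (edist_anti (deleteEdges_le _))
    rcases Sym2.eq_iff.mp hs with ⟨rfl, rfl⟩ | ⟨rfl, rfl⟩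
    · exact hxw
    · exact hxw.trans_eq edist_comm
  · have adj : K.Adj a b := by
      rw [sup_adj, edge_adj] at hab
      grind
    have le_of_cross {y z : V} (hyz : (r : ℕ∞) ≤ K.edist y z) : (r : ℕ∞) ≤
        1 + ((K.deleteEdges {s(a, b)}).edist a y + (K.deleteEdges {s(a, b)}).edist z b) :=
      calc (r : ℕ∞) ≤ K.edist y z := hyz
        _ ≤ K.edist y a + K.edist a z := K.edist_triangle
        _ ≤ K.edist y a + (1 + K.edist b z) := by gcongr; exact edist_le_one_add_edist adj
        _ = 1 + (K.edist a y + K.edist z b) := by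
          rw [edist_comm (u := y), edist_comm (u := b), add_left_comm]
        _ ≤ _ := by gcongr <;> exact K.deleteEdges_le _
    refine le_trans (le_min ?_ (le_min ?_ ?_)) ((min_le_edist_sup_edge _ x w a b).trans
      (edist_anti (sup_le_sup_left (deleteEdges_le _) _)))
    · exact natCast_lt_egirth_iff.mp hK adj
    · exact le_of_cross hxw
    · exact le_of_cross (hxw.trans_eq edist_comm)

end AddEdge

/-! ### Regular codes of large girth -/

namespace Tanner

variable {T : Tanner} {dv dc r : ℕ}

lemma not_graph_adj_inl_inl {v v' : Fin T.n} : ¬ T.graph.Adj (Sum.inl v) (Sum.inl v') := by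
  simp [graph]

lemma not_graph_adj_inr_inr {c c' : Fin T.m} : ¬ T.graph.Adj (Sum.inr c) (Sum.inr c') := by
  simp [graph]

lemma graph_le_iff {K : SimpleGraph (Fin T.n ⊕ Fin T.m)} :
    T.graph ≤ K ↔ ∀ v, ∀ c ∈ T.checksOf v, K.Adj (Sum.inl v) (Sum.inr c) := by
  refine ⟨fun h v c hc => h (graph_adj_inl_inr.mpr hc), fun h a b hab => ?_⟩
  match a, b, hab with
  | .inl v, .inr c, hab => exact h v c (graph_adj_inl_inr.mp hab)
  | .inr c, .inl v, hab => exact (h v c (graph_adj_inl_inr.mp hab.symm)).symm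
  | .inl _, .inl _, hab => exact absurd hab not_graph_adj_inl_inl
  | .inr _, .inr _, hab => exact absurd hab not_graph_adj_inr_inr

/-- The variable nodes at distance at most two from `S` in the Tanner graph. -/
def nextVars (T : Tanner) (S : Finset (Fin T.n)) : Finset (Fin T.n) :=
  S ∪ S.biUnion fun v => (T.checksOf v).biUnion T.varsOf

/-- The variable nodes at distance at most `2 * j` from `S` in the Tanner graph. -/
def varBall (T : Tanner) : ℕ → Finset (Fin T.n) → Finset (Fin T.n)
  | 0, S => S
  | j + 1, S => T.varBall j (T.nextVars S)

/-- Tanner graphs from which a `(dv, dc)`-regular code of girth greater than `r` may be built by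
adding edges. -/
structure IsSparse (T : Tanner) (dv dc r : ℕ) : Prop where
  card_checksOf_le : ∀ v, (T.checksOf v).card ≤ dv
  card_varsOf_le : ∀ c, (T.varsOf c).card ≤ dc
  lt_egirth : (r : ℕ∞) < T.graph.egirth

lemma subset_varBall (j : ℕ) (S : Finset (Fin T.n)) : S ⊆ T.varBall j S := by
  induction j generalizing S with
  | zero => exact subset_rfl
  | succ j ih => exact Finset.subset_union_left.trans (ih _)

lemma IsSparse.card_nextVars_le (h : T.IsSparse dv dc r) (S : Finset (Fin T.n)) :
    (T.nextVars S).card ≤ S.card * (1 + dv * dc) :=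
  calc (T.nextVars S).card ≤ S.card + S.card * (dv * dc) :=
        (Finset.card_union_le _ _).trans (Nat.add_le_add_left
          (Finset.card_biUnion_le_card_mul _ _ _ fun v _ =>
            (Finset.card_biUnion_le_card_mul _ _ _ fun c _ => h.card_varsOf_le c).trans
              (Nat.mul_le_mul_right _ (h.card_checksOf_le v))) _)
    _ = S.card * (1 + dv * dc) := by ring

lemma IsSparse.card_varBall_le (h : T.IsSparse dv dc r) (j : ℕ) (S : Finset (Fin T.n)) :
    (T.varBall j S).card ≤ S.card * (1 + dv * dc) ^ j := by
  induction j generalizing S with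
  | zero => simp [varBall]
  | succ j ih =>
    calc (T.varBall (j + 1) S).card ≤ (T.nextVars S).card * (1 + dv * dc) ^ j := ih _
      _ ≤ S.card * (1 + dv * dc) * (1 + dv * dc) ^ j := by gcongr; exact h.card_nextVars_le S
      _ = S.card * (1 + dv * dc) ^ (j + 1) := by ring

lemma mem_varBall_of_walk {j : ℕ} {S : Finset (Fin T.n)} {x u : Fin T.n} (hx : x ∈ S)
    (p : T.graph.Walk (Sum.inl x) (Sum.inl u)) (hp : p.length ≤ 2 * j + 1) :
    u ∈ T.varBall j S := by
  match j, p, hp with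
  | _, .nil, _ => exact subset_varBall _ _ hx
  | _, .cons (v := Sum.inl _) h _, _ => exact absurd h not_graph_adj_inl_inl
  | _, .cons (v := Sum.inr _) _ (.cons (v := Sum.inr _) h _), _ =>
    exact absurd h not_graph_adj_inr_inr
  | 0, .cons (v := Sum.inr _) _ (.cons (v := Sum.inl _) _ _), hp =>
    simp only [SimpleGraph.Walk.length_cons] at hp
    omega
  | j + 1, .cons (v := Sum.inr c) h (.cons (v := Sum.inl x') h' q), hp =>
    simp only [SimpleGraph.Walk.length_cons] at hp
    refine mem_varBall_of_walk (S := T.nextVars S) (x := x') ?_ q (by omega)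
    refine Finset.mem_union_right S (Finset.mem_biUnion.mpr ⟨x, hx, ?_⟩)
    exact Finset.mem_biUnion.mpr ⟨c, graph_adj_inl_inr.mp h,
      mem_checksOf_iff_mem_varsOf.mp (graph_adj_inl_inr.mp h'.symm)⟩

lemma le_edist_of_notMem_varBall_singleton {j : ℕ} {x u : Fin T.n} (hu : u ∉ T.varBall j {x}) :
    ((2 * j + 2 : ℕ) : ℕ∞) ≤ T.graph.edist (Sum.inl x) (Sum.inl u) := by
  refine natCast_le_edist_iff.mpr fun p => ?_
  by_contra! short
  exact hu (mem_varBall_of_walk (Finset.mem_singleton_self x) p (by omega))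

lemma le_edist_of_notMem_varBall_varsOf {j : ℕ} {y : Fin T.m} {u : Fin T.n}
    (hu : u ∉ T.varBall j (T.varsOf y)) :
    ((2 * j + 2 : ℕ) : ℕ∞) ≤ T.graph.edist (Sum.inr y) (Sum.inl u) := by
  refine natCast_le_edist_iff.mpr fun p => ?_
  by_contra! short
  match p, short with
  | .cons (v := Sum.inr _) h _, _ => exact not_graph_adj_inr_inr h
  | .cons (v := Sum.inl x) h q, short =>
    simp only [SimpleGraph.Walk.length_cons] at short
    exact hu (mem_varBall_of_walk
      (mem_checksOf_iff_mem_varsOf.mp (graph_adj_inl_inr.mp h.symm)) q (by omega))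

lemma IsSparse.exists_far_var (h : T.IsSparse dv dc r) {j : ℕ}
    (hn : (1 + dc) * (1 + dv * dc) ^ j < T.n) (x : Fin T.n) (y : Fin T.m) :
    ∃ u : Fin T.n, ((2 * j + 2 : ℕ) : ℕ∞) ≤ T.graph.edist (Sum.inl x) (Sum.inl u) ∧
      ((2 * j + 2 : ℕ) : ℕ∞) ≤ T.graph.edist (Sum.inr y) (Sum.inl u) := by
  have card_lt : (T.varBall j {x} ∪ T.varBall j (T.varsOf y)).card <
      (Finset.univ : Finset (Fin T.n)).card := by
    calc (T.varBall j {x} ∪ T.varBall j (T.varsOf y)).card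
        ≤ 1 * (1 + dv * dc) ^ j + dc * (1 + dv * dc) ^ j :=
          (Finset.card_union_le _ _).trans (Nat.add_le_add (h.card_varBall_le _ _)
            ((h.card_varBall_le _ _).trans (Nat.mul_le_mul_right _ (h.card_varsOf_le y))))
      _ = (1 + dc) * (1 + dv * dc) ^ j := by ring
      _ < (Finset.univ : Finset (Fin T.n)).card := by rwa [Finset.card_fin]
  obtain ⟨u, -, hu⟩ := Finset.exists_mem_notMem_of_card_lt_card card_lt
  rw [Finset.mem_union, not_or] at hu
  exact ⟨u, le_edist_of_notMem_varBall_singleton hu.1, le_edist_of_notMem_varBall_varsOf hu.2⟩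

end Tanner

section EdgeSets

variable {n m dv dc r j : ℕ} {E : Finset (Fin n × Fin m)} {u v x : Fin n} {c w y : Fin m}

/-- The Tanner graph with the given edges. -/
abbrev tannerOfEdges (E : Finset (Fin n × Fin m)) : Tanner where
  n := n
  m := m
  H := fun c v => if (v, c) ∈ E then 1 else 0

lemma mem_checksOf_tannerOfEdges : c ∈ (tannerOfEdges E).checksOf v ↔ (v, c) ∈ E :=
  Tanner.mem_checksOf_iff.trans (by simp)

lemma mem_varsOf_tannerOfEdges : v ∈ (tannerOfEdges E).varsOf c ↔ (v, c) ∈ E :=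
  Tanner.mem_checksOf_iff_mem_varsOf.symm.trans mem_checksOf_tannerOfEdges

lemma graph_tannerOfEdges_adj :
    (tannerOfEdges E).graph.Adj (Sum.inl v) (Sum.inr c) ↔ (v, c) ∈ E :=
  Tanner.graph_adj_inl_inr.trans mem_checksOf_tannerOfEdges

lemma graph_tannerOfEdges_le_iff {K : SimpleGraph (Fin n ⊕ Fin m)} :
    (tannerOfEdges E).graph ≤ K ↔ ∀ v c, (v, c) ∈ E → K.Adj (Sum.inl v) (Sum.inr c) :=
  Tanner.graph_le_iff.trans (forall₂_congr fun _ _ => by rw [mem_checksOf_tannerOfEdges])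

lemma card_checksOf_tannerOfEdges (E : Finset (Fin n × Fin m)) (v : Fin n) :
    ((tannerOfEdges E).checksOf v).card = ∑ a ∈ E, if a.1 = v then 1 else 0 := by
  rw [← Finset.card_filter]
  refine Finset.card_bij (fun c _ => (v, c)) (fun c hc => ?_) (fun c _ c' _ h => ?_) ?_
  · exact Finset.mem_filter.mpr ⟨mem_checksOf_tannerOfEdges.mp hc, rfl⟩
  · exact (Prod.mk.inj h).2
  · rintro ⟨v', c⟩ h
    obtain ⟨hmem, rfl⟩ := Finset.mem_filter.mp h
    exact ⟨c, mem_checksOf_tannerOfEdges.mpr hmem, rfl⟩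

lemma card_varsOf_tannerOfEdges (E : Finset (Fin n × Fin m)) (c : Fin m) :
    ((tannerOfEdges E).varsOf c).card = ∑ a ∈ E, if a.2 = c then 1 else 0 := by
  rw [← Finset.card_filter]
  refine Finset.card_bij (fun v _ => (v, c)) (fun v hv => ?_) (fun v _ v' _ h => ?_) ?_
  · exact Finset.mem_filter.mpr ⟨mem_varsOf_tannerOfEdges.mp hv, rfl⟩
  · exact (Prod.mk.inj h).1
  · rintro ⟨v, c'⟩ h
    obtain ⟨hmem, rfl⟩ := Finset.mem_filter.mp h
    exact ⟨v, mem_varsOf_tannerOfEdges.mpr hmem, rfl⟩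

lemma sum_card_checksOf_tannerOfEdges (E : Finset (Fin n × Fin m)) :
    ∑ v : Fin n, ((tannerOfEdges E).checksOf v).card = E.card := by
  rw [Finset.sum_congr rfl fun v _ => card_checksOf_tannerOfEdges E v, Finset.sum_comm]
  simp

lemma sum_card_varsOf_tannerOfEdges (E : Finset (Fin n × Fin m)) :
    ∑ c : Fin m, ((tannerOfEdges E).varsOf c).card = E.card := by
  rw [Finset.sum_congr rfl fun c _ => card_varsOf_tannerOfEdges E c, Finset.sum_comm]
  simp

lemma graph_tannerOfEdges_insert_le (E : Finset (Fin n × Fin m)) (v : Fin n) (c : Fin m) :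
    (tannerOfEdges (insert (v, c) E)).graph ≤
      (tannerOfEdges E).graph ⊔ SimpleGraph.edge (Sum.inl v) (Sum.inr c) := by
  refine graph_tannerOfEdges_le_iff.mpr fun v' c' h => ?_
  rw [SimpleGraph.sup_adj, SimpleGraph.edge_adj]
  rcases Finset.mem_insert.mp h with h | h
  · obtain ⟨rfl, rfl⟩ := Prod.mk.inj h
    exact Or.inr ⟨Or.inl ⟨rfl, rfl⟩, Sum.inl_ne_inr⟩
  · exact Or.inl (graph_tannerOfEdges_adj.mpr h)

lemma graph_tannerOfEdges_erase_le (E : Finset (Fin n × Fin m)) (v : Fin n) (c : Fin m) :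
    (tannerOfEdges (E.erase (v, c))).graph ≤
      (tannerOfEdges E).graph.deleteEdges {s(Sum.inl v, Sum.inr c)} := by
  refine graph_tannerOfEdges_le_iff.mpr fun v' c' h => ?_
  obtain ⟨hne, hmem⟩ := Finset.mem_erase.mp h
  rw [SimpleGraph.deleteEdges_adj]
  exact ⟨graph_tannerOfEdges_adj.mpr hmem, fun heq => hne (by simpa using heq)⟩

lemma notMem_of_one_lt_edist
    (h : 1 < (tannerOfEdges E).graph.edist (Sum.inr c) (Sum.inl v)) : (v, c) ∉ E := fun hvc =>
  h.ne' (SimpleGraph.edist_eq_one_iff_adj.mpr (graph_tannerOfEdges_adj.mpr hvc).symm)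

lemma isSparse_empty : (tannerOfEdges (∅ : Finset (Fin n × Fin m))).IsSparse dv dc r where
  card_checksOf_le v := (card_checksOf_tannerOfEdges ∅ v).trans_le (by simp)
  card_varsOf_le c := (card_varsOf_tannerOfEdges ∅ c).trans_le (by simp)
  lt_egirth := by
    have graph_eq_bot : (tannerOfEdges (∅ : Finset (Fin n × Fin m))).graph = ⊥ :=
      le_bot_iff.mp (graph_tannerOfEdges_le_iff.mpr (by simp))
    rw [graph_eq_bot, SimpleGraph.egirth_bot]
    exact ENat.natCast_lt_top r

lemma isSparse_insert (h : (tannerOfEdges E).IsSparse dv dc r)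
    (hu : ((tannerOfEdges E).checksOf u).card < dv) (hy : ((tannerOfEdges E).varsOf y).card < dc)
    (huyE : (u, y) ∉ E)
    (huy : (r : ℕ∞) ≤ (tannerOfEdges E).graph.edist (Sum.inl u) (Sum.inr y)) :
    (tannerOfEdges (insert (u, y) E)).IsSparse dv dc r := by
  refine ⟨fun v => ?_, fun c => ?_, ?_⟩
  · have degree_le := h.card_checksOf_le v
    rw [card_checksOf_tannerOfEdges] at degree_le hu ⊢
    rw [Finset.sum_insert huyE]
    grind
  · have degree_le := h.card_varsOf_le c
    rw [card_varsOf_tannerOfEdges] at degree_le hy ⊢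
    rw [Finset.sum_insert huyE]
    grind
  · exact (natCast_lt_egirth_sup_edge h.lt_egirth huy).trans_le
      (SimpleGraph.egirth_anti (graph_tannerOfEdges_insert_le E u y))

/-- The edge set obtained from `E` by replacing the edge `(u, w)` with the edges `(u, y)` and
`(x, w)`. -/
def switchEdges (E : Finset (Fin n × Fin m)) (u x : Fin n) (w y : Fin m) :
    Finset (Fin n × Fin m) :=
  insert (u, y) (insert (x, w) (E.erase (u, w)))

lemma sum_switchEdges_add (huw : (u, w) ∈ E) (hxw : (x, w) ∉ E) (huy : (u, y) ∉ E) (hxu : x ≠ u)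
    (f : Fin n × Fin m → ℕ) :
    ∑ a ∈ switchEdges E u x w y, f a + f (u, w) = f (u, y) + f (x, w) + ∑ a ∈ E, f a := by
  have xw_notMem : (x, w) ∉ E.erase (u, w) := fun h => hxw (Finset.mem_of_mem_erase h)
  have uy_notMem : (u, y) ∉ insert (x, w) (E.erase (u, w)) := by
    rw [Finset.mem_insert, not_or]
    exact ⟨fun h => hxu (Prod.mk.inj h).1.symm, fun h => huy (Finset.mem_of_mem_erase h)⟩
  rw [switchEdges, Finset.sum_insert uy_notMem, Finset.sum_insert xw_notMem,
    ← Finset.add_sum_erase _ _ huw]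
  ring

lemma natCast_lt_egirth_switchEdges (hE : (r : ℕ∞) < (tannerOfEdges E).graph.egirth)
    (huw : (u, w) ∈ E)
    (hxu : (r : ℕ∞) ≤ (tannerOfEdges E).graph.edist (Sum.inl x) (Sum.inl u))
    (hxw : (r : ℕ∞) ≤ (tannerOfEdges E).graph.edist (Sum.inl x) (Sum.inr w))
    (hyu : (r : ℕ∞) ≤ (tannerOfEdges E).graph.edist (Sum.inr y) (Sum.inl u)) :
    (r : ℕ∞) < (tannerOfEdges (switchEdges E u x w y)).graph.egirth := by
  set K := (tannerOfEdges (E.erase (u, w))).graph with hK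
  have K_le := graph_tannerOfEdges_erase_le E u w
  have K_le_graph : K ≤ (tannerOfEdges E).graph := K_le.trans (SimpleGraph.deleteEdges_le _)
  have le_edist_uw : (r : ℕ∞) ≤ K.edist (Sum.inl u) (Sum.inr w) :=
    (natCast_lt_egirth_iff.mp hE (graph_tannerOfEdges_adj.mpr huw)).trans
      (SimpleGraph.edist_anti K_le)
  have le_edist_uy : (r : ℕ∞) ≤
      (K ⊔ SimpleGraph.edge (Sum.inl x) (Sum.inr w)).edist (Sum.inl u) (Sum.inr y) := by
    rw [SimpleGraph.edist_comm] at hxu hyu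
    refine le_trans (le_min ?_ (le_min ?_ ?_)) (min_le_edist_sup_edge K _ _ _ _)
    · exact hyu.trans (SimpleGraph.edist_anti K_le_graph)
    · exact (hxu.trans (SimpleGraph.edist_anti K_le_graph)).trans
        (le_self_add.trans le_add_self)
    · exact le_edist_uw.trans (le_self_add.trans le_add_self)
  have lt_egirth_sup := natCast_lt_egirth_sup_edge
    (natCast_lt_egirth_sup_edge (hE.trans_le (SimpleGraph.egirth_anti K_le_graph))
      (hxw.trans (SimpleGraph.edist_anti K_le_graph))) le_edist_uy
  exact lt_egirth_sup.trans_le (SimpleGraph.egirth_anti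
    ((graph_tannerOfEdges_insert_le _ u y).trans
      (sup_le_sup_right (graph_tannerOfEdges_insert_le _ x w) _)))

lemma isSparse_switchEdges (h : (tannerOfEdges E).IsSparse dv dc r)
    (hx : ((tannerOfEdges E).checksOf x).card < dv) (hy : ((tannerOfEdges E).varsOf y).card < dc)
    (huw : (u, w) ∈ E) (hxwE : (x, w) ∉ E) (huyE : (u, y) ∉ E) (hxu_ne : x ≠ u)
    (hxu : (r : ℕ∞) ≤ (tannerOfEdges E).graph.edist (Sum.inl x) (Sum.inl u))
    (hxw : (r : ℕ∞) ≤ (tannerOfEdges E).graph.edist (Sum.inl x) (Sum.inr w))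
    (hyu : (r : ℕ∞) ≤ (tannerOfEdges E).graph.edist (Sum.inr y) (Sum.inl u)) :
    (tannerOfEdges (switchEdges E u x w y)).IsSparse dv dc r := by
  have sum_switch := sum_switchEdges_add huw hxwE huyE hxu_ne
  refine ⟨fun v => ?_, fun c => ?_, natCast_lt_egirth_switchEdges h.lt_egirth huw hxu hxw hyu⟩
  · have degree_le := h.card_checksOf_le v
    have degree_eq := sum_switch fun a => if a.1 = v then 1 else 0
    rw [card_checksOf_tannerOfEdges] at degree_le hx ⊢
    grind
  · have degree_le := h.card_varsOf_le c
    have degree_eq := sum_switch fun a => if a.2 = c then 1 else 0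
    rw [card_varsOf_tannerOfEdges] at degree_le hy ⊢
    grind

/-- If the far variable node `u` already has degree `dv`, one of its edges `(u, w)` is replaced by
`(u, y)` and `(x, w)`. -/
lemma exists_isSparse_card_succ (h : (tannerOfEdges E).IsSparse dv dc (2 * j)) (hdv : 0 < dv)
    (hj : 1 ≤ j) (hn : (1 + dc) * (1 + dv * dc) ^ j < n)
    (hx : ((tannerOfEdges E).checksOf x).card < dv)
    (hy : ((tannerOfEdges E).varsOf y).card < dc) :
    ∃ E' : Finset (Fin n × Fin m),
      (tannerOfEdges E').IsSparse dv dc (2 * j) ∧ E'.card = E.card + 1 := by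
  obtain ⟨u, hxu, hyu⟩ := h.exists_far_var hn x y
  have le_far : ((2 * j : ℕ) : ℕ∞) ≤ ((2 * j + 2 : ℕ) : ℕ∞) := by norm_cast; omega
  have one_lt : (1 : ℕ∞) < ((2 * j : ℕ) : ℕ∞) := by norm_cast; omega
  have huyE := notMem_of_one_lt_edist (one_lt.trans_le (le_far.trans hyu))
  rcases (h.card_checksOf_le u).lt_or_eq with hu | hu
  · refine ⟨insert (u, y) E, isSparse_insert h hu hy huyE ?_, Finset.card_insert_of_notMem huyE⟩
    rw [SimpleGraph.edist_comm]
    exact le_far.trans hyu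
  obtain ⟨w, hw⟩ := Finset.card_pos.mp (hdv.trans_eq hu.symm)
  have huw := mem_checksOf_tannerOfEdges.mp hw
  have hwx : ((2 * j : ℕ) : ℕ∞) ≤
      (tannerOfEdges E).graph.edist (Sum.inr w) (Sum.inl x) := by
    refine (ENat.add_le_add_iff_left ENat.one_ne_top).mp (le_trans ?_
      (edist_le_one_add_edist (graph_tannerOfEdges_adj.mpr huw)))
    rw [SimpleGraph.edist_comm]
    exact le_trans (by norm_cast; omega) hxu
  have hxwE := notMem_of_one_lt_edist (one_lt.trans_le hwx)
  have hxu_ne : x ≠ u := by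
    rintro rfl
    simp at hxu
  refine ⟨switchEdges E u x w y, isSparse_switchEdges h hx hy huw hxwE huyE hxu_ne
    (le_far.trans hxu) (SimpleGraph.edist_comm ▸ hwx) (le_far.trans hyu), ?_⟩
  have card_eq := sum_switchEdges_add huw hxwE huyE hxu_ne fun _ => 1
  simp only [Finset.sum_const, smul_eq_mul, mul_one] at card_eq
  omega

end EdgeSets

/-- An edge set of maximal size among the sparse ones is saturated on one side, hence, by double
counting, on both. -/
theorem exists_regular_lt_egirth {dv dc j t : ℕ} (hdv : 0 < dv) (hj : 1 ≤ j)
    (hn : (1 + dc) * (1 + dv * dc) ^ j < dc * t) :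
    ∃ T : Tanner, T.n = dc * t ∧ T.Regular dv dc ∧ ((2 * j : ℕ) : ℕ∞) < T.graph.egirth := by
  classical
  obtain ⟨E, hE, hmax⟩ := Finset.exists_max_image
    (Finset.univ.filter fun E : Finset (Fin (dc * t) × Fin (dv * t)) =>
      (tannerOfEdges E).IsSparse dv dc (2 * j))
    Finset.card ⟨∅, by simpa using isSparse_empty⟩
  simp only [Finset.mem_filter, Finset.mem_univ, true_and] at hE hmax
  have saturated : ∀ x y, ((tannerOfEdges E).checksOf x).card < dv →
      ((tannerOfEdges E).varsOf y).card < dc → False := fun x y hx hy => by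
    obtain ⟨E', hE', hcard⟩ := exists_isSparse_card_succ hE hdv hj hn hx hy
    have := hmax E' hE'
    omega
  have sum_degrees := (sum_card_checksOf_tannerOfEdges E).trans
    (sum_card_varsOf_tannerOfEdges E).symm
  have sum_bounds : ∑ _v : Fin (dc * t), dv = ∑ _c : Fin (dv * t), dc := by simp; ring
  refine ⟨tannerOfEdges E, rfl, ⟨Nat.zero_lt_of_lt hn, fun v => ?_, fun c => ?_⟩, hE.lt_egirth⟩
  · by_contra hne
    have hlt := (hE.card_checksOf_le v).lt_of_ne hne
    have sum_lt := Finset.sum_lt_sum (fun v _ => hE.card_checksOf_le v) ⟨v, Finset.mem_univ _, hlt⟩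
    obtain ⟨c, -, hc⟩ := Finset.exists_lt_of_sum_lt
      (sum_degrees.symm.trans_lt (sum_lt.trans_eq sum_bounds))
    exact saturated v c hlt hc
  · by_contra hne
    have hlt := (hE.card_varsOf_le c).lt_of_ne hne
    have sum_lt := Finset.sum_lt_sum (fun c _ => hE.card_varsOf_le c) ⟨c, Finset.mem_univ _, hlt⟩
    obtain ⟨v, -, hv⟩ := Finset.exists_lt_of_sum_lt
      (sum_degrees.trans_lt (sum_lt.trans_eq sum_bounds.symm))
    exact saturated v c hv hlt

theorem exists_isConstruction {dv dc : ℕ} (hdv : 3 ≤ dv) (hdc : 2 ≤ dc) :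
    ∃ C, IsConstruction dv dc (3 * Real.log (2 * (dv : ℝ) * (dc : ℝ) + 1)) C := by
  have exists_code : ∀ N : ℕ, ∃ T : Tanner, T.n = dc * (2 * (2 * dv * dc + 1) ^ (3 * N + 1)) ∧
      T.Regular dv dc ∧ ((2 * (2 * N + 1) : ℕ) : ℕ∞) < T.graph.egirth := fun N => by
    refine exists_regular_lt_egirth (by omega) (by omega) ?_
    have hpos : 0 < dv * dc := by positivity
    calc (1 + dc) * (1 + dv * dc) ^ (2 * N + 1) ≤ (dc * 2) * (1 + dv * dc) ^ (3 * N + 1) := by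
          gcongr <;> omega
      _ < (dc * 2) * (2 * dv * dc + 1) ^ (3 * N + 1) := by
          have : 1 + dv * dc < 2 * dv * dc + 1 := by rw [mul_assoc]; omega
          gcongr
      _ = _ := by ring
  choose C hn hC hgirth using exists_code
  refine ⟨C, fun N => ⟨hC N, (hC N).le_maxIter hdv hdc (lt_of_le_of_lt ?_ (hgirth N))⟩, ?_⟩
  · norm_cast
    omega
  have blocklength : ∀ N : ℕ, ((C N).n : ℝ) = (dc * 2 * (2 * dv * dc + 1)) *
      Real.exp (3 * Real.log (2 * (dv : ℝ) * (dc : ℝ) + 1) * N) := fun N => by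
    rw [hn, show 3 * Real.log (2 * (dv : ℝ) * (dc : ℝ) + 1) * N =
      ((3 * N : ℕ) : ℝ) * Real.log (2 * (dv : ℝ) * (dc : ℝ) + 1) by push_cast; ring,
      Real.exp_nat_mul, Real.exp_log (by positivity)]
    push_cast
    ring
  exact ⟨dc * 2 * (2 * dv * dc + 1), dc * 2 * (2 * dv * dc + 1), by positivity,
    fun N => ⟨(blocklength N).ge, (blocklength N).le⟩⟩

/-! ### Polylines on the tracks -/

namespace Cell

variable {x x' y y' : ℤ} {p q : Cell} {l r r' : List Cell}

lemma Step.symm (h : Step p q) : Step q p := by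
  rcases h with ⟨even, eq, next⟩ | ⟨even, eq, next⟩
  · exact Or.inl ⟨eq ▸ even, eq.symm, next.symm⟩
  · exact Or.inr ⟨eq ▸ even, eq.symm, next.symm⟩

lemma Step.swap (h : Step p q) : Step p.swap q.swap := Or.symm h

lemma StraightH.of_infix (h : StraightH r p) (hr : r <:+: r') : StraightH r' p :=
  h.imp (fun h => h.trans hr) fun h => h.trans hr

lemma StraightV.of_infix (h : StraightV r p) (hr : r <:+: r') : StraightV r' p :=
  h.imp (fun h => h.trans hr) fun h => h.trans hr

lemma StraightV.reverse (h : StraightV r p) : StraightV r.reverse p := by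
  rcases h with h | h
  · exact Or.inr (by simpa using List.reverse_infix.mpr h)
  · exact Or.inl (by simpa using List.reverse_infix.mpr h)

lemma StraightH.map_swap (h : StraightH r p) : StraightV (r.map Prod.swap) p.swap :=
  h.imp (fun h => h.map Prod.swap) fun h => h.map Prod.swap

/-- The cells of a horizontal track from `(x, y)` to `(x', y)`, without the last one. -/
def hseg (x x' y : ℤ) : List Cell :=
  (List.range (x' - x).natAbs).map fun i : ℕ => (x + (x' - x).sign * i, y)

/-- The cells of a vertical track from `(x, y)` to `(x, y')`, without the last one. -/
def vseg (x y y' : ℤ) : List Cell := (hseg y y' x).map Prod.swap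

lemma hseg_append_end (x x' y : ℤ) : hseg x x' y ++ [(x', y)] =
    (List.range ((x' - x).natAbs + 1)).map fun i : ℕ => (x + (x' - x).sign * i, y) := by
  rw [List.range_succ, List.map_append, hseg, List.map_singleton, Int.sign_mul_natAbs]
  simp

lemma mem_hseg : p ∈ hseg x x' y ↔ p.2 = y ∧ (x ≤ p.1 ∧ p.1 < x' ∨ x' < p.1 ∧ p.1 ≤ x) := by
  simp only [hseg, List.mem_map, List.mem_range, Prod.ext_iff]
  rcases lt_trichotomy x x' with h | rfl | h
  · rw [Int.sign_eq_one_of_pos (by omega)]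
    refine ⟨by rintro ⟨i, hi, hx, hy⟩; omega, fun hp => ⟨(p.1 - x).toNat, ?_⟩⟩
    omega
  · exact iff_of_false (by simp) (by omega)
  · rw [Int.sign_eq_neg_one_of_neg (by omega)]
    refine ⟨by rintro ⟨i, hi, hx, hy⟩; omega, fun hp => ⟨(x - p.1).toNat, ?_⟩⟩
    omega

lemma mem_vseg : p ∈ vseg x y y' ↔ p.1 = x ∧ (y ≤ p.2 ∧ p.2 < y' ∨ y' < p.2 ∧ p.2 ≤ y) := by
  rw [vseg, List.mem_map_of_involutive Prod.swap_swap, mem_hseg]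
  rfl

lemma nodup_hseg (x x' y : ℤ) : (hseg x x' y).Nodup := by
  by_cases h : x' - x = 0
  · simp [hseg, h]
  · refine List.nodup_range.map fun i j hij => ?_
    have := mul_left_cancel₀ (Int.sign_eq_zero_iff_zero.not.mpr h)
      (add_left_cancel (Prod.mk.inj hij).1)
    exact_mod_cast this

lemma nodup_vseg (x y y' : ℤ) : (vseg x y y').Nodup :=
  (nodup_hseg y y' x).map Prod.swap_injective

lemma head?_hseg_append (hl : l.head? = some (x', y)) :
    (hseg x x' y ++ l).head? = some (x, y) := by
  by_cases h : x' - x = 0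
  · simpa [hseg, h, show x = x' by omega] using hl
  · simp [hseg, List.head?_range, h]

lemma head?_vseg_append (hl : l.head? = some (x, y')) :
    (vseg x y y' ++ l).head? = some (x, y) := by
  have head_swap := head?_hseg_append (x := y) (x' := y') (y := x) (l := l.map Prod.swap)
    (by simp [hl])
  simpa [vseg] using congrArg (Option.map Prod.swap) head_swap

lemma isChain_hseg_append (hy : x = x' ∨ Even y) (hl : l.IsChain Step)
    (head : l.head? = some (x', y)) : (hseg x x' y ++ l).IsChain Step := by
  obtain ⟨t, rfl⟩ := List.head?_eq_some_iff.mp head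
  refine List.isChain_split.mpr ⟨?_, hl⟩
  rcases hy with rfl | hy
  · simp [hseg]
  rw [hseg_append_end, List.isChain_map, List.isChain_range]
  intro i hi
  refine Or.inr ⟨hy, rfl, ?_⟩
  push_cast
  rcases lt_trichotomy x x' with h | rfl | h
  · rw [Int.sign_eq_one_of_pos (by omega)]
    omega
  · simp at hi
  · rw [Int.sign_eq_neg_one_of_neg (by omega)]
    omega

lemma isChain_vseg_append (hx : Even x) (hl : l.IsChain Step) (head : l.head? = some (x, y')) :
    (vseg x y y' ++ l).IsChain Step := by
  have chain_swap := isChain_hseg_append (x := y) (Or.inr hx)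
    (((List.isChain_map Prod.swap).mpr (hl.imp fun _ _ => Step.swap)))
    (by simp [head] : (l.map Prod.swap).head? = some (y', x))
  simpa [vseg] using (List.isChain_map Prod.swap).mpr (chain_swap.imp fun _ _ => Step.swap)

lemma straightH_hseg_append (head : l.head? = some (x', y)) (hp : p.2 = y)
    (h : x < p.1 ∧ p.1 < x' ∨ x' < p.1 ∧ p.1 < x) : StraightH (hseg x x' y ++ l) p := by
  obtain ⟨t, rfl⟩ := List.head?_eq_some_iff.mp head
  have hseg_infix : hseg x x' y ++ [(x', y)] <:+: hseg x x' y ++ (x', y) :: t :=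
    (List.prefix_append _ t).isInfix.trans (by simp)
  refine StraightH.of_infix ?_ hseg_infix
  rw [hseg_append_end]
  have triple_infix (i : ℕ) (hi : i + 2 ≤ (x' - x).natAbs) :
      [i, i + 1, i + 2] <:+: List.range ((x' - x).natAbs + 1) :=
    ⟨List.range' 0 i, List.range' (i + 3) ((x' - x).natAbs - i - 2), by
      rw [List.range_eq_range',
        show [i, i + 1, i + 2] = List.range' (0 + i) 3 by simp [List.range'], List.range'_append_1]
      have split_range := List.range'_append_1 (s := 0) (m := i + 3)
        (n := (x' - x).natAbs - i - 2)
      rwa [zero_add, show i + 3 + ((x' - x).natAbs - i - 2) = (x' - x).natAbs + 1 by omega]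
        at split_range⟩
  rcases h with h | h
  · rw [Int.sign_eq_one_of_pos (by omega)]
    left
    convert (triple_infix (p.1 - x - 1).toNat (by omega)).map _ using 1
    simp [Prod.ext_iff]
    omega
  · rw [Int.sign_eq_neg_one_of_neg (by omega)]
    right
    convert (triple_infix (x - p.1 - 1).toNat (by omega)).map _ using 1
    simp [Prod.ext_iff]
    omega

lemma straightV_vseg_append (head : l.head? = some (x, y')) (hp : p.1 = x)
    (h : y < p.2 ∧ p.2 < y' ∨ y' < p.2 ∧ p.2 < y) : StraightV (vseg x y y' ++ l) p := by
  have straight_swap := straightH_hseg_append (x := y) (l := l.map Prod.swap)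
    (by simp [head] : (l.map Prod.swap).head? = some (y', x)) (p := p.swap) hp h
  simpa [vseg] using straight_swap.map_swap

end Cell

/-! ### Ports of processing nodes -/

/-- The polyline `(a, b)`, `(a, d)`, `(X, d)`, `(X, Y)`, without its last cell: the part of a wire
between a processing node and its horizontal track. -/
def halfWire (a b d X Y : ℤ) : List Cell :=
  Cell.vseg a b d ++ (Cell.hseg a X d ++ Cell.vseg X d Y)

section HalfWire

variable {a b d X Y : ℤ} {l : List Cell} {p : Cell}

lemma mem_halfWire (hdb : d ≤ b) (hdY : d < Y) :
    p ∈ halfWire a b d X Y ↔ (p.1 = a ∧ d < p.2 ∧ p.2 ≤ b) ∨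
      (p.2 = d ∧ (a ≤ p.1 ∧ p.1 < X ∨ X < p.1 ∧ p.1 ≤ a)) ∨ (p.1 = X ∧ d ≤ p.2 ∧ p.2 < Y) := by
  rw [halfWire, List.mem_append, List.mem_append, Cell.mem_vseg, Cell.mem_hseg, Cell.mem_vseg]
  omega

lemma halfWire_append : halfWire a b d X Y ++ l =
    Cell.vseg a b d ++ (Cell.hseg a X d ++ (Cell.vseg X d Y ++ l)) := by
  simp only [halfWire, List.append_assoc]

lemma head?_halfWire_append (head : l.head? = some (X, Y)) :
    (halfWire a b d X Y ++ l).head? = some (a, b) := by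
  rw [halfWire_append]
  exact Cell.head?_vseg_append (Cell.head?_hseg_append (Cell.head?_vseg_append head))

lemma isChain_halfWire_append (ha : Even a) (hd : a = X ∨ Even d) (hX : Even X)
    (hl : l.IsChain Cell.Step) (head : l.head? = some (X, Y)) :
    (halfWire a b d X Y ++ l).IsChain Cell.Step := by
  have head_up := Cell.head?_vseg_append (y := d) head
  rw [halfWire_append]
  exact Cell.isChain_vseg_append ha
    (Cell.isChain_hseg_append hd (Cell.isChain_vseg_append hX hl head) head_up)
    (Cell.head?_hseg_append head_up)

lemma straightV_halfWire_append (head : l.head? = some (X, Y)) (hp : p.1 = X)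
    (h : d < p.2 ∧ p.2 < Y) : Cell.StraightV (halfWire a b d X Y ++ l) p := by
  rw [halfWire_append, ← List.append_assoc]
  exact (Cell.straightV_vseg_append head hp (Or.inl h)).of_infix (List.suffix_append _ _).isInfix

lemma nodup_halfWire (hdY : d < Y) (h : a = X → d = b) : (halfWire a b d X Y).Nodup := by
  rw [halfWire, List.nodup_append', List.nodup_append']
  refine ⟨Cell.nodup_vseg _ _ _, ⟨Cell.nodup_hseg _ _ _, Cell.nodup_vseg _ _ _, ?_⟩, ?_⟩
  · intro p hp hp'
    rw [Cell.mem_hseg] at hp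
    rw [Cell.mem_vseg] at hp'
    omega
  · intro p hp hp'
    rw [Cell.mem_vseg] at hp
    rw [List.mem_append, Cell.mem_hseg, Cell.mem_vseg] at hp'
    omega

end HalfWire

/- The polylines of the ports of one processing node must not meet. On a square of side `x > 4`, the
even ports leave through the top, the odd ones through the bottom and then around the right side,
each along its own row and column. On a single contact square, ports `0, 1, 2` leave upwards, to the
right and to the left, and port `3` leaves downwards and turns right. -/

/-- First coordinate of the cell of port `i` of a processing node with `x` connections, relative to
the lower left cell of the node. -/
def portSrcX (x i : ℕ) : ℤ := if x ≤ 4 then 0 else if i % 2 = 0 then i else i - 1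

/-- Second coordinate of the cell of port `i`. -/
def portSrcY (x i : ℕ) : ℤ := if x ≤ 4 then 0 else if i % 2 = 0 then x - 1 else 0

/-- The row in which the wire of port `i` reaches its column. -/
def portRow (x i : ℕ) : ℤ :=
  if x ≤ 4 then (if i = 3 then -2 else 0) else if i % 2 = 0 then x - 1 else 2 * i - 2 * x

/-- The column in which the wire of port `i` climbs to its horizontal track. -/
def portCol (x i : ℕ) : ℤ :=
  if x ≤ 4 then (if i = 0 then 0 else if i = 1 then 2 else if i = 2 then -2 else 4)
  else if i % 2 = 0 then i else 4 * x - 2 * i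

/-- The cells, relative to the processing node, of the polyline from port `i` up to row `Y`, without
its two ends. -/
def PortCell (x i : ℕ) (Y p q : ℤ) : Prop :=
  ((p = portSrcX x i ∧ portRow x i < q ∧ q ≤ portSrcY x i) ∨
    (q = portRow x i ∧ (portSrcX x i ≤ p ∧ p < portCol x i ∨ portCol x i < p ∧ p ≤ portSrcX x i)) ∨
    (p = portCol x i ∧ portRow x i ≤ q ∧ q < Y)) ∧
  ¬ (p = portSrcX x i ∧ q = portSrcY x i)

section Ports

variable {D x i j : ℕ} {Y Y' p q : ℤ}

lemma even_portSrcX : Even (portSrcX x i) := by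
  rw [Int.even_iff]; unfold portSrcX; split_ifs <;> omega

lemma even_portCol : Even (portCol x i) := by
  rw [Int.even_iff]; unfold portCol; split_ifs <;> omega

lemma portSrcX_eq_or_even_portRow : portSrcX x i = portCol x i ∨ Even (portRow x i) := by
  rw [Int.even_iff]; unfold portSrcX portCol portRow; split_ifs <;> omega

lemma portRow_le_portSrcY (hi : i < x) : portRow x i ≤ portSrcY x i := by
  unfold portRow portSrcY; split_ifs <;> omega

lemma portRow_eq_portSrcY (hi : i < x) (h : portSrcX x i = portCol x i) :
    portRow x i = portSrcY x i := by
  revert h; unfold portRow portSrcY portSrcX portCol; split_ifs <;> omega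

lemma portSrcX_mem_Ico (hi : i < x) : portSrcX x i ∈ Set.Ico 0 (nodeSide x : ℤ) := by
  unfold portSrcX nodeSide; split_ifs <;> simp <;> omega

lemma portSrcY_mem_Ico : portSrcY x i ∈ Set.Ico 0 (nodeSide x : ℤ) := by
  unfold portSrcY nodeSide; split_ifs <;> simp <;> omega

lemma portCol_mem_Icc (hD : 4 ≤ D) (hx : x ≤ D) (hi : i < x) :
    portCol x i ∈ Set.Icc (-2) (4 * (D : ℤ)) := by
  unfold portCol; split_ifs <;> simp <;> omega

lemma neg_le_portRow (hD : 4 ≤ D) (hx : x ≤ D) : -(2 * (D : ℤ)) ≤ portRow x i := by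
  unfold portRow; split_ifs <;> omega

lemma nodeSide_le (hD : 4 ≤ D) (hx : x ≤ D) : nodeSide x ≤ D := by
  unfold nodeSide; split_ifs <;> omega

lemma PortCell.fst_mem_Icc (h : PortCell x i Y p q) (hD : 4 ≤ D) (hx : x ≤ D) (hi : i < x) :
    p ∈ Set.Icc (-2) (4 * (D : ℤ)) := by
  have src := portSrcX_mem_Ico hi
  have col := portCol_mem_Icc hD hx hi
  have side := nodeSide_le hD hx
  unfold PortCell at h
  simp only [Set.mem_Ico, Set.mem_Icc] at *
  omega

lemma PortCell.not_mem_node (h : PortCell x i Y p q) (hi : i < x) :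
    ¬ (0 ≤ p ∧ p < nodeSide x ∧ 0 ≤ q ∧ q < nodeSide x) := by
  revert h
  unfold PortCell portSrcX portSrcY portRow portCol nodeSide
  split_ifs <;> simp <;> omega

lemma PortCell.eq (h : PortCell x i Y p q) (h' : PortCell x j Y' p q) (hi : i < x) (hj : j < x) :
    i = j := by
  revert h h'
  unfold PortCell portSrcX portSrcY portRow portCol
  by_cases hx : x ≤ 4
  · simp only [hx, if_true]
    split_ifs <;> omega
  · simp only [hx, if_false]
    split_ifs <;> omega

end Ports

/-! ### Layouts of cubic area -/

namespace Tanner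

variable (T : Tanner)

/-- A bound for the sides of the processing nodes, and at least the side of the polylines around a
single contact square. -/
def width : ℕ := max 4 (Finset.univ.sup T.degree)

/-- Left end of a processing node: all nodes stand in one row, far enough from each other for the
polylines of their ports. -/
def nodeX (z : Fin T.n ⊕ Fin T.m) : ℤ := (4 * T.width + 8) * (finSumFinEquiv z : ℕ)

/-- The row of the `k`-th horizontal track above the processing nodes. -/
def trackRow (k : ℕ) : ℤ := 2 * T.width + 4 + 2 * k

/-- An external connection of a processing node: the pair of the node and of the number of the
connection, which is less than the degree of the node when `IsPort` holds. -/
abbrev Port := (Fin T.n ⊕ Fin T.m) × ℕ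

variable {T} {a b : T.Port} {k k' : ℕ} {p : Cell} {z z' : Fin T.n ⊕ Fin T.m}

/-- The processing node of `a` has a connection with the number of `a`. -/
def IsPort (a : T.Port) : Prop := a.2 < T.degree a.1

/-- The cell of a port. -/
def portSrc (a : T.Port) : Cell :=
  (T.nodeX a.1 + portSrcX (T.degree a.1) a.2, portSrcY (T.degree a.1) a.2)

/-- The column in which the wire of a port climbs to its horizontal track. -/
def portColumn (a : T.Port) : ℤ := T.nodeX a.1 + portCol (T.degree a.1) a.2

/-- The polyline from the port `a` up to the `k`-th track, without its last cell. -/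
def portPath (a : T.Port) (k : ℕ) : List Cell :=
  halfWire (T.nodeX a.1 + portSrcX (T.degree a.1) a.2) (portSrcY (T.degree a.1) a.2)
    (portRow (T.degree a.1) a.2) (portColumn a) (T.trackRow k)

/-- The polyline from the port `a` up to the `k`-th track, without its two ends. -/
def portWire (a : T.Port) (k : ℕ) : List Cell := (portPath a k).tail

/-- The wire between two ports along the `k`-th track. -/
def trackWire (a b : T.Port) (k : ℕ) : List Cell :=
  portWire a k ++ (Cell.hseg (portColumn a) (portColumn b) (T.trackRow k) ++
    (portColumn b, T.trackRow k) :: (portWire b k).reverse)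

variable (T) in
lemma four_le_width : 4 ≤ T.width := le_max_left _ _

lemma degree_le_width (z : Fin T.n ⊕ Fin T.m) : T.degree z ≤ T.width :=
  (Finset.le_sup (Finset.mem_univ z)).trans (le_max_right _ _)

lemma nodeSide_degree_le (z : Fin T.n ⊕ Fin T.m) : nodeSide (T.degree z) ≤ T.width :=
  nodeSide_le T.four_le_width (degree_le_width z)

lemma even_nodeX (z : Fin T.n ⊕ Fin T.m) : Even (T.nodeX z) :=
  Even.mul_right (by rw [Int.even_iff]; omega) _

lemma even_trackRow (k : ℕ) : Even (T.trackRow k) := by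
  unfold trackRow; rw [Int.even_iff]; omega

lemma width_add_one_lt_trackRow (k : ℕ) : T.width + 1 < T.trackRow k := by
  unfold trackRow; omega

lemma eq_of_mem_node_block {x : ℤ} (h : x - T.nodeX z ∈ Set.Icc (-2) (4 * (T.width : ℤ)))
    (h' : x - T.nodeX z' ∈ Set.Icc (-2) (4 * (T.width : ℤ))) : z = z' := by
  refine finSumFinEquiv.injective (Fin.ext ?_)
  unfold nodeX at h h'
  simp only [Set.mem_Icc] at h h'
  by_contra hne
  rcases Nat.lt_or_gt_of_ne hne with lt | lt
  · nlinarith [show ((finSumFinEquiv z : ℕ) : ℤ) + 1 ≤ (finSumFinEquiv z' : ℕ) by omega]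
  · nlinarith [show ((finSumFinEquiv z' : ℕ) : ℤ) + 1 ≤ (finSumFinEquiv z : ℕ) by omega]

lemma mem_square_nodeX : p ∈ Cell.square (T.nodeX z, 0) (nodeSide (T.degree z)) ↔
    0 ≤ p.1 - T.nodeX z ∧ p.1 - T.nodeX z < nodeSide (T.degree z) ∧ 0 ≤ p.2 ∧
      p.2 < nodeSide (T.degree z) := by
  simp only [Cell.square, Set.mem_ofPred_eq]
  omega

lemma sub_nodeX_mem_Icc_of_mem_square
    (h : p ∈ Cell.square (T.nodeX z, 0) (nodeSide (T.degree z))) :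
    p.1 - T.nodeX z ∈ Set.Icc (-2) (4 * (T.width : ℤ)) := by
  have side := nodeSide_degree_le z
  rw [mem_square_nodeX] at h
  rw [Set.mem_Icc]
  omega

lemma disjoint_square_nodeX (hne : z ≠ z') :
    Disjoint (Cell.square (T.nodeX z, 0) (nodeSide (T.degree z)))
      (Cell.square (T.nodeX z', 0) (nodeSide (T.degree z'))) :=
  Set.disjoint_left.mpr fun _ hp hp' => hne (eq_of_mem_node_block
    (sub_nodeX_mem_Icc_of_mem_square hp) (sub_nodeX_mem_Icc_of_mem_square hp'))

namespace IsPort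

lemma portSrc_mem_square (ha : IsPort a) :
    portSrc a ∈ Cell.square (T.nodeX a.1, 0) (nodeSide (T.degree a.1)) := by
  have x_mem := portSrcX_mem_Ico ha
  have y_mem : portSrcY _ a.2 ∈ Set.Ico 0 (nodeSide (T.degree a.1) : ℤ) := portSrcY_mem_Ico
  rw [mem_square_nodeX, portSrc, add_sub_cancel_left]
  exact ⟨x_mem.1, x_mem.2, y_mem⟩

lemma portRow_lt_width (ha : IsPort a) : portRow (T.degree a.1) a.2 < T.width := by
  have row_le := portRow_le_portSrcY ha
  have y_lt : portSrcY _ a.2 < (nodeSide (T.degree a.1) : ℤ) := portSrcY_mem_Ico.2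
  have side := nodeSide_degree_le a.1
  omega

lemma portRow_lt_trackRow (ha : IsPort a) : portRow (T.degree a.1) a.2 < T.trackRow k := by
  have row_lt := ha.portRow_lt_width
  have lt_track := width_add_one_lt_trackRow (T := T) k
  omega

lemma nodup_portPath (ha : IsPort a) : (portPath a k).Nodup :=
  nodup_halfWire ha.portRow_lt_trackRow
    fun h => portRow_eq_portSrcY ha (add_left_cancel h)

lemma portSrc_cons_portWire (ha : IsPort a) : portSrc a :: portWire a k = portPath a k := by
  obtain ⟨q, t, path_eq⟩ : ∃ q t, portPath a k = q :: t :=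
    List.exists_cons_of_ne_nil (List.ne_nil_of_mem (a := (portColumn a, T.trackRow k - 1))
      ((mem_halfWire (portRow_le_portSrcY ha) ha.portRow_lt_trackRow).mpr
        (Or.inr (Or.inr ⟨rfl, Int.le_sub_one_of_lt ha.portRow_lt_trackRow, by simp⟩))))
  have head : (portPath a k ++ [(portColumn a, T.trackRow k)]).head? = some (portSrc a) :=
    head?_halfWire_append rfl
  rw [path_eq, List.cons_append, List.head?_cons, Option.some_inj] at head
  rw [portWire, path_eq, head, List.tail_cons]

lemma mem_portWire (ha : IsPort a) : p ∈ portWire a k ↔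
    PortCell (T.degree a.1) a.2 (T.trackRow k) (p.1 - T.nodeX a.1) p.2 := by
  have nodup := ha.nodup_portPath (k := k)
  have mem_path : p ∈ portPath a k ↔ _ :=
    mem_halfWire (portRow_le_portSrcY ha) ha.portRow_lt_trackRow
  rw [← ha.portSrc_cons_portWire] at nodup mem_path
  have mem_iff : p ∈ portWire a k ↔ p ∈ portSrc a :: portWire a k ∧ p ≠ portSrc a := by
    have := (List.nodup_cons.mp nodup).1
    grind
  rw [mem_iff, mem_path, PortCell, portSrc, portColumn, Ne, Prod.ext_iff]
  dsimp only
  omega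

lemma sub_nodeX_mem_Icc (ha : IsPort a) (h : p ∈ portWire a k) :
    p.1 - T.nodeX a.1 ∈ Set.Icc (-2) (4 * (T.width : ℤ)) :=
  (ha.mem_portWire.mp h).fst_mem_Icc T.four_le_width (degree_le_width _) ha

lemma eq_of_mem_portWire (ha : IsPort a) (hb : IsPort b) (h : p ∈ portWire a k)
    (h' : p ∈ portWire b k') : a = b := by
  obtain ⟨z, i⟩ := a
  obtain ⟨z', j⟩ := b
  obtain rfl : z = z' :=
    eq_of_mem_node_block (ha.sub_nodeX_mem_Icc h) (hb.sub_nodeX_mem_Icc h')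
  exact Prod.ext rfl ((ha.mem_portWire.mp h).eq (hb.mem_portWire.mp h') ha hb)

lemma notMem_square (ha : IsPort a) (h : p ∈ portWire a k) :
    p ∉ Cell.square (T.nodeX z, 0) (nodeSide (T.degree z)) := fun mem_square => by
  obtain rfl : a.1 = z := eq_of_mem_node_block (ha.sub_nodeX_mem_Icc h)
    (sub_nodeX_mem_Icc_of_mem_square mem_square)
  exact (ha.mem_portWire.mp h).not_mem_node ha (mem_square_nodeX.mp mem_square)

lemma lt_trackRow_of_mem_portWire (ha : IsPort a) (h : p ∈ portWire a k) :
    p.2 < T.trackRow k := by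
  have row_lt := ha.portRow_lt_trackRow (k := k)
  have y_lt : portSrcY _ a.2 < (nodeSide (T.degree a.1) : ℤ) := portSrcY_mem_Ico.2
  have side := nodeSide_degree_le a.1
  have lt_track := width_add_one_lt_trackRow (T := T) k
  have mem := ha.mem_portWire.mp h
  unfold PortCell at mem
  omega

lemma fst_eq_of_mem_portWire (ha : IsPort a) (h : p ∈ portWire a k) (hp : T.width < p.2) :
    p.1 = portColumn a := by
  have y_lt : portSrcY _ a.2 < (nodeSide (T.degree a.1) : ℤ) := portSrcY_mem_Ico.2
  have row_lt := ha.portRow_lt_width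
  have side := nodeSide_degree_le a.1
  have mem := ha.mem_portWire.mp h
  unfold PortCell at mem
  unfold portColumn
  omega

lemma eq_of_portColumn_eq (ha : IsPort a) (hb : IsPort b) (h : portColumn a = portColumn b) :
    a = b := by
  have mem_portWire {c : T.Port} (hc : IsPort c) :
      (portColumn c, (T.width : ℤ) + 1) ∈ portWire c 0 := by
    have y_lt : portSrcY _ c.2 < (nodeSide (T.degree c.1) : ℤ) := portSrcY_mem_Ico.2
    have row_lt := hc.portRow_lt_width
    have side := nodeSide_degree_le c.1
    have lt_track := width_add_one_lt_trackRow (T := T) 0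
    rw [hc.mem_portWire, PortCell, portColumn]
    dsimp only
    omega
  exact ha.eq_of_mem_portWire hb (mem_portWire ha) (h ▸ mem_portWire hb)

lemma nodup_portWire (ha : IsPort a) : (portWire a k).Nodup :=
  ha.nodup_portPath.sublist (List.tail_sublist _)

lemma neg_le_of_mem_portWire (ha : IsPort a) (h : p ∈ portWire a k) :
    -(2 * (T.width : ℤ)) ≤ p.2 := by
  have row := neg_le_portRow (i := a.2) T.four_le_width (degree_le_width a.1)
  have mem := ha.mem_portWire.mp h
  unfold PortCell at mem
  omega

lemma portColumn_sub_mem_Icc (ha : IsPort a) :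
    portColumn a - T.nodeX a.1 ∈ Set.Icc (-2) (4 * (T.width : ℤ)) := by
  rw [portColumn, add_sub_cancel_left]
  exact portCol_mem_Icc T.four_le_width (degree_le_width _) ha

end IsPort

end Tanner

namespace Tanner

variable {T : Tanner} {a b : T.Port} {k k' : ℕ} {p : Cell}

lemma mem_trackWire : p ∈ trackWire a b k ↔ p ∈ portWire a k ∨ p ∈ portWire b k ∨
    p.2 = T.trackRow k ∧ (portColumn a ≤ p.1 ∧ p.1 ≤ portColumn b ∨
      portColumn b ≤ p.1 ∧ p.1 ≤ portColumn a) := by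
  rw [trackWire, List.mem_append, List.mem_append, List.mem_cons, List.mem_reverse, Cell.mem_hseg,
    Prod.ext_iff]
  dsimp only
  by_cases hb : p.1 = portColumn b <;> grind

lemma nodup_trackWire (ha : IsPort a) (hb : IsPort b) (hne : a ≠ b) : (trackWire a b k).Nodup := by
  have below_a : ∀ p ∈ portWire a k, p.2 < T.trackRow k := fun _ => ha.lt_trackRow_of_mem_portWire
  have below_b : ∀ p ∈ portWire b k, p.2 < T.trackRow k := fun _ => hb.lt_trackRow_of_mem_portWire
  have disjoint : ∀ p ∈ portWire a k, p ∉ portWire b k :=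
    fun _ h h' => hne (ha.eq_of_mem_portWire hb h h')
  have on_track : ∀ p ∈ Cell.hseg (portColumn a) (portColumn b) (T.trackRow k),
      p.2 = T.trackRow k ∧ p.1 ≠ portColumn b := fun p hp => by
    rw [Cell.mem_hseg] at hp
    omega
  rw [trackWire, List.nodup_append', List.nodup_append', List.nodup_cons, List.nodup_reverse]
  refine ⟨ha.nodup_portWire, ⟨Cell.nodup_hseg _ _ _, ⟨?_, hb.nodup_portWire⟩, ?_⟩, ?_⟩
  · intro h
    exact lt_irrefl _ (below_b _ (List.mem_reverse.mp h))
  · intro p hp hp'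
    rcases List.mem_cons.mp hp' with rfl | hp'
    · exact (on_track _ hp).2 rfl
    · exact (below_b p (List.mem_reverse.mp hp')).ne (on_track p hp).1
  · intro p hp hp'
    rcases List.mem_append.mp hp' with hp' | hp'
    · exact (below_a p hp).ne (on_track p hp').1
    · rcases List.mem_cons.mp hp' with rfl | hp'
      · exact lt_irrefl _ (below_a _ hp)
      · exact disjoint p hp (List.mem_reverse.mp hp')

/-- The route between two ports along the `k`-th track: the wire together with its two ends. -/
def route (a b : T.Port) (k : ℕ) : List Cell := portSrc a :: (trackWire a b k ++ [portSrc b])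

lemma route_eq (ha : IsPort a) (hb : IsPort b) : route a b k =
    portPath a k ++ (Cell.hseg (portColumn a) (portColumn b) (T.trackRow k) ++
      (portPath b k ++ [(portColumn b, T.trackRow k)]).reverse) := by
  rw [← ha.portSrc_cons_portWire, ← hb.portSrc_cons_portWire, route, trackWire]
  simp

lemma isChain_portPath_append {l : List Cell} (hl : l.IsChain Cell.Step)
    (head : l.head? = some (portColumn a, T.trackRow k)) :
    (portPath a k ++ l).IsChain Cell.Step :=
  isChain_halfWire_append ((even_nodeX _).add even_portSrcX)
    (portSrcX_eq_or_even_portRow.imp_left fun h => by rw [h, portColumn])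
    ((even_nodeX _).add even_portCol) hl head

lemma head?_reverse_portPath_append :
    (portPath b k ++ [(portColumn b, T.trackRow k)]).reverse.head? =
      some (portColumn b, T.trackRow k) := by
  rw [List.reverse_concat, List.head?_cons]

lemma isChain_route (ha : IsPort a) (hb : IsPort b) : (route a b k).IsChain Cell.Step := by
  have chain_b : (portPath b k ++ [(portColumn b, T.trackRow k)]).reverse.IsChain Cell.Step :=
    List.isChain_reverse.mpr ((isChain_portPath_append (List.isChain_singleton _) rfl).imp
      fun _ _ => Cell.Step.symm)
  rw [route_eq ha hb]
  exact isChain_portPath_append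
    (Cell.isChain_hseg_append (Or.inr (even_trackRow k)) chain_b head?_reverse_portPath_append)
    (Cell.head?_hseg_append head?_reverse_portPath_append)

lemma straightV_route_left (ha : IsPort a) (hb : IsPort b) (h : p ∈ portWire a k)
    (hp : T.width < p.2) : Cell.StraightV (route a b k) p := by
  rw [route_eq ha hb]
  exact straightV_halfWire_append (Cell.head?_hseg_append head?_reverse_portPath_append)
    (ha.fst_eq_of_mem_portWire h hp)
    ⟨ha.portRow_lt_width.trans hp, ha.lt_trackRow_of_mem_portWire h⟩

lemma straightV_route_right (ha : IsPort a) (hb : IsPort b) (h : p ∈ portWire b k)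
    (hp : T.width < p.2) : Cell.StraightV (route a b k) p := by
  rw [route_eq ha hb, ← List.append_assoc]
  exact (straightV_halfWire_append rfl (hb.fst_eq_of_mem_portWire h hp)
    ⟨hb.portRow_lt_width.trans hp, hb.lt_trackRow_of_mem_portWire h⟩).reverse.of_infix
      (List.suffix_append _ _).isInfix

lemma straightH_route (ha : IsPort a) (hb : IsPort b) (hp : p.2 = T.trackRow k)
    (h : portColumn a < p.1 ∧ p.1 < portColumn b ∨ portColumn b < p.1 ∧ p.1 < portColumn a) :
    Cell.StraightH (route a b k) p := by
  rw [route_eq ha hb]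
  exact (Cell.straightH_hseg_append head?_reverse_portPath_append hp h).of_infix
    (List.suffix_append _ _).isInfix

variable {e e' : Fin T.n × Fin T.m}

/-- The port of an edge at its variable node. -/
noncomputable def varPort (e : Fin T.n × Fin T.m) : T.Port :=
  (Sum.inl e.1, (T.checksOf e.1).toList.idxOf e.2)

/-- The port of an edge at its check node. -/
noncomputable def checkPort (e : Fin T.n × Fin T.m) : T.Port :=
  (Sum.inr e.2, (T.varsOf e.2).toList.idxOf e.1)

/-- The number of the horizontal track of an edge. -/
def edgeTrack (e : Fin T.n × Fin T.m) : ℕ := finProdFinEquiv e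

/-- The wire of an edge. -/
noncomputable def edgeWire (e : Fin T.n × Fin T.m) : List Cell :=
  trackWire (varPort e) (checkPort e) (edgeTrack e)

/-- The route of an edge. -/
noncomputable def edgeRoute (e : Fin T.n × Fin T.m) : List Cell :=
  route (varPort e) (checkPort e) (edgeTrack e)

/-- `a` is one of the two ports of the edge `e`. -/
def IsPortOf (a : T.Port) (e : Fin T.n × Fin T.m) : Prop := a = varPort e ∨ a = checkPort e

lemma mem_checksOf_of_mem_edges (he : e ∈ T.edges) : e.2 ∈ T.checksOf e.1 :=
  T.mem_checksOf_iff.mpr (T.mem_edges_iff.mp he)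

lemma mem_varsOf_of_mem_edges (he : e ∈ T.edges) : e.1 ∈ T.varsOf e.2 :=
  T.mem_varsOf_iff.mpr (T.mem_edges_iff.mp he)

lemma isPort_varPort (he : e ∈ T.edges) : IsPort (varPort e) := by
  simpa [IsPort, varPort, degree] using
    List.idxOf_lt_length_of_mem (Finset.mem_toList.mpr (mem_checksOf_of_mem_edges he))

lemma isPort_checkPort (he : e ∈ T.edges) : IsPort (checkPort e) := by
  simpa [IsPort, checkPort, degree] using
    List.idxOf_lt_length_of_mem (Finset.mem_toList.mpr (mem_varsOf_of_mem_edges he))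

lemma varPort_ne_checkPort : varPort e ≠ checkPort e' :=
  fun h => Sum.inl_ne_inr (congrArg Prod.fst h)

lemma varPort_inj (he : e ∈ T.edges) (h : varPort e = varPort e') : e = e' := by
  obtain ⟨v, c⟩ := e
  obtain ⟨v', c'⟩ := e'
  obtain rfl : v = v' := Sum.inl_injective (congrArg Prod.fst h)
  exact congrArg (v, ·) ((List.idxOf_inj (Finset.mem_toList.mpr
    (mem_checksOf_of_mem_edges he))).mp (congrArg Prod.snd h))

lemma checkPort_inj (he : e ∈ T.edges) (h : checkPort e = checkPort e') : e = e' := by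
  obtain ⟨v, c⟩ := e
  obtain ⟨v', c'⟩ := e'
  obtain rfl : c = c' := Sum.inr_injective (congrArg Prod.fst h)
  exact congrArg (·, c) ((List.idxOf_inj (Finset.mem_toList.mpr
    (mem_varsOf_of_mem_edges he))).mp (congrArg Prod.snd h))

lemma IsPortOf.isPort (h : IsPortOf a e) (he : e ∈ T.edges) : IsPort a := by
  rcases h with rfl | rfl
  exacts [isPort_varPort he, isPort_checkPort he]

lemma IsPortOf.edge_unique (h : IsPortOf a e) (h' : IsPortOf a e') (he : e ∈ T.edges) :
    e = e' := by
  rcases h with rfl | rfl <;> rcases h' with h' | h'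
  exacts [varPort_inj he h', absurd h' varPort_ne_checkPort,
    absurd h'.symm varPort_ne_checkPort, checkPort_inj he h']

lemma mem_edgeWire : p ∈ edgeWire e ↔ (∃ a, IsPortOf a e ∧ p ∈ portWire a (edgeTrack e)) ∨
    p.2 = T.trackRow (edgeTrack e) ∧
      (portColumn (varPort e) ≤ p.1 ∧ p.1 ≤ portColumn (checkPort e) ∨
        portColumn (checkPort e) ≤ p.1 ∧ p.1 ≤ portColumn (varPort e)) := by
  rw [edgeWire, mem_trackWire, ← or_assoc]
  simp only [IsPortOf, or_and_right, exists_or, exists_eq_left]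

lemma edgeTrack_inj (h : T.trackRow (edgeTrack e) = T.trackRow (edgeTrack e')) : e = e' :=
  finProdFinEquiv.injective (Fin.ext (by unfold trackRow edgeTrack at h; omega))

lemma edgeRoute_cross (he : e ∈ T.edges) (he' : e' ∈ T.edges) (hne : e ≠ e')
    (ha : IsPortOf a e) (h : p ∈ portWire a (edgeTrack e)) (hp : p.2 = T.trackRow (edgeTrack e'))
    (hp' : portColumn (varPort e') ≤ p.1 ∧ p.1 ≤ portColumn (checkPort e') ∨
      portColumn (checkPort e') ≤ p.1 ∧ p.1 ≤ portColumn (varPort e')) :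
    Cell.StraightV (edgeRoute e) p ∧ Cell.StraightH (edgeRoute e') p := by
  have above : T.width < p.2 := by
    have := width_add_one_lt_trackRow (T := T) (edgeTrack e')
    omega
  have column_ne {b : T.Port} (hb : IsPortOf b e') : p.1 ≠ portColumn b := fun column_eq => by
    obtain rfl : a = b := (ha.isPort he).eq_of_portColumn_eq (hb.isPort he')
      (((ha.isPort he).fst_eq_of_mem_portWire h above).symm.trans column_eq)
    exact hne (ha.edge_unique hb he)
  have column_ne_var := column_ne (Or.inl rfl)
  have column_ne_check := column_ne (Or.inr rfl)
  refine ⟨?_, straightH_route (isPort_varPort he') (isPort_checkPort he') hp (by omega)⟩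
  rcases ha with rfl | rfl
  · exact straightV_route_left (isPort_varPort he) (isPort_checkPort he) h above
  · exact straightV_route_right (isPort_varPort he) (isPort_checkPort he) h above

variable (T) in
/-- A layout with all processing nodes in one row and a separate horizontal track for each edge. -/
noncomputable def rowLayout : T.Layout where
  pos z := (T.nodeX z, 0)
  pos_contact z := ⟨even_nodeX z, Even.zero⟩
  nodes_disjoint _ _ hne := disjoint_square_nodeX hne
  wire v c := edgeWire (v, c)
  src v c := portSrc (varPort (v, c))
  dst v c := portSrc (checkPort (v, c))
  src_mem _ _ he := (isPort_varPort he).portSrc_mem_square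
  dst_mem _ _ he := (isPort_checkPort he).portSrc_mem_square
  wire_ne_nil v c _ := by simp [edgeWire, trackWire]
  wire_nodup _ _ he :=
    nodup_trackWire (isPort_varPort he) (isPort_checkPort he) varPort_ne_checkPort
  wire_chain _ _ he := isChain_route (isPort_varPort he) (isPort_checkPort he)
  wire_avoids v c he p hp z := by
    rcases mem_edgeWire.mp hp with ⟨a, ha, mem⟩ | ⟨on_track, -⟩
    · exact (ha.isPort he).notMem_square mem
    · rw [mem_square_nodeX]
      have side := nodeSide_degree_le z
      have lt_track := width_add_one_lt_trackRow (T := T) (edgeTrack (v, c))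
      omega
  wire_cross v c v' c' he he' hne p hp hp' := by
    rcases mem_edgeWire.mp hp with ⟨a, ha, mem⟩ | ⟨on_track, between⟩ <;>
      rcases mem_edgeWire.mp hp' with ⟨b, hb, mem'⟩ | ⟨on_track', between'⟩
    · obtain rfl := (ha.isPort he).eq_of_mem_portWire (hb.isPort he') mem mem'
      exact absurd (ha.edge_unique hb he) hne
    · exact Or.inr (edgeRoute_cross he he' hne ha mem on_track' between')
    · exact Or.inl (edgeRoute_cross he' he hne.symm hb mem' on_track between).symm
    · exact absurd (edgeTrack_inj (on_track.symm.trans on_track')) hne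

lemma fst_mem_Icc_of_sub_nodeX_mem {x : ℤ} {z : Fin T.n ⊕ Fin T.m}
    (h : x - T.nodeX z ∈ Set.Icc (-2) (4 * (T.width : ℤ))) :
    x ∈ Set.Icc (-2) ((4 * T.width + 8) * (T.n + T.m : ℤ)) := by
  have index_lt : ((finSumFinEquiv z : ℕ) : ℤ) + 1 ≤ T.n + T.m := by omega
  unfold nodeX at h
  constructor <;> nlinarith [h.1, h.2]

lemma mem_box_of_mem_edgeWire (he : e ∈ T.edges) (hp : p ∈ edgeWire e) :
    p ∈ Set.Icc (-2) ((4 * T.width + 8) * (T.n + T.m : ℤ)) ×ˢ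
      Set.Ico (-(2 * T.width) : ℤ) (2 * T.width + 4 + 2 * (T.n * T.m)) := by
  have track_lt : T.trackRow (edgeTrack e) < 2 * T.width + 4 + 2 * (T.n * T.m) := by
    have : ((edgeTrack e : ℕ) : ℤ) < T.n * T.m := by exact_mod_cast (finProdFinEquiv e).isLt
    unfold trackRow
    omega
  have lt_track := width_add_one_lt_trackRow (T := T) (edgeTrack e)
  rcases mem_edgeWire.mp hp with ⟨a, ha, mem⟩ | ⟨on_track, between⟩
  · have port := ha.isPort he
    exact ⟨fst_mem_Icc_of_sub_nodeX_mem (port.sub_nodeX_mem_Icc mem),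
      port.neg_le_of_mem_portWire mem, (port.lt_trackRow_of_mem_portWire mem).trans track_lt⟩
  · have var := fst_mem_Icc_of_sub_nodeX_mem (isPort_varPort he).portColumn_sub_mem_Icc
    have check := fst_mem_Icc_of_sub_nodeX_mem (isPort_checkPort he).portColumn_sub_mem_Icc
    rw [Set.mem_Icc] at var check
    exact ⟨⟨by omega, by omega⟩, by omega, by omega⟩

/-- The cells occupied by the wires of a layout. -/
def Layout.wireCells (L : T.Layout) : Finset Cell :=
  T.edges.biUnion fun e => (L.wire e.1 e.2).toFinset

variable (T) in
lemma card_wireCells_rowLayout_le : T.rowLayout.wireCells.card ≤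
    ((4 * T.width + 8) * (T.n + T.m) + 3) * (4 * T.width + 4 + 2 * (T.n * T.m)) := by
  have subset_box : T.rowLayout.wireCells ⊆
      Finset.Icc (-2 : ℤ) ((4 * T.width + 8) * (T.n + T.m : ℤ)) ×ˢ
        Finset.Ico (-(2 * T.width) : ℤ) (2 * T.width + 4 + 2 * (T.n * T.m)) := fun p hp => by
    obtain ⟨e, he, mem⟩ := Finset.mem_biUnion.mp hp
    simpa using mem_box_of_mem_edgeWire he (List.mem_toFinset.mp mem)
  refine (Finset.card_le_card subset_box).trans_eq ?_
  have columns : ((4 * T.width + 8) * (T.n + T.m) + 1 - -2 : ℤ) =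
      ((4 * T.width + 8) * (T.n + T.m) + 3 : ℕ) := by
    push_cast
    ring
  have rows : (2 * T.width + 4 + 2 * (T.n * T.m) - -(2 * T.width) : ℤ) =
      (4 * T.width + 4 + 2 * (T.n * T.m) : ℕ) := by
    push_cast
    ring
  rw [Finset.card_product, Int.card_Icc, Int.card_Ico, columns, rows, Int.toNat_natCast,
    Int.toNat_natCast]

end Tanner

/-! ### Wire area of regular codes -/

section WireArea

variable {T : Tanner} {dv dc : ℕ} {lam : ℝ}

namespace Tanner

lemma Regular.n_mul_eq (h : T.Regular dv dc) : T.n * dv = T.m * dc := by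
  calc T.n * dv = ∑ v, (T.checksOf v).card := by simp [h.2.1]
    _ = ∑ c, (T.varsOf c).card := by
      simp only [checksOf, varsOf, Finset.card_filter]
      exact Finset.sum_comm
    _ = T.m * dc := by simp [h.2.2]

lemma Regular.width_le (h : T.Regular dv dc) : T.width ≤ 4 + dv + dc := by
  refine max_le (by omega) (Finset.sup_le fun z _ => ?_)
  rcases z with v | c
  · exact (h.2.1 v).le.trans (by omega)
  · exact (h.2.2 c).le.trans (by omega)

lemma Regular.exists_wireCells_card_le (hdc : 0 < dc) :
    ∃ K : ℕ, ∀ T : Tanner, T.Regular dv dc → ∃ L : T.Layout, L.wireCells.card ≤ K * T.n ^ 3 := by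
  set s := 4 + dv + dc
  refine ⟨((4 * s + 8) * (1 + dv) + 3) * (4 * s + 4 + 2 * dv), fun T h => ⟨T.rowLayout, ?_⟩⟩
  have one_le_n : 1 ≤ T.n := h.1
  have m_le : T.m ≤ T.n * dv := h.n_mul_eq ▸ Nat.le_mul_of_pos_right _ hdc
  have width_le : T.width ≤ s := h.width_le
  have columns_le : (4 * T.width + 8) * (T.n + T.m) + 3 ≤ ((4 * s + 8) * (1 + dv) + 3) * T.n :=
    calc (4 * T.width + 8) * (T.n + T.m) + 3
        ≤ (4 * s + 8) * (T.n + T.n * dv) + 3 * T.n := by gcongr; omega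
      _ = ((4 * s + 8) * (1 + dv) + 3) * T.n := by ring
  have rows_le : 4 * T.width + 4 + 2 * (T.n * T.m) ≤ (4 * s + 4 + 2 * dv) * T.n ^ 2 :=
    calc 4 * T.width + 4 + 2 * (T.n * T.m)
        ≤ (4 * s + 4) * T.n ^ 2 + 2 * (T.n * (T.n * dv)) := by
          gcongr
          exact (by gcongr : _ ≤ 4 * s + 4).trans
            (Nat.le_mul_of_pos_right _ (Nat.one_le_pow _ _ one_le_n))
      _ = (4 * s + 4 + 2 * dv) * T.n ^ 2 := by ring
  calc T.rowLayout.wireCells.card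
      ≤ _ := T.card_wireCells_rowLayout_le
    _ ≤ ((4 * s + 8) * (1 + dv) + 3) * T.n * ((4 * s + 4 + 2 * dv) * T.n ^ 2) :=
      Nat.mul_le_mul columns_le rows_le
    _ = _ := by ring

lemma Regular.exists_wireArea_le (hdc : 0 < dc) :
    ∃ K : ℝ, 0 ≤ K ∧ ∀ (lam : ℝ) (T : Tanner), T.Regular dv dc →
      ∃ L : T.Layout, L.wireArea lam ≤ lam ^ 2 * (K * (T.n : ℝ) ^ 3) := by
  obtain ⟨K, hK⟩ := Regular.exists_wireCells_card_le (dv := dv) hdc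
  refine ⟨K, K.cast_nonneg, fun lam T h => ?_⟩
  obtain ⟨L, hL⟩ := hK T h
  refine ⟨L, mul_le_mul_of_nonneg_left ?_ (sq_nonneg lam)⟩
  exact_mod_cast hL

lemma Layout.exists_step_src (L : T.Layout) {v : Fin T.n} {c : Fin T.m} (he : (v, c) ∈ T.edges) :
    ∃ p ∈ L.wireCells, Cell.Step (L.src v c) p := by
  obtain ⟨p, l, wire_eq⟩ := List.exists_cons_of_ne_nil (L.wire_ne_nil v c he)
  have chain := L.wire_chain v c he
  rw [wire_eq, List.cons_append, List.isChain_cons_cons] at chain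
  exact ⟨p, Finset.mem_biUnion.mpr ⟨(v, c), he, by simp [wire_eq]⟩, chain.1⟩

lemma Layout.eq_of_src_eq (L : T.Layout) {v v' : Fin T.n} {c c' : Fin T.m}
    (he : (v, c) ∈ T.edges) (he' : (v', c') ∈ T.edges) (h : L.src v c = L.src v' c') : v = v' := by
  by_contra hne
  exact Set.disjoint_left.mp (L.nodes_disjoint (Sum.inl v) (Sum.inl v') (by simpa using hne))
    (L.src_mem v c he) (h ▸ L.src_mem v' c' he')

end Tanner

/-- The four cells that share a side with a given cell. -/
def Cell.neighbors (q : Cell) : Finset Cell :=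
  {(q.1, q.2 + 1), (q.1, q.2 - 1), (q.1 + 1, q.2), (q.1 - 1, q.2)}

lemma Cell.Step.mem_neighbors {p q : Cell} (h : Cell.Step p q) : p ∈ q.neighbors := by
  simp only [Cell.neighbors, Finset.mem_insert, Finset.mem_singleton, Prod.ext_iff]
  rcases h with ⟨-, _, _⟩ | ⟨-, _, _⟩ <;> omega

namespace Tanner

lemma Regular.n_le_card_wireCells (h : T.Regular dv dc) (hdv : 0 < dv) (L : T.Layout) :
    T.n ≤ 4 * L.wireCells.card := by
  choose c hc using fun v => Finset.card_pos.mp (hdv.trans_eq (h.2.1 v).symm)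
  have mem_edges v : (v, c v) ∈ T.edges := T.mem_edges_iff.mpr (T.mem_checksOf_iff.mp (hc v))
  choose p mem_wireCells step using fun v => L.exists_step_src (mem_edges v)
  have src_injective : Function.Injective fun v => L.src v (c v) :=
    fun v v' => L.eq_of_src_eq (mem_edges v) (mem_edges v')
  have card_fiber_le (q : Cell) : (Finset.univ.filter fun v => p v = q).card ≤ 4 := by
    refine (Finset.card_le_card_of_injOn (t := q.neighbors) (fun v => L.src v (c v))
      (fun v hv => ?_) src_injective.injOn).trans Finset.card_le_four
    obtain rfl : p v = q := by simpa using hv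
    exact (step v).mem_neighbors
  simpa using Finset.card_le_mul_card_image_of_maps_to (s := Finset.univ)
    (fun v _ => mem_wireCells v) 4 fun q _ => card_fiber_le q

lemma Layout.wireArea_nonneg (L : T.Layout) (lam : ℝ) : 0 ≤ L.wireArea lam := by
  unfold Layout.wireArea
  positivity

lemma Regular.le_wireArea (h : T.Regular dv dc) (hdv : 0 < dv) (L : T.Layout) (lam : ℝ) :
    lam ^ 2 * (T.n / 4) ≤ L.wireArea lam := by
  refine mul_le_mul_of_nonneg_left ?_ (sq_nonneg lam)
  rw [div_le_iff₀' four_pos]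
  exact_mod_cast h.n_le_card_wireCells hdv L

end Tanner

end WireArea

/-! ### Lower bounds on the total power -/

section LowerBounds

variable {dv dc : ℕ} {lam ξ η Pe PT P : ℝ}

/-- The exponential growth rate of the computation trees of a `(dv, dc)`-regular code in the number
of iterations, which is the lower end of the range of `γ`. -/
noncomputable def treeGrowthRate (dv dc : ℕ) : ℝ := Real.log (((dv : ℝ) - 1) * ((dc : ℝ) - 1))

lemma one_lt_branching_real (hdv : 3 ≤ dv) (hdc : 2 ≤ dc) :
    1 < ((dv : ℝ) - 1) * ((dc : ℝ) - 1) := by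
  have three_le_dv : (3 : ℝ) ≤ dv := by exact_mod_cast hdv
  have two_le_dc : (2 : ℝ) ≤ dc := by exact_mod_cast hdc
  nlinarith

lemma treeGrowthRate_pos (hdv : 3 ≤ dv) (hdc : 2 ≤ dc) : 0 < treeGrowthRate dv dc :=
  Real.log_pos (one_lt_branching_real hdv hdc)

lemma Tanner.Regular.exp_treeGrowthRate_mul_le {T : Tanner} (h : T.Regular dv dc) (hdv : 3 ≤ dv)
    (hdc : 2 ≤ dc) {ℓ : ℕ} (hℓ : ℓ ≤ T.maxIter) : Real.exp (treeGrowthRate dv dc * ℓ) ≤ T.n := by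
  have pow_le : ((((dv - 1) * (dc - 1)) ^ ℓ : ℕ) : ℝ) ≤ T.n := by
    exact_mod_cast h.pow_le_n (by omega) (Tanner.lt_egirth_of_le_maxIter hℓ)
  rwa [treeGrowthRate, mul_comm, Real.exp_nat_mul,
    Real.exp_log (zero_lt_one.trans (one_lt_branching_real hdv hdc)),
    ← Nat.cast_pred (by omega), ← Nat.cast_pred (by omega), ← Nat.cast_mul, ← Nat.cast_pow]

lemma exists_of_mem_totalPowersAt (hdv : 3 ≤ dv) (hdc : 2 ≤ dc) (hξ : 0 ≤ ξ)
    (hP : P ∈ totalPowersAt (regularCodes dv dc) lam ξ η Pe PT) :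
    ∃ ℓ : ℕ, flipProb η PT ^ (ℓ + 1) ≤ Pe ∧
      PT + ξ * lam ^ 2 / 4 * Real.exp (treeGrowthRate dv dc * ℓ) ≤ P := by
  obtain ⟨T, hT, ℓ, hℓ, L, error_le, rfl⟩ := hP
  change T.Regular dv dc at hT
  rw [hT.bitErrorProb_eq_densityEvolution (by omega) _ hℓ] at error_le
  refine ⟨ℓ, (densityEvolution_mem_Icc ⟨flipProb_pos.le, flipProb_le_half⟩ (by omega) hdc
    ℓ).1.trans error_le, add_le_add_right ?_ PT⟩
  calc ξ * lam ^ 2 / 4 * Real.exp (treeGrowthRate dv dc * ℓ)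
      ≤ ξ * lam ^ 2 / 4 * T.n := by
        gcongr
        exact hT.exp_treeGrowthRate_mul_le hdv hdc hℓ
    _ = ξ * (lam ^ 2 * (T.n / 4)) := by ring
    _ ≤ ξ * L.wireArea lam := by
        gcongr
        exact hT.le_wireArea (by omega) L lam

lemma tendsto_log_one_div : Tendsto (fun Pe : ℝ => Real.log (1 / Pe)) (𝓝[>] 0) atTop := by
  simp only [one_div]
  exact Real.tendsto_log_atTop.comp tendsto_inv_nhdsGT_zero

lemma tendsto_log_log_one_div :
    Tendsto (fun Pe : ℝ => Real.log (Real.log (1 / Pe))) (𝓝[>] 0) atTop :=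
  Real.tendsto_log_atTop.comp tendsto_log_one_div

lemma log_one_div_le_mul {p : ℝ} {k : ℕ} (hp : 0 < p) (h : p ^ k ≤ Pe) :
    Real.log (1 / Pe) ≤ k * Real.log (1 / p) := by
  have log_pow_le := Real.log_le_log (pow_pos hp k) h
  rw [Real.log_pow] at log_pow_le
  rw [one_div, one_div, Real.log_inv, Real.log_inv]
  linarith

lemma eventually_log_le_mul_rpow {c r : ℝ} (hc : 0 < c) (hr : 0 < r) :
    ∀ᶠ x : ℝ in atTop, Real.log x ≤ c * x ^ r := by
  filter_upwards [(isLittleO_log_rpow_atTop hr).bound hc, eventually_ge_atTop 1]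
    with x log_le one_le
  rwa [Real.norm_of_nonneg (Real.log_nonneg one_le), Real.norm_of_nonneg (by positivity)]
    at log_le

lemma mul_add_one_le_two_mul_log {β s x t : ℝ} (hs : 0 < s) (hx : 0 < x)
    (hβ : β - Real.log s ≤ Real.log x) (h : s * Real.exp (β * t) ≤ x) :
    β * (t + 1) ≤ 2 * Real.log x := by
  have : β * t ≤ Real.log x - Real.log s := by
    rw [← Real.log_div hx.ne' hs.ne', Real.le_log_iff_exp_le (by positivity), le_div_iff₀' hs]
    exact h
  linarith

lemma powerScale_le_of_tradeoff {β s t : ℝ} (hβ : 0 ≤ β) (hs : 0 < s) (hη : 0 < η) (hPT : 0 ≤ PT)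
    (log_pos : 0 < Real.log (1 / Pe)) (loglog_pos : 0 < Real.log (Real.log (1 / Pe)))
    (loglog_le : Real.log (Real.log (1 / Pe)) ≤ β / 8 * Real.log (1 / Pe))
    (le_loglog : β / (8 * η) ≤ Real.log (Real.log (1 / Pe)))
    (sub_le_loglog : β - Real.log s ≤ Real.log (Real.log (1 / Pe)))
    (error : Real.log (1 / Pe) ≤ (t + 1) * (2 * (η * PT) + 2)) :
    1 / 8 * powerScale β η Pe ≤ PT + s * Real.exp (β * t) := by
  rw [powerScale]
  generalize Real.log (1 / Pe) = x at *
  have exp_pos := Real.exp_pos (β * t)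
  rcases le_total x (s * Real.exp (β * t)) with many_iterations | few_iterations
  · have scale_le : 1 / 8 * (β / η * x / Real.log x) ≤ x := by
      rw [show 1 / 8 * (β / η * x / Real.log x) = β / (8 * η) * x / Real.log x by field_simp,
        div_le_iff₀ loglog_pos, mul_comm x]
      gcongr
    linarith
  · have rate_le := mul_add_one_le_two_mul_log hs log_pos sub_le_loglog few_iterations
    have mul_le : β * x ≤ 2 * Real.log x * (2 * (η * PT) + 2) :=
      calc β * x ≤ β * ((t + 1) * (2 * (η * PT) + 2)) := by gcongr
        _ = β * (t + 1) * (2 * (η * PT) + 2) := by ring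
        _ ≤ 2 * Real.log x * (2 * (η * PT) + 2) := by gcongr
    have scale_le : 1 / 8 * (β / η * x / Real.log x) ≤ PT := by
      rw [show 1 / 8 * (β / η * x / Real.log x) = (β * x / 8) / (η * Real.log x) by field_simp,
        div_le_iff₀ (by positivity)]
      linarith
    linarith [mul_pos hs exp_pos]

lemma eventually_le_of_mem_totalPowersAt (hdv : 3 ≤ dv) (hdc : 2 ≤ dc) (hlam : 0 < lam)
    (hξ : 0 < ξ) (hη : 0 < η) :
    ∀ᶠ Pe in 𝓝[>] (0 : ℝ), ∀ PT, 0 ≤ PT → ∀ P ∈ totalPowersAt (regularCodes dv dc) lam ξ η Pe PT,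
      1 / 8 * powerScale (treeGrowthRate dv dc) η Pe ≤ P := by
  have rate_pos := treeGrowthRate_pos hdv hdc
  filter_upwards [tendsto_log_one_div.eventually
      (eventually_log_le_mul_rpow (c := treeGrowthRate dv dc / 8) (by positivity) one_pos),
    tendsto_log_one_div.eventually_gt_atTop 0, tendsto_log_log_one_div.eventually_gt_atTop 0,
    tendsto_log_log_one_div.eventually_ge_atTop (treeGrowthRate dv dc / (8 * η)),
    tendsto_log_log_one_div.eventually_ge_atTop
      (treeGrowthRate dv dc - Real.log (ξ * lam ^ 2 / 4))]
    with Pe loglog_le log_pos loglog_pos le_loglog sub_le_loglog PT hPT P hP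
  obtain ⟨ℓ, error_le, power_le⟩ := exists_of_mem_totalPowersAt hdv hdc hξ.le hP
  rw [Real.rpow_one] at loglog_le
  refine le_trans ?_ power_le
  refine powerScale_le_of_tradeoff rate_pos.le (by positivity) hη hPT log_pos loglog_pos loglog_le
    le_loglog sub_le_loglog ?_
  calc Real.log (1 / Pe) ≤ (ℓ + 1 : ℕ) * Real.log (1 / flipProb η PT) :=
        log_one_div_le_mul flipProb_pos error_le
    _ ≤ (ℓ + 1) * (2 * (η * PT) + 2) := by
        push_cast
        gcongr
        exact log_one_div_flipProb_le (by positivity)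

lemma totalPower_nonneg {𝒞 : Set Tanner} (hξ : 0 ≤ ξ) (hPT : 0 ≤ PT)
    (hP : P ∈ totalPowersAt 𝒞 lam ξ η Pe PT) : 0 ≤ P := by
  obtain ⟨T, -, ℓ, -, L, -, rfl⟩ := hP
  exact add_nonneg hPT (mul_nonneg hξ (L.wireArea_nonneg lam))

lemma totalPowerMin_le {𝒞 : Set Tanner} (hξ : 0 ≤ ξ) (hPT : 0 ≤ PT)
    (hP : P ∈ totalPowersAt 𝒞 lam ξ η Pe PT) : totalPowerMin 𝒞 lam ξ η Pe ≤ P :=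
  csInf_le ⟨0, fun _ ⟨_, h, h'⟩ => totalPower_nonneg hξ h h'⟩ ⟨PT, hPT, hP⟩

lemma totalPowersAt_mono {𝒞 𝒞' : Set Tanner} (h : 𝒞 ⊆ 𝒞') :
    totalPowersAt 𝒞 lam ξ η Pe PT ⊆ totalPowersAt 𝒞' lam ξ η Pe PT :=
  fun _ ⟨T, hT, h'⟩ => ⟨T, h hT, h'⟩

lemma exists_rpow_le_of_mem_totalPowersAt (hdv : 3 ≤ dv) (hdc : 2 ≤ dc) (hlam : 0 < lam)
    (hξ : 0 < ξ) (hPT : 0 ≤ PT) :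
    ∃ a k : ℝ, 0 < a ∧ 0 < k ∧ ∀ Pe, 0 < Pe →
      ∀ P ∈ totalPowersAt (regularCodes dv dc) lam ξ η Pe PT, k * (1 / Pe) ^ a ≤ P := by
  have rate_pos := treeGrowthRate_pos hdv hdc
  set β := treeGrowthRate dv dc with β_def
  have log_pos := log_one_div_flipProb_pos (η := η) (PT := PT)
  refine ⟨β / Real.log (1 / flipProb η PT), ξ * lam ^ 2 / 4 * Real.exp (-β), by positivity,
    by positivity, fun Pe hPe P hP => ?_⟩
  obtain ⟨ℓ, error_le, power_le⟩ := exists_of_mem_totalPowersAt hdv hdc hξ.le hP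
  rw [← β_def] at power_le
  have iterations : Real.log (1 / Pe) / Real.log (1 / flipProb η PT) ≤ ℓ + 1 := by
    rw [div_le_iff₀ log_pos]
    exact_mod_cast log_one_div_le_mul flipProb_pos error_le
  refine le_trans ?_ ((le_add_of_nonneg_left hPT).trans power_le)
  rw [mul_assoc, Real.rpow_def_of_pos (by positivity), ← Real.exp_add]
  gcongr
  calc -β + Real.log (1 / Pe) * (β / Real.log (1 / flipProb η PT))
      = -β + β * (Real.log (1 / Pe) / Real.log (1 / flipProb η PT)) := by ring
    _ ≤ -β + β * (ℓ + 1) := by gcongr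
    _ = β * ℓ := by ring

lemma eventually_exp_uncodedPower_le {a k : ℝ} (hη : 0 < η) (ha : 0 < a) (hk : 0 < k) :
    ∀ᶠ Pe in 𝓝[>] (0 : ℝ), Real.exp (a * η / 2 * uncodedPower η Pe) ≤ k * (1 / Pe) ^ a := by
  filter_upwards [Ioo_mem_nhdsGT (zero_lt_one' ℝ),
    tendsto_log_one_div.eventually_ge_atTop (-Real.log k * (2 / a))] with Pe hPe le_log
  rw [Real.rpow_def_of_pos (one_div_pos.mpr hPe.1), ← Real.exp_log hk, ← Real.exp_add,
    Real.exp_le_exp]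
  have uncoded_le : a * η / 2 * uncodedPower η Pe ≤ a / 2 * Real.log (1 / Pe) :=
    calc a * η / 2 * uncodedPower η Pe
        ≤ a * η / 2 * (Real.log (1 / Pe) / η) := by gcongr; exact uncodedPower_le hη hPe.1 hPe.2
      _ = a / 2 * Real.log (1 / Pe) := by field_simp
  have neg_log_le : -Real.log k ≤ a / 2 * Real.log (1 / Pe) :=
    calc -Real.log k = a / 2 * (-Real.log k * (2 / a)) := by field_simp
      _ ≤ a / 2 * Real.log (1 / Pe) := by gcongr
  linarith

end LowerBounds

/-! ### Upper bounds on the total power -/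

section UpperBounds

variable {dv dc : ℕ} {lam ξ η γ Pe PT : ℝ} {C : ℕ → Tanner}

lemma mul_flipProb_le_exp_neg {M u : ℝ} (hM : 0 < M) (hPT : 0 ≤ η * PT)
    (h : u + Real.log M ≤ η * PT) : M * flipProb η PT ≤ Real.exp (-u) :=
  calc M * flipProb η PT ≤ M * Real.exp (-(η * PT)) := by
        gcongr
        exact (flipProb_le_exp_neg hPT).trans (half_le_self (Real.exp_pos _).le)
    _ = Real.exp (Real.log M + -(η * PT)) := by rw [Real.exp_add, Real.exp_log hM]
    _ ≤ Real.exp (-u) := Real.exp_le_exp.mpr (by linarith)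

lemma log_two_mul_sq_nonneg (hdv : 0 < dv) (hdc : 0 < dc) :
    0 ≤ Real.log (2 * ((dv : ℝ) * dc) ^ 2) := by
  have : (1 : ℝ) ≤ dv * dc := by exact_mod_cast Nat.mul_pos hdv hdc
  exact Real.log_nonneg (by nlinarith)

lemma Tanner.Regular.bitErrorProb_le_exp {T : Tanner} (h : T.Regular dv dc) (hdv : 3 ≤ dv)
    (hdc : 2 ≤ dc) {ℓ : ℕ} (hℓ : ℓ ≤ T.maxIter) {u : ℝ} (hu : 0 ≤ u)
    (hPT : u + Real.log (2 * ((dv : ℝ) * dc) ^ 2) ≤ η * PT) :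
    T.bitErrorProb (flipProb η PT) ℓ ≤ Real.exp (-(u * (ℓ + 1))) := by
  have scaled_le : 2 * ((dv : ℝ) * dc) ^ 2 * flipProb η PT ≤ Real.exp (-u) :=
    mul_flipProb_le_exp_neg (by positivity)
      ((add_nonneg hu (log_two_mul_sq_nonneg (by omega) (by omega))).trans hPT) hPT
  rw [h.bitErrorProb_eq_densityEvolution (by omega) _ hℓ]
  calc densityEvolution (flipProb η PT) dv dc ℓ
      ≤ (2 * ((dv : ℝ) * dc) ^ 2 * flipProb η PT) ^ (ℓ + 1) :=
        densityEvolution_le flipProb_pos.le hdv hdc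
          (scaled_le.trans (Real.exp_le_one_iff.mpr (by linarith))) ℓ
    _ ≤ Real.exp (-u) ^ (ℓ + 1) := by
        have := flipProb_pos (η := η) (PT := PT)
        gcongr
    _ = Real.exp (-(u * (ℓ + 1))) := by
        rw [← Real.exp_nat_mul]
        push_cast
        ring_nf

lemma IsConstruction.range_subset (hC : IsConstruction dv dc γ C) :
    Set.range C ⊆ regularCodes dv dc :=
  Set.range_subset_iff.mpr fun N => (hC.1 N).1

lemma IsConstruction.exists_mem_totalPowersAt_le (hC : IsConstruction dv dc γ C) (hdv : 3 ≤ dv)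
    (hdc : 2 ≤ dc) (hξ : 0 ≤ ξ) :
    ∃ K, 0 ≤ K ∧ ∀ (PT Pe : ℝ) (N : ℕ), 0 < Pe → Pe < 1 →
      Real.log (1 / Pe) / (N + 1) + Real.log (2 * ((dv : ℝ) * dc) ^ 2) ≤ η * PT →
      ∃ P ∈ totalPowersAt (Set.range C) lam ξ η Pe PT, P ≤ PT + K * Real.exp (3 * (γ * N)) := by
  obtain ⟨hreg, a, A, -, hA⟩ := hC
  obtain ⟨K, K_nonneg, hK⟩ := Tanner.Regular.exists_wireArea_le (dv := dv) (dc := dc) (by omega)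
  have A_nonneg : 0 ≤ A := by
    have : (0 : ℝ) ≤ A * Real.exp (γ * (0 : ℕ)) := (Nat.cast_nonneg _).trans (hA 0).2
    simpa using this
  refine ⟨ξ * (lam ^ 2 * (K * A ^ 3)), by positivity, fun PT Pe N hPe₀ hPe₁ hPT => ?_⟩
  obtain ⟨L, area_le⟩ := hK lam (C N) (hreg N).1
  refine ⟨_, ⟨C N, ⟨N, rfl⟩, N, (hreg N).2, L, ?_, rfl⟩, add_le_add_right ?_ PT⟩
  · have log_pos := log_one_div_pos hPe₀ hPe₁
    have error_le := (hreg N).1.bitErrorProb_le_exp hdv hdc (hreg N).2 (by positivity) hPT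
    rwa [div_mul_cancel₀ _ (by positivity), exp_neg_log_one_div hPe₀] at error_le
  · calc ξ * L.wireArea lam
        ≤ ξ * (lam ^ 2 * (K * (A * Real.exp (γ * N)) ^ 3)) := by
          refine mul_le_mul_of_nonneg_left (area_le.trans ?_) hξ
          gcongr
          exact (hA N).2
      _ = ξ * (lam ^ 2 * (K * A ^ 3)) * Real.exp (3 * (γ * N)) := by
          rw [mul_pow, ← Real.exp_nat_mul]
          push_cast
          ring

lemma eventually_add_mul_sqrt_le (D : ℝ) {K c : ℝ} (hK : 0 ≤ K) (hc : 0 < c) :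
    ∀ᶠ x : ℝ in atTop, D + K * Real.sqrt x ≤ c * x / Real.log x := by
  filter_upwards [eventually_log_le_mul_rpow (c := c / (|D| + K + 1)) (by positivity) one_half_pos,
    eventually_gt_atTop 1] with x log_le one_lt
  rw [← Real.sqrt_eq_rpow] at log_le
  have one_le_sqrt : 1 ≤ Real.sqrt x := Real.one_le_sqrt.mpr one_lt.le
  rw [le_div_iff₀ (Real.log_pos one_lt)]
  calc (D + K * Real.sqrt x) * Real.log x
      ≤ ((|D| + K + 1) * Real.sqrt x) * (c / (|D| + K + 1) * Real.sqrt x) := by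
        refine mul_le_mul ?_ log_le (Real.log_nonneg one_lt.le) (by positivity)
        nlinarith [le_abs_self D, abs_nonneg D]
    _ = c * (Real.sqrt x * Real.sqrt x) := by field_simp
    _ = c * x := by rw [Real.mul_self_sqrt (by linarith)]

lemma eventually_tradeoff_le (D : ℝ) {K : ℝ} (hη : 0 < η) (hγ : 0 < γ) (hK : 0 ≤ K) :
    ∀ᶠ Pe in 𝓝[>] (0 : ℝ), ∃ N : ℕ,
      (Real.log (1 / Pe) / (N + 1) + D) / η + K * Real.exp (3 * (γ * N)) ≤
        7 * powerScale γ η Pe := by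
  filter_upwards [tendsto_log_one_div.eventually
      (eventually_add_mul_sqrt_le (D / η) hK (div_pos hγ hη)),
    tendsto_log_one_div.eventually_gt_atTop 0, tendsto_log_log_one_div.eventually_gt_atTop 0]
    with Pe overhead_le log_pos loglog_pos
  rw [powerScale]
  generalize Real.log (1 / Pe) = x at *
  refine ⟨⌊Real.log x / (6 * γ)⌋₊, ?_⟩
  set N := ⌊Real.log x / (6 * γ)⌋₊
  have le_div : (N : ℝ) ≤ Real.log x / (6 * γ) := Nat.floor_le (by positivity)
  have div_lt : Real.log x / (6 * γ) < N + 1 := Nat.lt_floor_add_one _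
  have wires_le : Real.exp (3 * (γ * N)) ≤ Real.sqrt x := by
    rw [le_div_iff₀ (by positivity)] at le_div
    rw [Real.sqrt_eq_rpow, Real.rpow_def_of_pos log_pos]
    exact Real.exp_le_exp.mpr (by linarith)
  have transmit_le : x / (N + 1) / η ≤ 6 * (γ / η * x / Real.log x) :=
    calc x / (N + 1) / η ≤ x / (Real.log x / (6 * γ)) / η := by gcongr
      _ = 6 * (γ / η * x / Real.log x) := by field_simp
  rw [add_div]
  linarith [mul_le_mul_of_nonneg_left wires_le hK]

lemma IsConstruction.eventually_exists_mem_totalPowersAt_le (hC : IsConstruction dv dc γ C)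
    (hdv : 3 ≤ dv) (hdc : 2 ≤ dc) (hξ : 0 ≤ ξ) (hη : 0 < η) (hγ : 0 < γ) :
    ∀ᶠ Pe in 𝓝[>] (0 : ℝ), ∃ PT, 0 ≤ PT ∧ ∃ P ∈ totalPowersAt (Set.range C) lam ξ η Pe PT,
      P ≤ 7 * powerScale γ η Pe := by
  obtain ⟨K, K_nonneg, hK⟩ := hC.exists_mem_totalPowersAt_le (lam := lam) (η := η) hdv hdc hξ
  filter_upwards [Ioo_mem_nhdsGT (zero_lt_one' ℝ),
    eventually_tradeoff_le (Real.log (2 * ((dv : ℝ) * dc) ^ 2)) hη hγ K_nonneg]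
    with Pe hPe ⟨N, tradeoff_le⟩
  have log_pos := log_one_div_pos hPe.1 hPe.2
  have overhead_nonneg := log_two_mul_sq_nonneg (dv := dv) (dc := dc) (by omega) (by omega)
  obtain ⟨P, hP, P_le⟩ := hK _ Pe N hPe.1 hPe.2 (mul_div_cancel₀ _ hη.ne').ge
  exact ⟨_, by positivity, P, hP, P_le.trans tradeoff_le⟩

lemma exists_forall_totalPowersAt_nonempty (hdv : 3 ≤ dv) (hdc : 2 ≤ dc) (hη : 0 < η)
    (lam ξ : ℝ) :
    ∃ Δ : ℝ, ∀ PT, Δ ≤ PT → ∀ Pe : ℝ, 0 < Pe →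
      (totalPowersAt (regularCodes dv dc) lam ξ η Pe PT).Nonempty := by
  obtain ⟨C, hreg, -⟩ := exists_isConstruction hdv hdc
  refine ⟨(1 + Real.log (2 * ((dv : ℝ) * dc) ^ 2)) / η, fun PT hPT Pe hPe => ?_⟩
  obtain ⟨N, neg_log_le⟩ := exists_nat_ge (-Real.log Pe)
  refine ⟨_, C N, (hreg N).1, N, (hreg N).2, (C N).rowLayout, ?_, rfl⟩
  refine ((hreg N).1.bitErrorProb_le_exp hdv hdc (hreg N).2 zero_le_one
    ((div_le_iff₀' hη).mp hPT)).trans ?_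
  rw [← Real.le_log_iff_exp_le hPe]
  linarith

end UpperBounds

/-! ### The order of growth of the optimal total power -/

section OrderOfGrowth

variable {dv dc : ℕ} {lam ξ η γ γ' Pe : ℝ}

lemma log_add_one_le_four_mul_treeGrowthRate (hdv : 3 ≤ dv) (hdc : 2 ≤ dc) :
    Real.log (2 * (dv : ℝ) * (dc : ℝ) + 1) ≤ 4 * treeGrowthRate dv dc := by
  have three_le_dv : (3 : ℝ) ≤ dv := by exact_mod_cast hdv
  have two_le_dc : (2 : ℝ) ≤ dc := by exact_mod_cast hdc
  have le_pow : 2 * (dv : ℝ) * dc + 1 ≤ (((dv : ℝ) - 1) * ((dc : ℝ) - 1)) ^ 4 := by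
    have two_le : 2 ≤ ((dv : ℝ) - 1) * ((dc : ℝ) - 1) := by nlinarith
    have mul_le : (dv : ℝ) * dc ≤ 3 * (((dv : ℝ) - 1) * ((dc : ℝ) - 1)) := by nlinarith
    generalize ((dv : ℝ) - 1) * ((dc : ℝ) - 1) = b at *
    nlinarith [pow_le_pow_left₀ zero_le_two two_le 3]
  rw [treeGrowthRate, ← Nat.cast_ofNat (n := 4), ← Real.log_pow]
  exact Real.log_le_log (by positivity) le_pow

lemma constructionRate_mem_gammaRange (hdv : 3 ≤ dv) (hdc : 2 ≤ dc) :
    3 * Real.log (2 * (dv : ℝ) * (dc : ℝ) + 1) ∈ gammaRange dv dc := by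
  have three_le_dv : (3 : ℝ) ≤ dv := by exact_mod_cast hdv
  have two_le_dc : (2 : ℝ) ≤ dc := by exact_mod_cast hdc
  have branching_le : ((dv : ℝ) - 1) * ((dc : ℝ) - 1) ≤ 2 * (dv : ℝ) * (dc : ℝ) + 1 := by nlinarith
  have log_le := Real.log_le_log (zero_lt_one.trans (one_lt_branching_real hdv hdc)) branching_le
  have log_pos := Real.log_pos (one_lt_branching_real hdv hdc)
  exact ⟨by linarith, le_rfl⟩

lemma pos_of_mem_gammaRange (hdv : 3 ≤ dv) (hdc : 2 ≤ dc) (hγ : γ ∈ gammaRange dv dc) : 0 < γ :=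
  (treeGrowthRate_pos hdv hdc).trans_le hγ.1

lemma powerScale_le_mul {k : ℝ} (hη : 0 < η) (h : γ ≤ k * γ') (log_pos : 0 < Real.log (1 / Pe))
    (loglog_pos : 0 < Real.log (Real.log (1 / Pe))) :
    powerScale γ η Pe ≤ k * powerScale γ' η Pe :=
  calc powerScale γ η Pe ≤ k * γ' / η * Real.log (1 / Pe) / Real.log (Real.log (1 / Pe)) := by
        unfold powerScale
        gcongr
    _ = k * powerScale γ' η Pe := by
        unfold powerScale
        ring

lemma eventually_totalPowerMin_bounds {C : ℕ → Tanner} {𝒞 : Set Tanner} (hdv : 3 ≤ dv)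
    (hdc : 2 ≤ dc) (hlam : 0 < lam) (hξ : 0 < ξ) (hη : 0 < η) (hγ' : γ' ∈ gammaRange dv dc)
    (hC : IsConstruction dv dc γ' C) (hC𝒞 : Set.range C ⊆ 𝒞) (h𝒞 : 𝒞 ⊆ regularCodes dv dc)
    (hγ : γ ∈ gammaRange dv dc) :
    ∀ᶠ Pe in 𝓝[>] (0 : ℝ), 1 / 96 * powerScale γ η Pe ≤ totalPowerMin 𝒞 lam ξ η Pe ∧
      totalPowerMin 𝒞 lam ξ η Pe ≤ 84 * powerScale γ η Pe := by
  have rate_le := log_add_one_le_four_mul_treeGrowthRate hdv hdc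
  have le_rate : γ ≤ 12 * treeGrowthRate dv dc := by linarith [hγ.2]
  have rate_le_mul : γ' ≤ 12 * γ := by
    have : treeGrowthRate dv dc ≤ γ := hγ.1
    linarith [hγ'.2]
  filter_upwards [tendsto_log_one_div.eventually_gt_atTop 0,
    tendsto_log_log_one_div.eventually_gt_atTop 0,
    eventually_le_of_mem_totalPowersAt hdv hdc hlam hξ hη,
    hC.eventually_exists_mem_totalPowersAt_le (lam := lam) hdv hdc hξ.le hη
      (pos_of_mem_gammaRange hdv hdc hγ')]
    with Pe log_pos loglog_pos le_power ⟨PT, hPT, P, hP, power_le⟩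
  have hP' := totalPowersAt_mono hC𝒞 hP
  constructor
  · refine le_csInf ⟨P, PT, hPT, hP'⟩ fun Q ⟨PT', hPT', hQ⟩ => ?_
    linarith [le_power PT' hPT' Q (totalPowersAt_mono h𝒞 hQ),
      powerScale_le_mul hη le_rate log_pos loglog_pos]
  · linarith [totalPowerMin_le hξ.le hPT hP',
      powerScale_le_mul hη rate_le_mul log_pos loglog_pos]

lemma eventually_uncodedPower_bounds {c₁ c₂ : ℝ} {power : ℝ → ℝ} (hη : 0 < η) (hγ : 0 < γ)
    (hc₁ : 0 < c₁) (hc₂ : 0 < c₂) (h : ∀ᶠ Pe in 𝓝[>] (0 : ℝ),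
      c₁ * powerScale γ η Pe ≤ power Pe ∧ power Pe ≤ c₂ * powerScale γ η Pe) :
    ∀ᶠ Pe in 𝓝[>] (0 : ℝ),
      1 / (4 * c₂ * γ) * Real.log (Real.log (1 / Pe)) * power Pe ≤ uncodedPower η Pe ∧
      uncodedPower η Pe ≤ 1 / (c₁ * γ) * Real.log (Real.log (1 / Pe)) * power Pe := by
  filter_upwards [h, Ioo_mem_nhdsGT (zero_lt_one' ℝ), tendsto_log_one_div.eventually_ge_atTop 4,
    tendsto_log_log_one_div.eventually_gt_atTop 0]
    with Pe ⟨le_power, power_le⟩ hPe four_le loglog_pos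
  have uncoded_le := uncodedPower_le hη hPe.1 hPe.2
  have le_uncoded := le_uncodedPower hη hPe.1 hPe.2
  rw [powerScale] at le_power power_le
  generalize Real.log (1 / Pe) = x at *
  constructor
  · calc 1 / (4 * c₂ * γ) * Real.log x * power Pe
        ≤ 1 / (4 * c₂ * γ) * Real.log x * (c₂ * (γ / η * x / Real.log x)) := by gcongr
      _ = x / 2 / (2 * η) := by
        field_simp
        norm_num
      _ ≤ (x - 2) / (2 * η) := by
        gcongr
        linarith
      _ ≤ uncodedPower η Pe := le_uncoded
  · calc uncodedPower η Pe ≤ x / η := uncoded_le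
      _ = 1 / (c₁ * γ) * Real.log x * (c₁ * (γ / η * x / Real.log x)) := by field_simp
      _ ≤ 1 / (c₁ * γ) * Real.log x * power Pe := by gcongr

end OrderOfGrowth

theorem mainTheorem3_general :
    ∃ c₁ c₂ : ℝ, 0 < c₁ ∧ c₁ ≤ c₂ ∧ ∀ dv dc : ℕ, 3 ≤ dv → 2 ≤ dc →
      (∃ γ ∈ gammaRange dv dc, ∃ C, IsConstruction dv dc γ C) ∧
      (∀ lam ξ η : ℝ, 0 < lam → 0 < ξ → 0 < η → ∀ γ ∈ gammaRange dv dc,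
        ∀ᶠ Pe in 𝓝[>] (0 : ℝ),
          c₁ * powerScale γ η Pe ≤ totalPowerMin (regularCodes dv dc) lam ξ η Pe ∧
          totalPowerMin (regularCodes dv dc) lam ξ η Pe ≤ c₂ * powerScale γ η Pe) ∧
      (∀ lam ξ η : ℝ, 0 < lam → 0 < ξ → 0 < η → ∀ γ ∈ gammaRange dv dc,
        ∀ C, IsConstruction dv dc γ C → ∀ᶠ Pe in 𝓝[>] (0 : ℝ),
          c₁ * powerScale γ η Pe ≤ totalPowerMin (Set.range C) lam ξ η Pe ∧
          totalPowerMin (Set.range C) lam ξ η Pe ≤ c₂ * powerScale γ η Pe) ∧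
      (∃ k₁ k₂ : ℝ, 0 < k₁ ∧ k₁ ≤ k₂ ∧ ∀ lam ξ η : ℝ, 0 < lam → 0 < ξ → 0 < η →
        ∀ᶠ Pe in 𝓝[>] (0 : ℝ),
          k₁ * Real.log (Real.log (1 / Pe)) * totalPowerMin (regularCodes dv dc) lam ξ η Pe
              ≤ uncodedPower η Pe ∧
          uncodedPower η Pe
              ≤ k₂ * Real.log (Real.log (1 / Pe)) *
                totalPowerMin (regularCodes dv dc) lam ξ η Pe) ∧
      (∀ lam ξ η PT : ℝ, 0 < lam → 0 < ξ → 0 < η → 0 ≤ PT →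
        (∃ a k : ℝ, 0 < a ∧ 0 < k ∧ ∀ᶠ Pe in 𝓝[>] (0 : ℝ),
          ∀ P ∈ totalPowersAt (regularCodes dv dc) lam ξ η Pe PT, k * (1 / Pe) ^ a ≤ P) ∧
        (∃ b : ℝ, 0 < b ∧ ∀ᶠ Pe in 𝓝[>] (0 : ℝ),
          ∀ P ∈ totalPowersAt (regularCodes dv dc) lam ξ η Pe PT,
            Real.exp (b * uncodedPower η Pe) ≤ P)) ∧
      (∀ lam ξ η : ℝ, 0 < lam → 0 < ξ → 0 < η → ∃ Δ : ℝ, ∀ PT, Δ ≤ PT → ∀ Pe : ℝ, 0 < Pe →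
        (totalPowersAt (regularCodes dv dc) lam ξ η Pe PT).Nonempty) := by
  refine ⟨1 / 96, 84, by norm_num, by norm_num, fun dv dc hdv hdc => ?_⟩
  have rate_mem := constructionRate_mem_gammaRange hdv hdc
  obtain ⟨C₀, hC₀⟩ := exists_isConstruction hdv hdc
  have all_codes : ∀ lam ξ η : ℝ, 0 < lam → 0 < ξ → 0 < η → ∀ γ ∈ gammaRange dv dc,
      ∀ᶠ Pe in 𝓝[>] (0 : ℝ),
        1 / 96 * powerScale γ η Pe ≤ totalPowerMin (regularCodes dv dc) lam ξ η Pe ∧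
        totalPowerMin (regularCodes dv dc) lam ξ η Pe ≤ 84 * powerScale γ η Pe :=
    fun lam ξ η hlam hξ hη γ hγ => eventually_totalPowerMin_bounds hdv hdc hlam hξ hη rate_mem hC₀
      hC₀.range_subset subset_rfl hγ
  refine ⟨⟨_, rate_mem, C₀, hC₀⟩, all_codes, fun lam ξ η hlam hξ hη γ hγ C hC => ?_, ?_,
    fun lam ξ η PT hlam hξ hη hPT => ?_, fun lam ξ η _ _ hη => ?_⟩
  · exact eventually_totalPowerMin_bounds hdv hdc hlam hξ hη hγ hC subset_rfl hC.range_subset hγ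
  · have rate_pos := pos_of_mem_gammaRange hdv hdc rate_mem
    refine ⟨_, _, by positivity, one_div_le_one_div_of_le (by positivity) (by linarith),
      fun lam ξ η hlam hξ hη => eventually_uncodedPower_bounds hη rate_pos (by norm_num)
        (by norm_num) (all_codes lam ξ η hlam hξ hη _ rate_mem)⟩
  · obtain ⟨a, k, ha, hk, rpow_le⟩ :=
      exists_rpow_le_of_mem_totalPowersAt (η := η) hdv hdc hlam hξ hPT
    refine ⟨⟨a, k, ha, hk, eventually_nhdsWithin_of_forall rpow_le⟩, a * η / 2, by positivity, ?_⟩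
    filter_upwards [eventually_exp_uncodedPower_le hη ha hk, self_mem_nhdsWithin]
      with Pe exp_le hPe P hP using exp_le.trans (rpow_le Pe hPe P hP)
  · exact exists_forall_totalPowersAt_nonempty hdv hdc hη lam ξ

theorem mainTheorem3 :
    -- absolute constants of the order-of-growth claims
    ∃ c₁ c₂ : ℝ, 0 < c₁ ∧ c₁ ≤ c₂ ∧ ∀ dv dc : ℕ, 3 ≤ dv → dv < dc →
      -- there are code constructions with a growth rate in the stated range
      (∃ γ ∈ gammaRange dv dc, ∃ C, IsConstruction dv dc γ C) ∧
      -- optimal total power over all regular codes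
      (∀ lam ξ η : ℝ, 0 < lam → 0 < ξ → 0 < η → ∀ γ ∈ gammaRange dv dc,
        ∀ᶠ Pe in 𝓝[>] (0 : ℝ),
          c₁ * powerScale γ η Pe ≤ totalPowerMin (regularCodes dv dc) lam ξ η Pe ∧
          totalPowerMin (regularCodes dv dc) lam ξ η Pe ≤ c₂ * powerScale γ η Pe) ∧
      -- optimal total power for a code construction with growth rate `γ`
      (∀ lam ξ η : ℝ, 0 < lam → 0 < ξ → 0 < η → ∀ γ ∈ gammaRange dv dc,
        ∀ C, IsConstruction dv dc γ C → ∀ᶠ Pe in 𝓝[>] (0 : ℝ),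
          c₁ * powerScale γ η Pe ≤ totalPowerMin (Set.range C) lam ξ η Pe ∧
          totalPowerMin (Set.range C) lam ξ η Pe ≤ c₂ * powerScale γ η Pe) ∧
      -- uncoded transmission needs more power by a factor of order `log log (1 / Pe)`
      (∃ k₁ k₂ : ℝ, 0 < k₁ ∧ k₁ ≤ k₂ ∧ ∀ lam ξ η : ℝ, 0 < lam → 0 < ξ → 0 < η →
        ∀ᶠ Pe in 𝓝[>] (0 : ℝ),
          k₁ * Real.log (Real.log (1 / Pe)) * totalPowerMin (regularCodes dv dc) lam ξ η Pe
              ≤ uncodedPower η Pe ∧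
          uncodedPower η Pe
              ≤ k₂ * Real.log (Real.log (1 / Pe)) *
                totalPowerMin (regularCodes dv dc) lam ξ η Pe) ∧
      -- fixed transmit power: polynomial growth in `1 / Pe`, exponential in the uncoded power
      (∀ lam ξ η PT : ℝ, 0 < lam → 0 < ξ → 0 < η → 0 ≤ PT →
        (∃ a k : ℝ, 0 < a ∧ 0 < k ∧ ∀ᶠ Pe in 𝓝[>] (0 : ℝ),
          ∀ P ∈ totalPowersAt (regularCodes dv dc) lam ξ η Pe PT, k * (1 / Pe) ^ a ≤ P) ∧
        (∃ b : ℝ, 0 < b ∧ ∀ᶠ Pe in 𝓝[>] (0 : ℝ),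
          ∀ P ∈ totalPowersAt (regularCodes dv dc) lam ξ η Pe PT,
            Real.exp (b * uncodedPower η Pe) ≤ P)) ∧
      -- every sufficiently large fixed transmit power reaches every bit-error probability
      (∀ lam ξ η : ℝ, 0 < lam → 0 < ξ → 0 < η → ∃ Δ : ℝ, ∀ PT, Δ ≤ PT → ∀ Pe : ℝ, 0 < Pe →
        (totalPowersAt (regularCodes dv dc) lam ξ η Pe PT).Nonempty) := by
  obtain ⟨c₁, c₂, hc₁, hc₁₂, h⟩ := mainTheorem3_general
  exact ⟨c₁, c₂, hc₁, hc₁₂, fun dv dc hdv hlt => h dv dc hdv (by omega)⟩
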